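/- Let $V$ be a real $8$-dimensional vector space with a positive definite inner product $g$ and a hyper-Hermitian structure: $g$-orthogonal endomorphisms $J_1,J_2,J_3$ with $J_s^2=-\mathrm{Id}$ and $J_1J_2=-J_2J_1=J_3$. Let $Sp(2)\subset GL(V)$ be the group of isometries commuting with all $J_s$, let $Sp(1)=\{x_0\mathrm{Id}+\sum_s x_sJ_s : \sum_{s=0}^3 x_s^2=1\}$, let $\mathcal Q=\mathrm{span}_{\mathbb R}\{J_1,J_2,J_3\}$ and $Sp(2)Sp(1)=\{A\in SO(V): A\mathcal QA^{-1}\subset\mathcal Q\}$. Extend $g$, $J_s$ and tensors on $V$ complex (multi)linearly to $V^{\mathbb C}=V\otimes\mathbb C=W\oplus\overline W$, where $W$ and $\overline W$ are the $\pm i$-eigenspaces of $J_1$. Put $jx=J_2\bar x$ and $\pi(x,y)=-g(x,J_2y)$ for $x,y\in W$. A basis $e=(e_1,e_2,e_3,e_4)$ of $W$ is called $Sp(2)$-adapted if $e_3=je_1$, $e_4=je_2$ and $\pi=e^1\wedge e^3+e^2\wedge e^4$. Let $\mathfrak S$ be the space of totally symmetric real $4$-tensors $S$ on $V$ that lie in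 $S^4(W^*)+S^4(\overline W^*)$ and satisfy $S(J_2x,J_2y,J_2z,J_2w)=S(x,y,z,w)$. Let $\mathfrak R$ be the space of hyper-Kähler curvature-type tensors on $V$, i.e. of those $K\in\Lambda^2V^*\otimes\Lambda^2V^*$ with $K(x,y,z,w)+K(y,z,x,w)+K(z,x,y,w)=0$ and $K(x,y,J_sz,J_sw)=K(x,y,z,w)$ for $s=1,2,3$. For $S\in\mathfrak S$ put $\mathcal K(S)(x,y,z,w)=S(x,J_2y,z,J_2w)-S(x,J_2y,J_2z,w)$. The group $GL(V)$ acts on $4$-tensors by $(A\cdot T)(x,y,z,w)=T(A^{-1}x,A^{-1}y,A^{-1}z,A^{-1}w)$. For an $Sp(2)$-adapted basis $e$, the cubic discriminant $\hat S=\hat S_e\in\mathfrak S$ is the tensor with $$\hat S(x,x,x,x)=-18x^1x^2x^3x^4+4\sqrt3\,x^1(x^4)^3-4\sqrt3\,(x^2)^3x^3+3(x^2)^2(x^4)^2-9(x^1)^2(x^3)^2,\qquad x=x^\alpha e_\alpha\in W .$$ The orbit $\mathcal C\subset\mathfrak R$ is the set of all $K\in\mathfrak R$ such that $K=\mathcal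 K(\hat S_e)$ for some $Sp(2)$-adapted basis $e$. Let $\Delta=\mathbb C^2$ be the standard representation of $Sp(1)\cong SU(2)$ with standard basis $d_1,d_2$. Identify $S^3\Delta$ with $W$ by sending $d_1^{\otimes3}$, $\frac1{\sqrt3}(d_1d_1d_2+d_1d_2d_1+d_2d_1d_1)$, $d_2^{\otimes3}$, $-\frac1{\sqrt3}(d_1d_2d_2+d_2d_1d_2+d_2d_2d_1)$ (products are tensor products) to $e_1,e_2,e_3,e_4$ respectively. Let $Sp(1)_{ir}\subset GL(V)$ be the group of those transformations of $V$ that act on $W\cong S^3\Delta$ as elements of $SU(2)$, and let $SO(4)_{ir}=Sp(1)_{ir}\,Sp(1)\subset GL(V)$. **Proposition.** $Sp(2)$-adapted bases exist, and for each of them the tensor $\hat S$ exists and is unique. For every $Sp(2)$-adapted basis: 1. the stabilizer of $\hat S$ in $Sp(2)$ is exactly $Sp(1)_{ir}$; 2. the stabilizer of $\hat K=\mathcal K(\hat S)$ in $Sp(2)Sp(1)$ is exactly $SO(4)_{ir}$; 3. $\mathcal C$ is a $7$-dimensional smooth embedded submanifold of $\mathfrak R$, and the orbit maps $A\,Sp(1)_{ir}\mapsto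 A\cdot\hat K$ and $A\,SO(4)_{ir}\mapsto A\cdot\hat K$ are well defined and are diffeomorphisms $$\frac{Sp(2)}{Sp(1)_{ir}}\;\cong\;\mathcal C\;\cong\;\frac{Sp(2)Sp(1)}{SO(4)_{ir}} .$$ Here $Sp(2)$ and $Sp(2)Sp(1)$, of dimensions $10$ and $13$, carry their smooth structures as embedded submanifolds of $\mathrm{End}(V)$, and the quotients carry the smooth structures for which the projections are smooth submersions. -/

import Mathlib

open scoped Manifold ContDiff TensorProduct

noncomputable section

/-! ### Complexification of a real vector space -/

/-- The complexification `V^ℂ = ℂ ⊗ V` of a real vector space. -/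
abbrev Cplx (V : Type*) [AddCommGroup V] [Module ℝ V] : Type _ := ℂ ⊗[ℝ] V

namespace Cplx

variable {V : Type*} [NormedAddCommGroup V] [InnerProductSpace ℝ V]

/-- Real part of a vector of `V^ℂ`. -/
def re : Cplx V →ₗ[ℝ] V := (TensorProduct.lid ℝ V).toLinearMap ∘ₗ Complex.reLm.rTensor V

/-- Imaginary part of a vector of `V^ℂ`. -/
def im : Cplx V →ₗ[ℝ] V := (TensorProduct.lid ℝ V).toLinearMap ∘ₗ Complex.imLm.rTensor V

/-- Complex conjugation `z ⊗ v ↦ z̄ ⊗ v` on `V^ℂ`. -/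
def conj : Cplx V →ₗ[ℝ] Cplx V := Complex.conjAe.toLinearMap.rTensor V

/-- The complex linear extension to `V^ℂ` of an endomorphism of `V`. -/
def ext (A : V →L[ℝ] V) : Cplx V →ₗ[ℂ] Cplx V := (A : V →ₗ[ℝ] V).baseChange ℂ

/-- The complex bilinear extension to `V^ℂ` of the inner product `g` of `V`. -/
def g : LinearMap.BilinForm ℂ (Cplx V) := LinearMap.BilinForm.baseChange ℂ (innerₗ V)

end Cplx

/-! ### Covariant 4-tensors -/

/-- The (normed) space of real covariant 4-tensors on `V`. -/
abbrev Tensor4 (V : Type*) [NormedAddCommGroup V] [InnerProductSpace ℝ V] : Type _ :=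
  ContinuousMultilinearMap ℝ (fun _ : Fin 4 => V) ℝ

namespace Tensor4

variable {V : Type*} [NormedAddCommGroup V] [InnerProductSpace ℝ V]

/-- The complex multilinear extension of a real 4-tensor to `V^ℂ`: expand every argument as
`x k = re (x k) + i im (x k)`; `s` is the set of positions where the imaginary part is taken. -/
def ext (T : Tensor4 V) (x : Fin 4 → Cplx V) : ℂ :=
  ∑ s : Finset (Fin 4), Complex.I ^ s.card *
    (T (fun k => if k ∈ s then Cplx.im (x k) else Cplx.re (x k)) : ℂ)

/-- The natural action of `GL(V)` on covariant 4-tensors,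
`(A · T)(x, y, z, w) = T(A⁻¹ x, A⁻¹ y, A⁻¹ z, A⁻¹ w)`. -/
def act (A : (V →L[ℝ] V)ˣ) (T : Tensor4 V) : Tensor4 V :=
  T.compContinuousLinearMap (fun _ => ((A⁻¹ : (V →L[ℝ] V)ˣ) : V →L[ℝ] V))

end Tensor4

/-! ### Hyper-Hermitian structures -/

/-- A hyper-Hermitian structure on a real inner product space `(V, g)`. -/
structure HyperHermitian (V : Type*) [NormedAddCommGroup V] [InnerProductSpace ℝ V] where
  J₁ : V →L[ℝ] V
  J₂ : V →L[ℝ] V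
  J₃ : V →L[ℝ] V
  J₁_mul_J₂ : J₁ * J₂ = J₃
  J₂_mul_J₁ : J₂ * J₁ = -J₃
  J₁_sq : J₁ * J₁ = -1
  J₂_sq : J₂ * J₂ = -1
  J₃_sq : J₃ * J₃ = -1
  inner_J₁ : ∀ x y, inner ℝ (J₁ x) (J₁ y) = inner ℝ x y
  inner_J₂ : ∀ x y, inner ℝ (J₂ x) (J₂ y) = inner ℝ x y
  inner_J₃ : ∀ x y, inner ℝ (J₃ x) (J₃ y) = inner ℝ x y

namespace HyperHermitian

variable {V : Type*} [NormedAddCommGroup V] [InnerProductSpace ℝ V] (h : HyperHermitian V)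

/-! #### The groups `Sp(n)`, `Sp(1)` and `Sp(n)Sp(1)` in `GL(V)` -/

/-- `Sp(n)`: the linear transformations preserving the metric and commuting with all `J_s`. -/
def Sp : Subgroup (V →L[ℝ] V)ˣ where
  carrier := {A | (∀ x y, inner ℝ ((A : V →L[ℝ] V) x) ((A : V →L[ℝ] V) y) = inner ℝ x y) ∧
    (A : V →L[ℝ] V) * h.J₁ = h.J₁ * A ∧ (A : V →L[ℝ] V) * h.J₂ = h.J₂ * A ∧
    (A : V →L[ℝ] V) * h.J₃ = h.J₃ * A}
  one_mem' := by simp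
  mul_mem' := by
    rintro A B ⟨hA, hA1, hA2, hA3⟩ ⟨hB, hB1, hB2, hB3⟩
    refine ⟨fun x y => by simp [hA, hB], ?_, ?_, ?_⟩
    · rw [Units.val_mul, mul_assoc, hB1, ← mul_assoc, hA1, mul_assoc]
    · rw [Units.val_mul, mul_assoc, hB2, ← mul_assoc, hA2, mul_assoc]
    · rw [Units.val_mul, mul_assoc, hB3, ← mul_assoc, hA3, mul_assoc]
  inv_mem' := by
    rintro A ⟨hA, hA1, hA2, hA3⟩
    have key : ∀ x, (A : V →L[ℝ] V) (((A⁻¹ : (V →L[ℝ] V)ˣ) : V →L[ℝ] V) x) = x := fun x =>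
      congrArg (fun T : V →L[ℝ] V => T x) (Units.mul_inv A)
    refine ⟨fun x y => ?_, ?_, ?_, ?_⟩
    · rw [← hA, key, key]
    · exact (Commute.units_inv_left (u := A) hA1)
    · exact (Commute.units_inv_left (u := A) hA2)
    · exact (Commute.units_inv_left (u := A) hA3)

/-- `x₀ Id + x₁ J₁ + x₂ J₂ + x₃ J₃`. -/
def quat (x : Fin 4 → ℝ) : V →L[ℝ] V :=
  x 0 • (1 : V →L[ℝ] V) + x 1 • h.J₁ + x 2 • h.J₂ + x 3 • h.J₃

theorem quat_mul (x y : Fin 4 → ℝ) : h.quat x * h.quat y = h.quat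
    ![x 0 * y 0 - x 1 * y 1 - x 2 * y 2 - x 3 * y 3, x 0 * y 1 + x 1 * y 0 + x 2 * y 3 - x 3 * y 2,
      x 0 * y 2 - x 1 * y 3 + x 2 * y 0 + x 3 * y 1,
      x 0 * y 3 + x 1 * y 2 - x 2 * y 1 + x 3 * y 0] := by
  have h12 := h.J₁_mul_J₂
  have h21 := h.J₂_mul_J₁
  have h11 := h.J₁_sq
  have h22 := h.J₂_sq
  have h33 := h.J₃_sq
  have h13 : h.J₁ * h.J₃ = -h.J₂ := by rw [← h12, ← mul_assoc, h11]; simp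
  have h31 : h.J₃ * h.J₁ = h.J₂ := by rw [← neg_eq_iff_eq_neg.mpr h21, neg_mul, mul_assoc, h11]; simp
  have h23 : h.J₂ * h.J₃ = h.J₁ := by
    rw [← neg_eq_iff_eq_neg.mpr h21, mul_neg, ← mul_assoc, h22]; simp
  have h32 : h.J₃ * h.J₂ = -h.J₁ := by rw [← h12, mul_assoc, h22]; simp
  simp only [quat, add_mul, mul_add, smul_mul_assoc, mul_smul_comm, one_mul, mul_one, h11, h12, h13,
    h21, h22, h23, h31, h32, h33, Matrix.cons_val_zero, Matrix.cons_val_one, Matrix.cons_val]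
  module

/-- `Sp(1) = {x₀ Id + ∑ x_s J_s | ∑ x_s² = 1}`. -/
def SpOne : Subgroup (V →L[ℝ] V)ˣ where
  carrier := {A | ∃ x : Fin 4 → ℝ, ∑ s, x s ^ 2 = 1 ∧ (A : V →L[ℝ] V) = h.quat x}
  one_mem' := ⟨![1, 0, 0, 0], by simp [Fin.sum_univ_four], by simp [quat]⟩
  mul_mem' := by
    rintro A B ⟨x, hx, hA⟩ ⟨y, hy, hB⟩
    refine ⟨_, ?_, by rw [Units.val_mul, hA, hB, quat_mul]⟩
    simp only [Fin.sum_univ_four] at hx hy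
    simp only [Fin.sum_univ_four, Matrix.cons_val_zero, Matrix.cons_val_one, Matrix.cons_val]
    linear_combination (y 0 ^ 2 + y 1 ^ 2 + y 2 ^ 2 + y 3 ^ 2) * hx + hy
  inv_mem' := by
    rintro A ⟨x, hx, hA⟩
    refine ⟨![x 0, - x 1, - x 2, - x 3], ?_, ?_⟩
    · simpa [Fin.sum_univ_four] using hx
    · apply Units.inv_eq_of_mul_eq_one_right
      rw [hA, quat_mul]
      simp only [Fin.sum_univ_four] at hx
      have e : x 0 * x 0 + x 1 * x 1 + x 2 * x 2 + x 3 * x 3 = 1 := by linarith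
      simp only [quat, Matrix.cons_val_zero, Matrix.cons_val_one, Matrix.cons_val]
      have h0 : x 0 * x 0 - x 1 * -x 1 - x 2 * -x 2 - x 3 * -x 3 = 1 := by linarith
      have h1 : x 0 * -x 1 + x 1 * x 0 + x 2 * -x 3 - x 3 * -x 2 = 0 := by ring
      have h2 : x 0 * -x 2 - x 1 * -x 3 + x 2 * x 0 + x 3 * -x 1 = 0 := by ring
      have h3 : x 0 * -x 3 + x 1 * -x 2 - x 2 * -x 1 + x 3 * x 0 = 0 := by ring
      rw [h0, h1, h2, h3]
      simp

/-- `𝒬 = span {J₁, J₂, J₃} ⊂ End(V)`. -/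
def Q : Submodule ℝ (V →L[ℝ] V) := Submodule.span ℝ {h.J₁, h.J₂, h.J₃}

/-- `Sp(n)Sp(1) = {A ∈ SO(V) | A 𝒬 A⁻¹ ⊂ 𝒬}`. -/
def SpSpOne : Subgroup (V →L[ℝ] V)ˣ where
  carrier := {A | (∀ x y, inner ℝ ((A : V →L[ℝ] V) x) ((A : V →L[ℝ] V) y) = inner ℝ x y) ∧
    LinearMap.det ((A : V →L[ℝ] V) : V →ₗ[ℝ] V) = 1 ∧
    ∀ q ∈ h.Q, (A : V →L[ℝ] V) * q * ((A⁻¹ : (V →L[ℝ] V)ˣ) : V →L[ℝ] V) ∈ h.Q}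
  one_mem' := by
    refine ⟨by simp, ?_, by simp⟩
    exact LinearMap.det_id
  mul_mem' := by
    rintro A B ⟨hA, hA1, hA2⟩ ⟨hB, hB1, hB2⟩
    refine ⟨fun x y => by simp [hA, hB], ?_, fun q hq => ?_⟩
    · rw [Units.val_mul, ContinuousLinearMap.toLinearMap_mul, map_mul, hA1, hB1, one_mul]
    · have := hA2 _ (hB2 q hq)
      simpa [mul_inv_rev, mul_assoc] using this
  inv_mem' := by
    rintro A ⟨hA, hA1, hA2⟩
    have key : ∀ x, (A : V →L[ℝ] V) (((A⁻¹ : (V →L[ℝ] V)ˣ) : V →L[ℝ] V) x) = x := fun x =>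
      congrArg (fun T : V →L[ℝ] V => T x) (Units.mul_inv A)
    refine ⟨fun x y => by rw [← hA, key, key], ?_, fun q hq => ?_⟩
    · have := congrArg (fun T : V →L[ℝ] V => LinearMap.det (T : V →ₗ[ℝ] V)) (Units.mul_inv A)
      simp only [ContinuousLinearMap.toLinearMap_mul, map_mul, hA1, one_mul] at this
      rw [this]
      exact LinearMap.det_id
    · -- conjugation by `A` is injective on the finite-dimensional space `𝒬`, hence onto
      have hfin : FiniteDimensional ℝ h.Q :=
        FiniteDimensional.span_of_finite ℝ (by simp)
      let c : h.Q →ₗ[ℝ] h.Q :=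
        { toFun := fun q => ⟨_, hA2 q q.2⟩
          map_add' := fun p q => by ext1; simp [mul_add, add_mul]
          map_smul' := fun r q => by ext1; simp }
      have hinj : Function.Injective c := by
        intro p q hpq
        have hpq := congrArg Subtype.val hpq
        simp only [c, LinearMap.coe_mk, AddHom.coe_mk] at hpq
        ext1
        exact (Units.mul_right_inj A).1 ((Units.mul_left_inj A⁻¹).1 hpq)
      obtain ⟨p, hp⟩ := (LinearMap.injective_iff_surjective.1 hinj) ⟨q, hq⟩
      have hp := congrArg Subtype.val hp
      simp only [c, LinearMap.coe_mk, AddHom.coe_mk] at hp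
      rw [← hp]
      simp [mul_assoc]

/-! #### Complex geometry of `V^ℂ = W ⊕ W̄` -/

/-- `W`: the `i`-eigenspace of `J₁` in `V^ℂ`. -/
def W : Submodule ℂ (Cplx V) := LinearMap.ker (Cplx.ext h.J₁ - Complex.I • LinearMap.id)

/-- `W̄`: the `(-i)`-eigenspace of `J₁` in `V^ℂ`. -/
def Wbar : Submodule ℂ (Cplx V) := LinearMap.ker (Cplx.ext h.J₁ + Complex.I • LinearMap.id)

/-- The antilinear map `j x = J₂ x̄`. -/
def j (x : Cplx V) : Cplx V := Cplx.ext h.J₂ (Cplx.conj x)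

/-- The complex 2-form `π`, determined by `g(x, y) = π(x, J₂ y)`, i.e. `π(x, y) = -g(x, J₂ y)`. -/
def pi (x y : Cplx V) : ℂ := -Cplx.g x (Cplx.ext h.J₂ y)

/-- A basis `e₁, e₂, e₃, e₄` of `W` (indexed from `0`) is `Sp(2)`-adapted if `e₃ = j e₁`,
`e₄ = j e₂` and `π = e¹ ∧ e³ + e² ∧ e⁴`. -/
structure IsAdapted (e : Module.Basis (Fin 4) ℂ h.W) : Prop where
  j_zero : (e 2 : Cplx V) = h.j (e 0)
  j_one : (e 3 : Cplx V) = h.j (e 1)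
  pi_eq : ∀ x y : h.W, h.pi x y =
    (e.repr x 0 * e.repr y 2 - e.repr x 2 * e.repr y 0) +
    (e.repr x 1 * e.repr y 3 - e.repr x 3 * e.repr y 1)

/-! #### The tensor spaces `𝔖^{Sp(n)}` and `ℜ^{Sp(n)}` -/

/-- Membership in `𝔖^{Sp(n)}`: real totally symmetric 4-tensors on `V` whose complex extension lies
in `S⁴(W*) + S⁴(W̄*)` (no mixed components) and which are invariant under `J₂`. -/
structure IsSymType (S : Tensor4 V) : Prop where
  symm : ∀ (σ : Equiv.Perm (Fin 4)) (x : Fin 4 → V), S (x ∘ σ) = S x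
  mixed : ∀ x : Fin 4 → Cplx V, x 0 ∈ h.W → x 1 ∈ h.Wbar → S.ext x = 0
  J₂_inv : ∀ x : Fin 4 → V, S (fun k => h.J₂ (x k)) = S x

/-- `ℜ^{Sp(n)}`: the space of hyper-Kähler curvature-type tensors on `V`. -/
def Curv : Submodule ℝ (Tensor4 V) where
  carrier := {K | (∀ x y z w, K ![x, y, z, w] = -K ![y, x, z, w]) ∧
    (∀ x y z w, K ![x, y, z, w] = -K ![x, y, w, z]) ∧
    (∀ x y z w, K ![x, y, z, w] + K ![y, z, x, w] + K ![z, x, y, w] = 0) ∧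
    (∀ x y z w, K ![x, y, h.J₁ z, h.J₁ w] = K ![x, y, z, w]) ∧
    (∀ x y z w, K ![x, y, h.J₂ z, h.J₂ w] = K ![x, y, z, w]) ∧
    (∀ x y z w, K ![x, y, h.J₃ z, h.J₃ w] = K ![x, y, z, w])}
  zero_mem' := by simp
  add_mem' := by
    rintro K L ⟨a1, a2, a3, a4, a5, a6⟩ ⟨b1, b2, b3, b4, b5, b6⟩
    refine ⟨fun x y z w => ?_, fun x y z w => ?_, fun x y z w => ?_, fun x y z w => ?_,
      fun x y z w => ?_, fun x y z w => ?_⟩ <;> simp only [add_apply]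
    · rw [a1, b1]; ring
    · rw [a2, b2]; ring
    · linear_combination a3 x y z w + b3 x y z w
    · rw [a4, b4]
    · rw [a5, b5]
    · rw [a6, b6]
  smul_mem' := by
    rintro c K ⟨a1, a2, a3, a4, a5, a6⟩
    refine ⟨fun x y z w => ?_, fun x y z w => ?_, fun x y z w => ?_, fun x y z w => ?_,
      fun x y z w => ?_, fun x y z w => ?_⟩ <;>
      simp only [smul_apply, smul_eq_mul]
    · rw [a1]; ring
    · rw [a2]; ring
    · linear_combination c * a3 x y z w
    · rw [a4]
    · rw [a5]
    · rw [a6]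

/-- The map `𝒦(S)(x, y, z, w) = S(x, J₂ y, z, J₂ w) - S(x, J₂ y, J₂ z, w)`. -/
def calK (S : Tensor4 V) : Tensor4 V :=
  S.compContinuousLinearMap ![1, h.J₂, 1, h.J₂] - S.compContinuousLinearMap ![1, h.J₂, h.J₂, 1]

/-! #### Cubic discriminants -/

/-- The discriminant of a cubic polynomial in the coordinates of an adapted basis: with
`x¹ = a`, `x² = b/√3`, `x³ = d`, `x⁴ = -c/√3` it is a third of the discriminant of
`a t³ + b t² + c t + d`. -/
def disc (x : Fin 4 → ℂ) : ℂ :=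
  -18 * x 0 * x 1 * x 2 * x 3 + 4 * (Real.sqrt 3 : ℂ) * x 0 * x 3 ^ 3
    - 4 * (Real.sqrt 3 : ℂ) * x 1 ^ 3 * x 2 + 3 * x 1 ^ 2 * x 3 ^ 2 - 9 * x 0 ^ 2 * x 2 ^ 2

/-- `S ∈ 𝔖^{Sp(2)}` is the cubic discriminant `Ŝ` with respect to the basis `e` of `W`. -/
def IsDiscTensor (e : Module.Basis (Fin 4) ℂ h.W) (S : Tensor4 V) : Prop :=
  h.IsSymType S ∧ ∀ x : h.W, S.ext (fun _ => (x : Cplx V)) = disc (e.repr x)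

/-- The set `𝒞 ⊂ ℜ^{Sp(2)}` of all `K` for which `S = 𝒦⁻¹(K) ∈ 𝔖^{Sp(2)}` is the cubic discriminant
with respect to some `Sp(2)`-adapted basis of `W`. -/
def orbitC : Set h.Curv :=
  {K | ∃ S : Tensor4 V, h.IsSymType S ∧ h.calK S = K ∧
    ∃ e : Module.Basis (Fin 4) ℂ h.W, h.IsAdapted e ∧ h.IsDiscTensor e S}

end HyperHermitian

/-! ### The irreducible representation of `Sp(1)` on `S³Δ`, `Δ = ℂ²` -/

namespace SymCube

/-- The standard representation space of `Sp(1) = SU(2)`. -/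
abbrev Delta : Type := Fin 2 → ℂ

/-- `Δ ⊗ Δ ⊗ Δ`. -/
abbrev Cube : Type := (Delta ⊗[ℂ] Delta) ⊗[ℂ] Delta

/-- `x ⊗ y ⊗ z ↦ y ⊗ x ⊗ z`. -/
def swap₁₂ : Cube →ₗ[ℂ] Cube := (TensorProduct.comm ℂ Delta Delta).toLinearMap.rTensor Delta

/-- `x ⊗ y ⊗ z ↦ x ⊗ z ⊗ y`. -/
def swap₂₃ : Cube →ₗ[ℂ] Cube :=
  (TensorProduct.assoc ℂ Delta Delta Delta).symm.toLinearMap ∘ₗ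
    (TensorProduct.comm ℂ Delta Delta).toLinearMap.lTensor Delta ∘ₗ
      (TensorProduct.assoc ℂ Delta Delta Delta).toLinearMap

/-- `S³Δ`: the symmetric tensors in `Δ ⊗ Δ ⊗ Δ`. -/
def S3 : Submodule ℂ Cube :=
  LinearMap.eqLocus swap₁₂ LinearMap.id ⊓ LinearMap.eqLocus swap₂₃ LinearMap.id

theorem mem_S3 {t : Cube} : t ∈ S3 ↔ swap₁₂ t = t ∧ swap₂₃ t = t := by
  simp [S3, LinearMap.mem_eqLocus]

/-- `A ⊗ A ⊗ A` on `Δ ⊗ Δ ⊗ Δ`. -/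
def cubeAct (A : Matrix (Fin 2) (Fin 2) ℂ) : Cube →ₗ[ℂ] Cube :=
  TensorProduct.map (TensorProduct.map A.toLin' A.toLin') A.toLin'

theorem cubeAct_mul (A B : Matrix (Fin 2) (Fin 2) ℂ) (t : Cube) :
    cubeAct (A * B) t = cubeAct A (cubeAct B t) := by
  simp only [cubeAct, Matrix.toLin'_mul, TensorProduct.map_comp, LinearMap.comp_apply]

theorem cubeAct_one (t : Cube) : cubeAct 1 t = t := by
  simp [cubeAct]

theorem swap₁₂_cubeAct (A : Matrix (Fin 2) (Fin 2) ℂ) (t : Cube) :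
    swap₁₂ (cubeAct A t) = cubeAct A (swap₁₂ t) := by
  induction t using TensorProduct.induction_on with
  | zero => simp
  | add x y hx hy => simp only [map_add, hx, hy]
  | tmul x z =>
    induction x using TensorProduct.induction_on with
    | zero => simp
    | add x y hx hy => simp only [TensorProduct.add_tmul, map_add, hx, hy]
    | tmul x y => simp [swap₁₂, cubeAct]

theorem swap₂₃_cubeAct (A : Matrix (Fin 2) (Fin 2) ℂ) (t : Cube) :
    swap₂₃ (cubeAct A t) = cubeAct A (swap₂₃ t) := by
  induction t using TensorProduct.induction_on with
  | zero => simp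
  | add x y hx hy => simp only [map_add, hx, hy]
  | tmul x z =>
    induction x using TensorProduct.induction_on with
    | zero => simp
    | add x y hx hy => simp only [TensorProduct.add_tmul, map_add, hx, hy]
    | tmul x y => simp [swap₂₃, cubeAct]

/-- The action of a matrix `A` on `S³Δ`. -/
def rep (A : Matrix (Fin 2) (Fin 2) ℂ) : S3 →ₗ[ℂ] S3 :=
  (cubeAct A).restrict (fun t ht => by
    rw [mem_S3] at ht ⊢
    rw [swap₁₂_cubeAct, swap₂₃_cubeAct, ht.1, ht.2]
    exact ⟨rfl, rfl⟩)

theorem rep_mul (A B : Matrix (Fin 2) (Fin 2) ℂ) (t : S3) : rep (A * B) t = rep A (rep B t) :=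
  Subtype.ext (cubeAct_mul A B t)

theorem rep_one (t : S3) : rep 1 t = t := Subtype.ext (cubeAct_one t)

/-- The standard basis `d₁, d₂` of `Δ` (so `d₂ = j d₁` and `π(d₁, d₂) = 1`), indexed from `0`. -/
def d (i : Fin 2) : Delta := Pi.single i 1

/-- The tensors `ê₁, ê₂, ê₃, ê₄` (indexed from `0`). -/
def hat : Fin 4 → Cube := ![
  (d 0 ⊗ₜ d 0) ⊗ₜ d 0,
  (1 / (Real.sqrt 3 : ℂ)) • ((d 0 ⊗ₜ d 0) ⊗ₜ d 1 + (d 0 ⊗ₜ d 1) ⊗ₜ d 0 + (d 1 ⊗ₜ d 0) ⊗ₜ d 0),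
  (d 1 ⊗ₜ d 1) ⊗ₜ d 1,
  (-(1 / (Real.sqrt 3 : ℂ))) •
    ((d 0 ⊗ₜ d 1) ⊗ₜ d 1 + (d 1 ⊗ₜ d 0) ⊗ₜ d 1 + (d 1 ⊗ₜ d 1) ⊗ₜ d 0)]

theorem hat_mem (k : Fin 4) : hat k ∈ S3 := by
  rw [mem_S3]
  fin_cases k <;> constructor <;> simp [hat, swap₁₂, swap₂₃, -neg_smul] <;> abel_nf

/-- The basis `d_i ⊗ d_j ⊗ d_k` of `Δ ⊗ Δ ⊗ Δ`. -/
def cubeBasis : Module.Basis ((Fin 2 × Fin 2) × Fin 2) ℂ Cube :=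
  ((Pi.basisFun ℂ (Fin 2)).tensorProduct (Pi.basisFun ℂ (Fin 2))).tensorProduct
    (Pi.basisFun ℂ (Fin 2))

theorem repr_d (i j k a b c : Fin 2) : cubeBasis.repr ((d i ⊗ₜ d j) ⊗ₜ d k) ((a, b), c) =
    if i = a ∧ j = b ∧ k = c then 1 else 0 := by
  simp only [cubeBasis, d, Module.Basis.tensorProduct_repr_tmul_apply, Pi.basisFun_repr,
    Pi.single_apply, smul_eq_mul]
  grind

theorem repr_swap₁₂ (t : Cube) (i j k : Fin 2) :
    cubeBasis.repr (swap₁₂ t) ((i, j), k) = cubeBasis.repr t ((j, i), k) := by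
  induction t using TensorProduct.induction_on with
  | zero => simp
  | add x y hx hy => simp only [map_add, Finsupp.add_apply, hx, hy]
  | tmul x z =>
    induction x using TensorProduct.induction_on with
    | zero => simp
    | add x y hx hy => simp only [TensorProduct.add_tmul, map_add, Finsupp.add_apply, hx, hy]
    | tmul x y => simp [swap₁₂, cubeBasis, mul_comm]

theorem repr_swap₂₃ (t : Cube) (i j k : Fin 2) :
    cubeBasis.repr (swap₂₃ t) ((i, j), k) = cubeBasis.repr t ((i, k), j) := by
  induction t using TensorProduct.induction_on with
  | zero => simp
  | add x y hx hy => simp only [map_add, Finsupp.add_apply, hx, hy]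
  | tmul x z =>
    induction x using TensorProduct.induction_on with
    | zero => simp
    | add x y hx hy => simp only [TensorProduct.add_tmul, map_add, Finsupp.add_apply, hx, hy]
    | tmul x y => simp [swap₂₃, cubeBasis, mul_comm, mul_left_comm]

theorem sqrt3_ne : (Real.sqrt 3 : ℂ) ≠ 0 := by
  simp

theorem repr_sum_hat (x : Fin 4 → ℂ) (i j k : Fin 2) :
    cubeBasis.repr (∑ m, x m • hat m) ((i, j), k) =
      (![![![x 0, x 1 / Real.sqrt 3], ![x 1 / Real.sqrt 3, -x 3 / Real.sqrt 3]],
        ![![x 1 / Real.sqrt 3, -x 3 / Real.sqrt 3], ![-x 3 / Real.sqrt 3, x 2]]] :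
        Fin 2 → Fin 2 → Fin 2 → ℂ) i j k := by
  simp only [Fin.sum_univ_four, hat, Matrix.cons_val_zero, Matrix.cons_val_one, Matrix.cons_val,
    map_add, map_smul, Finsupp.add_apply, Finsupp.smul_apply, repr_d, smul_eq_mul]
  fin_cases i <;> fin_cases j <;> fin_cases k <;> simp <;> ring

/-- Coordinates of a symmetric tensor with respect to `ê₁, ê₂, ê₃, ê₄`. -/
def hatCoord (t : Cube) : Fin 4 → ℂ :=
  ![cubeBasis.repr t ((0, 0), 0), (Real.sqrt 3 : ℂ) * cubeBasis.repr t ((0, 0), 1),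
    cubeBasis.repr t ((1, 1), 1), -((Real.sqrt 3 : ℂ) * cubeBasis.repr t ((0, 1), 1))]

theorem sum_hatCoord {t : Cube} (ht : t ∈ S3) : ∑ m, hatCoord t m • hat m = t := by
  have h3 := sqrt3_ne
  obtain ⟨h12, h23⟩ := mem_S3.1 ht
  have e1 := fun i j k => (repr_swap₁₂ t i j k).symm
  have e2 := fun i j k => (repr_swap₂₃ t i j k).symm
  rw [h12] at e1
  rw [h23] at e2
  have a1 := e2 0 1 0
  have a2 := e1 1 0 0
  have a3 := e1 0 1 1
  have a4 := e2 1 0 1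
  apply cubeBasis.ext_elem
  rintro ⟨⟨i, j⟩, k⟩
  rw [repr_sum_hat]
  have b2 := a1.trans a2
  have b4 := (a4.trans a3)
  fin_cases i <;> fin_cases j <;> fin_cases k <;> simp [hatCoord, -one_div] <;>
    first | done | assumption | exact a3.symm | exact b4.symm

theorem hatCoord_sum (x : Fin 4 → ℂ) : hatCoord (∑ m, x m • hat m) = x := by
  have h3 := sqrt3_ne
  ext m
  rw [hatCoord]
  simp only [repr_sum_hat]
  fin_cases m <;> simp <;> field_simp

/-- The coordinate isomorphism `S³Δ ≅ ℂ⁴` with respect to `ê₁, ê₂, ê₃, ê₄`. -/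
def hatEquiv : S3 ≃ₗ[ℂ] (Fin 4 → ℂ) where
  toFun t := hatCoord t
  map_add' s t := by
    ext k; fin_cases k <;> simp [hatCoord] <;> ring
  map_smul' c t := by
    ext k; fin_cases k <;> simp [hatCoord] <;> ring
  invFun x := ⟨∑ m, x m • hat m, S3.sum_mem fun m _ => S3.smul_mem _ (hat_mem m)⟩
  left_inv t := Subtype.ext (sum_hatCoord t.2)
  right_inv x := hatCoord_sum x

/-- `ê₁, ê₂, ê₃, ê₄` as a basis of `S³Δ`. -/
def hatBasis : Module.Basis (Fin 4) ℂ S3 := Module.Basis.ofEquivFun hatEquiv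

theorem hatBasis_apply (k : Fin 4) : (hatBasis k : Cube) = hat k := by
  simp [hatBasis, hatEquiv, Pi.single_apply]

end SymCube

namespace HyperHermitian

variable {V : Type*} [NormedAddCommGroup V] [InnerProductSpace ℝ V] (h : HyperHermitian V)

/-- `Sp(1)_ir ⊂ GL(V)`: the transformations of `V` that, under the identification
`φ : S³Δ ≅ W`, `ê_α ↦ e_α`, act on `W` as an element of `Sp(1) = SU(2)` acts on `S³Δ`. -/
def SpOneIr (e : Module.Basis (Fin 4) ℂ h.W) : Subgroup (V →L[ℝ] V)ˣ where
  carrier := {B | ∃ A ∈ Matrix.specialUnitaryGroup (Fin 2) ℂ, ∀ t : SymCube.S3,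
    Cplx.ext (B : V →L[ℝ] V) (SymCube.hatBasis.equiv e (Equiv.refl _) t : Cplx V) =
      (SymCube.hatBasis.equiv e (Equiv.refl _) (SymCube.rep A t) : Cplx V)}
  one_mem' := ⟨1, one_mem _, fun t => by
    rw [SymCube.rep_one, Cplx.ext, Units.val_one]
    exact congrFun (congrArg DFunLike.coe (LinearMap.baseChange_id (R := ℝ) (A := ℂ) (M := V))) _⟩
  mul_mem' := by
    rintro B B' ⟨A, hA, hB⟩ ⟨A', hA', hB'⟩
    refine ⟨A * A', mul_mem hA hA', fun t => ?_⟩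
    rw [SymCube.rep_mul, ← hB, ← hB', Cplx.ext, Units.val_mul, ContinuousLinearMap.toLinearMap_mul,
      LinearMap.baseChange_mul]
    rfl
  inv_mem' := by
    rintro B ⟨A, hA, hB⟩
    refine ⟨star A, Matrix.mem_specialUnitaryGroup_iff.2
      ⟨Unitary.star_mem hA.1, by
        rw [Matrix.star_eq_conjTranspose, Matrix.det_conjTranspose,
          (Matrix.mem_specialUnitaryGroup_iff.1 hA).2, star_one]⟩, fun t => ?_⟩
    have hAA : A * star A = 1 := Matrix.mem_unitaryGroup_iff.1 hA.1
    have h1 := hB (SymCube.rep (star A) t)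
    rw [← SymCube.rep_mul, hAA, SymCube.rep_one] at h1
    rw [← h1]
    have h2 : Cplx.ext ((B⁻¹ : (V →L[ℝ] V)ˣ) : V →L[ℝ] V) * Cplx.ext (B : V →L[ℝ] V) = 1 := by
      rw [Cplx.ext, Cplx.ext, ← LinearMap.baseChange_mul, ← ContinuousLinearMap.toLinearMap_mul,
        Units.inv_mul]
      exact LinearMap.baseChange_id (R := ℝ) (A := ℂ) (M := V)
    exact congrFun (congrArg DFunLike.coe h2) _

/-- The product group `SO(4)_ir = Sp(1)_ir Sp(1) ⊂ GL(V)` (the two factors commute). -/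
def SOFourIr (e : Module.Basis (Fin 4) ℂ h.W) : Subgroup (V →L[ℝ] V)ˣ := h.SpOneIr e ⊔ h.SpOne

end HyperHermitian

/-! ### Homogeneous spaces -/

/-- Let `H ≤ G` be subgroups of `GL(V)` and `C` a subset of a subspace `R` of the space of 4-tensors,
carrying a `d`-dimensional smooth structure. The statement says that the smooth manifold `C` is
diffeomorphic to the homogeneous space `G / H`, through the orbit map `gH ↦ g · K`.
Here `G` (of dimension `m`) carries its smooth structure as an embedded submanifold of `End(V)`, and
`G / H` the smooth structure on the quotient topology for which `G → G / H` is a smooth submersion;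
these two properties determine the smooth structures uniquely. -/
def DiffeoToHomogeneous {V : Type*} [NormedAddCommGroup V] [InnerProductSpace ℝ V]
    (m d : ℕ) (G H : Subgroup (V →L[ℝ] V)ˣ) (R : Submodule ℝ (Tensor4 V)) (C : Set R)
    [ChartedSpace (EuclideanSpace ℝ (Fin d)) C] (K : Tensor4 V) : Prop :=
  ∃ (_ : ChartedSpace (EuclideanSpace ℝ (Fin m)) G) (_ : IsManifold (𝓡 m) ∞ G)
    (_ : ChartedSpace (EuclideanSpace ℝ (Fin d)) (G ⧸ H.subgroupOf G))
    (_ : IsManifold (𝓡 d) ∞ (G ⧸ H.subgroupOf G)),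
    Manifold.IsSmoothEmbedding (𝓡 m) 𝓘(ℝ, V →L[ℝ] V) ∞
      (fun A : G => ((A : (V →L[ℝ] V)ˣ) : V →L[ℝ] V)) ∧
    Manifold.IsSubmersion (𝓡 m) (𝓡 d) ∞ (fun A : G => (A : G ⧸ H.subgroupOf G)) ∧
    ∃ Φ : Diffeomorph (𝓡 d) (𝓡 d) (G ⧸ H.subgroupOf G) C ∞,
      ∀ A : G, ((Φ (A : G ⧸ H.subgroupOf G) : R) : Tensor4 V) = Tensor4.act A K

end

/-! Everything is reduced to coordinates. A frame is a real isomorphism `κ : V ≃ ℂ⁴` carrying `J₁`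
to `i`, `J₂` to the standard quaternionic structure and `g` to half the real part of the standard
Hermitian form. Frames are the same thing as adapted bases (`isFrame_coord`,
`isAdapted_frameBasis`), they exist by a quaternionic Gram-Schmidt argument, and `Sp(2)` permutes
them transitively. A symmetric tensor is determined by its diagonal, so `Ŝ` is the unique element of
`𝔖` with `Ŝ(v,v,v,v) = Re disc(κ v) / 8`; polarization gives existence.

The stabilizer in `Sp(2)`. In coordinates an element of the stabilizer is a quaternionic unitary map
preserving the discriminant of binary cubics. It therefore preserves the critical points of the
discriminant, and these are perfect cubes because the gradient relations force the Hessian to vanish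
(`exists_eq_cube`). Hence `e₁` goes to a cube of norm one, and after composition with an element of
`SU(2)` it may be assumed fixed. Then `e₃ = j e₁` is fixed too, and three evaluations of the
discriminant leave only the action of `diag(u, ū)` with `u³ = 1`, which lies in `SU(2)`
(`exists_eq_cubicRep`). Conversely the discriminant is `SL(2)`-invariant, as its Hessian form shows
(`disc_cubicRep`).

The stabilizer in `Sp(2)Sp(1)`. The map `𝒦` is `Sp(2)`-equivariant, is injective on `𝔖` (`eq_calK`),
and has image fixed pointwise by `Sp(1)` (`act_SpOne`). Since `Sp(2)Sp(1)` is the product of its two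
commuting factors (`mem_SpSpOne_iff`), the stabilizer of `𝒦(Ŝ)` is the product of the stabilizer of
`Ŝ` with `Sp(1)`, and both groups have the same orbit `𝒞`.

The smooth structures. Both groups are compact, so a transitive action gives a homeomorphism from
the quotient to `𝒞`, and the orbit map is open. The Lie algebra of `Sp(2)` splits into a
3-dimensional part killing the discriminant and a 7-dimensional complement on which the orbit map is
an immersion (`exists_lieSplit`, `LieSplit.orb_injective`). The parametrization `exp(y) exp(z)`,
multiplied by a rational parametrization of `Sp(1)` for the larger group, satisfies the hypotheses
collected in `IsOrbitParam`. Its translates are charts of the group, their first factors give charts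
of `𝒞`, and in these charts the quotient map is a linear projection
(`IsOrbitParam.diffeoToHomogeneous`). -/

noncomputable section

open Set Filter Topology

/-! ### Embedded submanifolds of a normed space -/

/-- A chart of `M` that is adapted to an injection `i : M → F` into a normed space: the inverse of
the chart is an analytic map to `F`, and the chart is the restriction of an analytic map on `F`. -/
structure IsAdaptedChart {M E F : Type*} [TopologicalSpace M]
    [NormedAddCommGroup E] [NormedSpace ℝ E] [NormedAddCommGroup F] [NormedSpace ℝ F]
    (i : M → F) (c : OpenPartialHomeomorph M E) : Prop where
  contDiffOn_symm : ContDiffOn ℝ ω (i ∘ c.symm) c.target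
  exists_extension : ∃ ρ : F → E, (∀ x ∈ c.source, ContDiffAt ℝ ω ρ (i x)) ∧
    ∀ x ∈ c.source, c x = ρ (i x)

/-- Every point of `M` lies in a chart adapted to `i : M → F`. -/
def HasAdaptedCharts {M F : Type*} [TopologicalSpace M] [NormedAddCommGroup F] [NormedSpace ℝ F]
    (d : ℕ) (i : M → F) : Prop :=
  ∀ x : M, ∃ c : OpenPartialHomeomorph M (EuclideanSpace ℝ (Fin d)),
    IsAdaptedChart i c ∧ x ∈ c.source

/-- The inverse function theorem gives analyticity of the map and of its inverse only at one point.
Analyticity at a point is an open condition, so both hold throughout after shrinking the source. -/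
theorem ContDiffAt.exists_openPartialHomeomorph {E F : Type*}
    [NormedAddCommGroup E] [NormedSpace ℝ E] [CompleteSpace E]
    [NormedAddCommGroup F] [NormedSpace ℝ F] {f : E → F} {a : E} {f' : E ≃L[ℝ] F}
    (hf : ContDiffAt ℝ ω f a) (hf' : HasFDerivAt f (f' : E →L[ℝ] F) a) :
    ∃ e : OpenPartialHomeomorph E F, a ∈ e.source ∧ (e : E → F) = f ∧
      ContDiffOn ℝ ω f e.source ∧ ContDiffOn ℝ ω e.symm e.target := by
  have hn : (ω : WithTop ℕ∞) ≠ 0 := by simp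
  set e₀ := hf.toOpenPartialHomeomorph f hf' hn with he₀
  have hcoe : (e₀ : E → F) = f := rfl
  have hsym : ContDiffAt ℝ ω e₀.symm (f a) := hf.to_localInverse hf' hn
  have h1 : ∀ᶠ x in 𝓝 a, ContDiffAt ℝ ω f x := hf.eventually (by simp)
  have h2 : ∀ᶠ x in 𝓝 a, ContDiffAt ℝ ω e₀.symm (f x) :=
    hf.continuousAt.eventually (hsym.eventually (by simp))
  obtain ⟨s, hs, hso, has⟩ := eventually_nhds_iff.1 (h1.and h2)
  refine ⟨e₀.restrOpen s hso, ?_, rfl, ?_, ?_⟩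
  · exact ⟨hf.mem_toOpenPartialHomeomorph_source hf' hn, has⟩
  · intro x hx
    exact (hs x hx.2).1.contDiffWithinAt
  · intro y hy
    have hys : (e₀.restrOpen s hso).symm y ∈ (e₀.restrOpen s hso).source :=
      (e₀.restrOpen s hso).map_target hy
    have h3 := (hs _ hys.2).2
    have h4 : f ((e₀.restrOpen s hso).symm y) = y := (e₀.restrOpen s hso).right_inv hy
    rw [h4] at h3
    exact h3.contDiffWithinAt

namespace IsAdaptedChart

variable {M E E' F : Type*} [TopologicalSpace M]
  [NormedAddCommGroup E] [NormedSpace ℝ E] [NormedAddCommGroup E'] [NormedSpace ℝ E']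
  [NormedAddCommGroup F] [NormedSpace ℝ F] {i : M → F}

/-- The transition map is the ambient extension of the second chart composed with the analytic
inverse of the first; no compatibility between charts has to be assumed. -/
theorem contDiffOn_trans {c : OpenPartialHomeomorph M E} {c' : OpenPartialHomeomorph M E'}
    (hc : IsAdaptedChart i c) (hc' : IsAdaptedChart i c') :
    ContDiffOn ℝ ω (c.symm ≫ₕ c') (c.symm ≫ₕ c').source := by
  obtain ⟨ρ, hρ, hρ'⟩ := hc'.exists_extension
  intro u hu
  rw [OpenPartialHomeomorph.trans_source] at hu
  have h1 : ContDiffWithinAt ℝ ω (ρ ∘ (i ∘ c.symm)) (c.symm ≫ₕ c').source u :=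
    (hρ _ hu.2).comp_contDiffWithinAt u ((hc.contDiffOn_symm u hu.1).mono fun v hv => hv.1)
  refine h1.congr (fun v hv => hρ' _ hv.2) (hρ' _ hu.2)

theorem restrOpen {c : OpenPartialHomeomorph M E} (hc : IsAdaptedChart i c) (s : Set M)
    (hs : IsOpen s) : IsAdaptedChart i (c.restrOpen s hs) := by
  obtain ⟨ρ, hρ, hρ'⟩ := hc.exists_extension
  exact ⟨hc.contDiffOn_symm.mono fun v hv => hv.1,
    ρ, fun x hx => hρ x hx.1, fun x hx => hρ' x hx.1⟩

theorem contDiffAt_comp_symm {c : OpenPartialHomeomorph M E} (hc : IsAdaptedChart i c) {u : E}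
    (hu : u ∈ c.target) : ContDiffAt ℝ ω (i ∘ c.symm) u :=
  hc.contDiffOn_symm.contDiffAt (c.open_target.mem_nhds hu)

end IsAdaptedChart

namespace HasAdaptedCharts

variable {M F : Type*} [TopologicalSpace M] [NormedAddCommGroup F] [NormedSpace ℝ F] {d : ℕ}
  {i : M → F}

/-- The smooth structure on `M` given by the charts adapted to `i : M → F`. -/
abbrev chartedSpace (h : HasAdaptedCharts d i) : ChartedSpace (EuclideanSpace ℝ (Fin d)) M where
  atlas := {c | IsAdaptedChart i c}
  chartAt x := (h x).choose
  mem_chart_source x := (h x).choose_spec.2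
  chart_mem_atlas x := (h x).choose_spec.1

theorem isManifold (h : HasAdaptedCharts d i) :
    letI := h.chartedSpace
    IsManifold (𝓡 d) ∞ M := by
  let _ := h.chartedSpace
  apply isManifold_of_contDiffOn
  intro c c' hc hc'
  have := (IsAdaptedChart.contDiffOn_trans hc hc').of_le (n := ω) (m := (∞ : WithTop ℕ∞)) le_top
  simpa using this

theorem mem_maximalAtlas (h : HasAdaptedCharts d i)
    {c : OpenPartialHomeomorph M (EuclideanSpace ℝ (Fin d))} (hc : IsAdaptedChart i c) :
    letI := h.chartedSpace
    c ∈ IsManifold.maximalAtlas (𝓡 d) ∞ M := by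
  let _ := h.chartedSpace
  have := h.isManifold
  exact IsManifold.subset_maximalAtlas hc

/-- Let `φ` be the inverse chart composed with `i`, `ρ` the ambient extension of the chart and `D`
the derivative of `φ`. The map `y ↦ D (ρ y) + (y - φ (ρ y))` has identity derivative at the point
and sends `φ u` to `D u`. It is thus a chart of `F` in which the image is flat, and extending `D` to
a linear equivalence gives the normal form of an immersion. -/
theorem isSmoothEmbedding [FiniteDimensional ℝ F] (h : HasAdaptedCharts d i) (hi : IsEmbedding i) :
    letI := h.chartedSpace
    Manifold.IsSmoothEmbedding (𝓡 d) 𝓘(ℝ, F) ∞ i := by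
  let _ := h.chartedSpace
  have := h.isManifold
  have : CompleteSpace F := FiniteDimensional.complete ℝ F
  refine ⟨Manifold.IsImmersionOfComplement.isImmersion
    (F := EuclideanSpace ℝ (Fin (Module.finrank ℝ F - d))) fun x => ?_, hi⟩
  obtain ⟨c, hc, hx⟩ := h x
  obtain ⟨ρ, hρ, hρ'⟩ := hc.exists_extension
  set φ : EuclideanSpace ℝ (Fin d) → F := i ∘ c.symm with hφ
  have hcx : c x ∈ c.target := c.map_source hx
  have hφx : φ (c x) = i x := by simp [hφ, c.left_inv hx]
  have hρx : ρ (i x) = c x := (hρ' x hx).symm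
  have hφd : HasFDerivAt φ (fderiv ℝ φ (c x)) (c x) :=
    ((hc.contDiffAt_comp_symm hcx).differentiableAt (by simp)).hasFDerivAt
  have hρd : HasFDerivAt ρ (fderiv ℝ ρ (i x)) (i x) :=
    ((hρ x hx).differentiableAt (by simp)).hasFDerivAt
  set D := fderiv ℝ φ (c x) with hD
  set R := fderiv ℝ ρ (i x) with hR
  have hρφ : ∀ u ∈ c.target, ρ (φ u) = u := fun u hu => by
    rw [hφ, Function.comp_apply, ← hρ' _ (c.map_target hu), c.right_inv hu]
  have hRD : ∀ u, R (D u) = u := by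
    have h1 : HasFDerivAt (ρ ∘ φ) (R.comp D) (c x) := by
      refine HasFDerivAt.comp (c x) ?_ hφd
      rwa [hφx]
    have h2 : HasFDerivAt (ρ ∘ φ) (ContinuousLinearMap.id ℝ _) (c x) :=
      (hasFDerivAt_id (c x)).congr_of_eventuallyEq
        (Filter.eventually_of_mem (c.open_target.mem_nhds hcx) hρφ)
    intro u
    exact congrArg (fun T => T u) (h1.unique h2)
  -- the straightening map
  let T : F → F := fun y => D (ρ y) + (y - φ (ρ y))
  have hT : ContDiffAt ℝ ω T (i x) := by
    have h1 : ContDiffAt ℝ ω (fun y => φ (ρ y)) (i x) := by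
      refine ContDiffAt.comp (g := φ) (i x) ?_ (hρ x hx)
      rw [hρx]
      exact hc.contDiffAt_comp_symm hcx
    exact (D.contDiff.contDiffAt.comp (i x) (hρ x hx)).add (contDiffAt_id.sub h1)
  have hT' : HasFDerivAt T ((ContinuousLinearEquiv.refl ℝ F : F ≃L[ℝ] F) : F →L[ℝ] F) (i x) := by
    have h1 : HasFDerivAt (fun y => φ (ρ y)) (D.comp R) (i x) := by
      refine HasFDerivAt.comp (g := φ) (i x) ?_ hρd
      rwa [hρx]
    have h2 : HasFDerivAt T (D.comp R + (ContinuousLinearMap.id ℝ F - D.comp R)) (i x) :=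
      (D.hasFDerivAt.comp (i x) hρd).add ((hasFDerivAt_id (i x)).sub h1)
    convert h2 using 1
    ext y
    simp
  obtain ⟨e, hxe, heT, he, he'⟩ := hT.exists_openPartialHomeomorph hT'
  -- a linear equivalence extending `D`
  have hDinj : Function.Injective D := fun u v huv => by rw [← hRD u, huv, hRD]
  obtain ⟨Q, hQ⟩ := (LinearMap.range (D : EuclideanSpace ℝ (Fin d) →ₗ[ℝ] F)).exists_isCompl
  have hrank : Module.finrank ℝ (LinearMap.range (D : EuclideanSpace ℝ (Fin d) →ₗ[ℝ] F)) = d := by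
    rw [LinearMap.finrank_range_of_inj hDinj]; simp
  have hQrank : Module.finrank ℝ Q = Module.finrank ℝ F - d := by
    have := Submodule.finrank_add_eq_of_isCompl hQ
    omega
  let q : EuclideanSpace ℝ (Fin (Module.finrank ℝ F - d)) ≃ₗ[ℝ] Q :=
    LinearEquiv.ofFinrankEq _ _ (by simp [hQrank])
  let r := LinearEquiv.ofInjective (D : EuclideanSpace ℝ (Fin d) →ₗ[ℝ] F) hDinj
  let L := ((LinearEquiv.prodCongr r q).trans
    (Submodule.prodEquivOfIsCompl _ Q hQ)).toContinuousLinearEquiv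
  have hL : ∀ u, L (u, 0) = D u := fun u => by simp [L, r]
  refine Manifold.IsImmersionAtOfComplement.mk_of_continuousAt hi.continuous.continuousAt L c e hx
    hxe (h.mem_maximalAtlas hc) ?_ ?_
  · apply StructureGroupoid.mem_maximalAtlas_of_mem_groupoid
    rw [contDiffGroupoid, mem_groupoid_of_pregroupoid]
    simp only [contDiffPregroupoid, modelWithCornersSelf_coe,
      modelWithCornersSelf_coe_symm, Function.id_comp, Function.comp_id, range_id, inter_univ,
      preimage_id]
    exact ⟨(heT ▸ he).of_le le_top, he'.of_le le_top⟩
  · intro u hu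
    have hu' : u ∈ c.target := by simpa using hu
    simp only [OpenPartialHomeomorph.extend, mfld_simps, Function.comp_apply, heT]
    rw [hL]
    have h1 := hρφ u hu'
    rw [hφ, Function.comp_apply] at h1
    simp [T, h1, hφ]

/-- A continuous map that commutes with the inclusions into `F` is smooth. -/
theorem contMDiff_of_comp_eq {M' : Type*} [TopologicalSpace M'] {d' : ℕ} {i' : M' → F}
    (h : HasAdaptedCharts d i) (h' : HasAdaptedCharts d' i') {f : M → M'} (hf : Continuous f)
    (hif : ∀ x, i' (f x) = i x) :
    letI := h.chartedSpace
    letI := h'.chartedSpace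
    ContMDiff (𝓡 d) (𝓡 d') ∞ f := by
  let _ := h.chartedSpace
  let _ := h'.chartedSpace
  have := h.isManifold
  have := h'.isManifold
  intro x
  obtain ⟨c, hc, hx⟩ := h x
  obtain ⟨c', hc', hx'⟩ := h' (f x)
  rw [contMDiffAt_iff_of_mem_maximalAtlas (h.mem_maximalAtlas hc) (h'.mem_maximalAtlas hc') hx hx']
  refine ⟨hf.continuousAt, ?_⟩
  obtain ⟨ρ, hρ, hρ'⟩ := hc'.exists_extension
  have h1 : ContDiffAt ℝ ω (fun u => ρ (i (c.symm u))) (c x) := by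
    refine ContDiffAt.comp (c x) ?_ (hc.contDiffAt_comp_symm (c.map_source hx))
    simp only [c.left_inv hx, ← hif]
    exact hρ _ hx'
  have h2 : (fun u => c' (f (c.symm u))) =ᶠ[𝓝 (c x)] fun u => ρ (i (c.symm u)) := by
    have h3 : ContinuousAt (fun u => f (c.symm u)) (c x) :=
      hf.continuousAt.comp (c.continuousAt_symm (c.map_source hx))
    have h4 : ∀ᶠ u in 𝓝 (c x), f (c.symm u) ∈ c'.source :=
      h3 (c'.open_source.mem_nhds (by simpa [c.left_inv hx] using hx'))
    filter_upwards [h4] with u hu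
    rw [hρ' _ hu, hif]
  simpa [OpenPartialHomeomorph.extend, Function.comp_def] using
    ((h1.congr_of_eventuallyEq h2).of_le le_top).contDiffWithinAt

end HasAdaptedCharts

/-- An analytic parametrization with injective derivative that is open onto its image in `M` is the
inverse of an adapted chart. -/
theorem exists_isAdaptedChart_of_open {M E F : Type*} [TopologicalSpace M]
    [NormedAddCommGroup E] [NormedSpace ℝ E] [FiniteDimensional ℝ E]
    [NormedAddCommGroup F] [NormedSpace ℝ F] [FiniteDimensional ℝ F] {i : M → F}
    (hi : IsEmbedding i) {φ : E → M} (hφ : ContDiffAt ℝ ω (i ∘ φ) 0)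
    (hD : Function.Injective (fderiv ℝ (i ∘ φ) 0)) (hopen : 𝓝 (φ 0) ≤ map φ (𝓝 0)) :
    ∃ c : OpenPartialHomeomorph M E, IsAdaptedChart i c ∧ φ 0 ∈ c.source ∧ c (φ 0) = 0 ∧
      ∀ u ∈ c.target, c.symm u = φ u := by
  have : CompleteSpace E := FiniteDimensional.complete ℝ E
  set D := fderiv ℝ (i ∘ φ) 0 with hDdef
  -- A linear left inverse `P` of the derivative makes `P ∘ i ∘ φ` a local diffeomorphism `e` of
  -- `E`. The chart will be `e.symm ∘ P ∘ i`, which visibly extends to `F`; `hopen` ensures that it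
  -- is defined on a neighbourhood in `M`.
  obtain ⟨P₀, hP₀⟩ := LinearMap.exists_leftInverse_of_injective (D : E →ₗ[ℝ] F)
    (LinearMap.ker_eq_bot.2 hD)
  let P : F →L[ℝ] E := LinearMap.toContinuousLinearMap P₀
  have hPD : ∀ u, P (D u) = u := fun u => congrArg (fun T : E →ₗ[ℝ] E => T u) hP₀
  have h1 : ContDiffAt ℝ ω (fun u => P (i (φ u))) 0 := P.contDiff.contDiffAt.comp 0 hφ
  have h2 : HasFDerivAt (fun u => P (i (φ u)))
      ((ContinuousLinearEquiv.refl ℝ E : E ≃L[ℝ] E) : E →L[ℝ] E) 0 := by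
    have h3 : HasFDerivAt (fun u => P (i (φ u))) (P.comp D) 0 :=
      P.hasFDerivAt.comp (0 : E) (hφ.differentiableAt (by simp)).hasFDerivAt
    convert h3 using 1
    ext u
    simp [hPD]
  obtain ⟨e, h0, hef, hes, het⟩ := h1.exists_openPartialHomeomorph h2
  have he_apply : ∀ u, e u = P (i (φ u)) := fun u => congrFun hef u
  -- `U` is an open neighbourhood of `0` on which everything is defined
  have hφU : ∀ᶠ u in 𝓝 (0 : E), ContDiffAt ℝ ω (i ∘ φ) u := hφ.eventually (by simp)
  obtain ⟨U, hU, hUo, h0U⟩ := eventually_nhds_iff.1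
    (hφU.and (e.open_source.mem_nhds h0))
  have hφcont : ∀ u ∈ U, ContinuousAt φ u := fun u hu =>
    hi.isInducing.continuousAt_iff.2 (hU u hu).1.continuousAt
  -- `N` is an open neighbourhood of `φ 0` in `M`, contained in `φ '' U`
  have hN : φ '' U ∈ 𝓝 (φ 0) := hopen (image_mem_map (hUo.mem_nhds h0U))
  obtain ⟨N, hNU, hNo, h0N⟩ := mem_nhds_iff.1 hN
  have hinv : ∀ u ∈ U, e.symm (P (i (φ u))) = u := fun u hu => by
    rw [← he_apply]; exact e.left_inv (hU u hu).2
  have hinv' : ∀ x ∈ N, φ (e.symm (P (i x))) = x ∧ e.symm (P (i x)) ∈ U := fun x hx => by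
    obtain ⟨u, hu, rfl⟩ := hNU hx
    rw [hinv u hu]; exact ⟨rfl, hu⟩
  have hPt : ∀ x ∈ N, P (i x) ∈ e.target := fun x hx => by
    obtain ⟨u, hu, rfl⟩ := hNU hx
    rw [← he_apply]; exact e.map_source (hU u hu).2
  have hρ : ∀ x ∈ N, ContDiffAt ℝ ω (fun y => e.symm (P y)) (i x) := fun x hx =>
    (het.contDiffAt (e.open_target.mem_nhds (hPt x hx))).comp (i x) P.contDiff.contDiffAt
  let c : OpenPartialHomeomorph M E :=
    { toFun := fun x => e.symm (P (i x))
      invFun := φ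
      source := N
      target := U ∩ φ ⁻¹' N
      map_source' := fun x hx => ⟨(hinv' x hx).2, by
        rw [mem_preimage, (hinv' x hx).1]; exact hx⟩
      map_target' := fun u hu => hu.2
      left_inv' := fun x hx => (hinv' x hx).1
      right_inv' := fun u hu => hinv u hu.1
      open_source := hNo
      open_target := by
        refine ContinuousOn.isOpen_inter_preimage (fun u hu => ?_) hUo hNo
        exact (hφcont u hu).continuousWithinAt
      continuousOn_toFun := fun x hx =>
        ((hρ x hx).continuousAt.comp (f := i) hi.continuous.continuousAt).continuousWithinAt
      continuousOn_invFun := fun u hu => (hφcont u hu.1).continuousWithinAt }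
  refine ⟨c, ⟨fun u hu => (hU u hu.1).1.contDiffWithinAt, fun y => e.symm (P y), hρ,
    fun x _ => rfl⟩, h0N, hinv 0 h0U, fun u _ => rfl⟩

/-- An analytic map with injective derivative into an embedded submanifold of the same dimension is
open. -/
theorem nhds_le_map_of_injective_fderiv {M E E' F : Type*} [TopologicalSpace M]
    [NormedAddCommGroup E] [NormedSpace ℝ E] [FiniteDimensional ℝ E]
    [NormedAddCommGroup E'] [NormedSpace ℝ E'] [FiniteDimensional ℝ E']
    [NormedAddCommGroup F] [NormedSpace ℝ F] {i : M → F} (hi : IsEmbedding i)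
    {c : OpenPartialHomeomorph M E} (hc : IsAdaptedChart i c)
    (hE : Module.finrank ℝ E' = Module.finrank ℝ E)
    {φ : E' → M} (hx : φ 0 ∈ c.source) (hφ : ContDiffAt ℝ ω (i ∘ φ) 0)
    (hD : Function.Injective (fderiv ℝ (i ∘ φ) 0)) : 𝓝 (φ 0) ≤ map φ (𝓝 0) := by
  have : CompleteSpace E := FiniteDimensional.complete ℝ E
  have : CompleteSpace E' := FiniteDimensional.complete ℝ E'
  obtain ⟨ρ, hρ, hρ'⟩ := hc.exists_extension
  have hφc : ContinuousAt φ 0 := hi.isInducing.continuousAt_iff.2 hφ.continuousAt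
  -- This is `φ` read in the chart. Since `i ∘ c.symm ∘ f` agrees with `i ∘ φ` near `0`, its
  -- derivative is injective too, and equality of dimensions turns it into a local homeomorphism.
  let f : E' → E := fun u => ρ (i (φ u))
  have hf : ContDiffAt ℝ ω f 0 := ContDiffAt.comp (0 : E') (hρ _ hx) hφ
  have hev : ∀ᶠ u in 𝓝 (0 : E'), φ u ∈ c.source := hφc (c.open_source.mem_nhds hx)
  have hff : ∀ᶠ u in 𝓝 (0 : E'), (i ∘ c.symm) (f u) = (i ∘ φ) u := by
    filter_upwards [hev] with u hu
    simp only [f, Function.comp_apply, ← hρ' _ hu, c.left_inv hu]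
  have hf0 : f 0 = c (φ 0) := (hρ' _ hx).symm
  have hinj : Function.Injective (fderiv ℝ f 0) := by
    have hs : HasFDerivAt (i ∘ c.symm) (fderiv ℝ (i ∘ c.symm) (f 0)) (f 0) := by
      rw [hf0]
      exact ((hc.contDiffAt_comp_symm (c.map_source hx)).differentiableAt
        (by simp)).hasFDerivAt
    have h1 := hs.comp (0 : E') (hf.differentiableAt (by simp)).hasFDerivAt
    have h2 := (h1.congr_of_eventuallyEq (hff.mono fun u hu => hu.symm)).fderiv
    rw [h2] at hD
    exact Function.Injective.of_comp hD
  let f' : E' ≃L[ℝ] E := (LinearEquiv.ofInjectiveOfFinrankEq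
    ((fderiv ℝ f 0 : E' →L[ℝ] E) : E' →ₗ[ℝ] E) hinj hE).toContinuousLinearEquiv
  have hf' : HasStrictFDerivAt f (f' : E' →L[ℝ] E) 0 := by
    have := hf.hasStrictFDerivAt (by simp)
    convert this using 1
    ext u
    rfl
  have hmap := hf'.map_nhds_eq_of_equiv
  have h3 : φ =ᶠ[𝓝 0] c.symm ∘ f := by
    filter_upwards [hev] with u hu
    simp only [f, Function.comp_apply, ← hρ' _ hu, c.left_inv hu]
  rw [map_congr h3, ← map_map, hmap, hf0, c.symm_map_nhds_eq hx]

end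

/-! ### Orbits of compact transformation groups on 4-tensors -/

noncomputable section

open Set Filter Topology

/-- Orbit maps are analytic as maps to all 4-tensors; composing with such a projection makes them
analytic as maps to the subspace `R`. -/
theorem exists_continuousLinearMap_projection {F : Type*} [NormedAddCommGroup F] [NormedSpace ℝ F]
    [FiniteDimensional ℝ F] (R : Submodule ℝ F) : ∃ P : F →L[ℝ] R, ∀ x : R, P x = x := by
  obtain ⟨p, hp⟩ := LinearMap.exists_leftInverse_of_injective R.subtype
    (LinearMap.ker_eq_bot.2 R.injective_subtype)
  exact ⟨LinearMap.toContinuousLinearMap p, fun x => congrArg (fun T : R →ₗ[ℝ] R => T x) hp⟩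

theorem IsAdaptedChart.comp_homeomorph {M M' E F : Type*} [TopologicalSpace M]
    [TopologicalSpace M'] [NormedAddCommGroup E] [NormedSpace ℝ E] [NormedAddCommGroup F]
    [NormedSpace ℝ F] {i : M' → F} {c : OpenPartialHomeomorph M' E} (h : IsAdaptedChart i c)
    (Φ : M ≃ₜ M') : IsAdaptedChart (i ∘ Φ) (Φ.transOpenPartialHomeomorph c) := by
  obtain ⟨ρ, hρ, hρ'⟩ := h.exists_extension
  refine ⟨h.contDiffOn_symm.congr fun u _ => by simp, ρ, fun x hx => hρ _ hx, fun x hx => hρ' _ hx⟩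

theorem HasAdaptedCharts.comp_homeomorph {M M' F : Type*} [TopologicalSpace M]
    [TopologicalSpace M'] [NormedAddCommGroup F] [NormedSpace ℝ F] {d : ℕ} {i : M' → F}
    (h : HasAdaptedCharts d i) (Φ : M ≃ₜ M') : HasAdaptedCharts d (i ∘ Φ) := by
  intro x
  obtain ⟨c, hc, hx⟩ := h (Φ x)
  exact ⟨Φ.transOpenPartialHomeomorph c, hc.comp_homeomorph Φ, hx⟩

namespace Tensor4

variable {V : Type*} [NormedAddCommGroup V] [InnerProductSpace ℝ V]

theorem act_apply (A : (V →L[ℝ] V)ˣ) (T : Tensor4 V) (x : Fin 4 → V) :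
    act A T x = T (fun k => ((A⁻¹ : (V →L[ℝ] V)ˣ) : V →L[ℝ] V) (x k)) := rfl

theorem act_mul (A B : (V →L[ℝ] V)ˣ) (T : Tensor4 V) : act (A * B) T = act A (act B T) := by
  ext x
  simp [act_apply, mul_inv_rev]

theorem act_one (T : Tensor4 V) : act 1 T = T := by
  ext x
  simp [act_apply]

theorem act_inv_act (A : (V →L[ℝ] V)ˣ) (T : Tensor4 V) : act A⁻¹ (act A T) = T := by
  rw [← act_mul, inv_mul_cancel, act_one]

theorem act_injective (A : (V →L[ℝ] V)ˣ) : Function.Injective (act A) :=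
  Function.LeftInverse.injective (act_inv_act A)

/-- The action of a fixed transformation as a continuous linear map. -/
def actL (A : (V →L[ℝ] V)ˣ) : Tensor4 V →L[ℝ] Tensor4 V :=
  ContinuousMultilinearMap.compContinuousLinearMapL
    (fun _ => ((A⁻¹ : (V →L[ℝ] V)ˣ) : V →L[ℝ] V))

/-- The orbit map `A ↦ A · T` is the restriction of an analytic map on the units of `End(V)`. -/
theorem exists_contDiffAt_act [CompleteSpace V] (T : Tensor4 V) :
    ∃ f : (V →L[ℝ] V) → Tensor4 V,
      ∀ A : (V →L[ℝ] V)ˣ, ContDiffAt ℝ ω f (A : V →L[ℝ] V) ∧ f A = act A T := by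
  -- `Ring.inverse` extends inversion to all endomorphisms and is analytic at units, while pulling
  -- `T` back is polynomial in the endomorphism.
  refine ⟨fun B => T.compContinuousLinearMap fun _ => Ring.inverse B, fun A => ⟨?_, ?_⟩⟩
  · have h1 : ContDiffAt ℝ ω (fun B : V →L[ℝ] V => fun _ : Fin 4 => Ring.inverse B)
        (A : V →L[ℝ] V) := contDiffAt_pi.2 fun _ => contDiffAt_ringInverse ℝ A
    let m := ContinuousMultilinearMap.compContinuousLinearMapContinuousMultilinear ℝ
      (fun _ : Fin 4 => V) (fun _ : Fin 4 => V) ℝ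
    have h2 : ContDiff ℝ ω m :=
      ContinuousMultilinearMap.contDiff (𝕜 := ℝ) (ι := Fin 4) (E := fun _ => V →L[ℝ] V)
        (F := Tensor4 V →L[ℝ] Tensor4 V) m
    have h3 : ContDiffAt ℝ ω
        (fun B : V →L[ℝ] V => m (fun _ : Fin 4 => Ring.inverse B)) (A : V →L[ℝ] V) :=
      h2.contDiffAt.comp _ h1
    exact (ContinuousLinearMap.apply ℝ (Tensor4 V) T).contDiff.contDiffAt.comp _ h3
  · simp only [Ring.inverse_unit]
    rfl

instance finiteDimensional [FiniteDimensional ℝ V] : FiniteDimensional ℝ (Tensor4 V) :=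
  FiniteDimensional.of_injective
    (ContinuousMultilinearMap.toMultilinearMapLinear :
      Tensor4 V →ₗ[ℝ] MultilinearMap ℝ (fun _ : Fin 4 => V) ℝ)
    ContinuousMultilinearMap.toMultilinearMap_injective

end Tensor4

section Homogeneous

variable {V : Type*} [NormedAddCommGroup V] [InnerProductSpace ℝ V]

theorem isEmbedding_subgroup_val [FiniteDimensional ℝ V] (G : Subgroup (V →L[ℝ] V)ˣ) :
    IsEmbedding (fun A : G => ((A : (V →L[ℝ] V)ˣ) : V →L[ℝ] V)) := by
  have : CompleteSpace V := FiniteDimensional.complete ℝ V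
  exact Units.isOpenEmbedding_val.isEmbedding.comp IsEmbedding.subtypeVal

/-- A compact group `G` of transformations acts transitively on a set `C` of tensors; a
parametrization `φ` of `G` near `1` by `𝔪 × 𝔥` is such that the second factor
stabilizes the tensor `K ∈ C`, while the orbit map is an immersion along the first factor. -/
structure IsOrbitParam {d k : ℕ} (G : Subgroup (V →L[ℝ] V)ˣ) {R : Submodule ℝ (Tensor4 V)}
    {C : Set R} (K : Tensor4 V) (orb : G → C)
    (φ : EuclideanSpace ℝ (Fin d) × EuclideanSpace ℝ (Fin k) → G) : Prop where
  isCompact : IsCompact (G : Set (V →L[ℝ] V)ˣ)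
  orb_eq : ∀ A : G, ((orb A : R) : Tensor4 V) = Tensor4.act A K
  surjective : Function.Surjective orb
  zero : φ 0 = 1
  contDiffAt : ContDiffAt ℝ ω (fun u => ((φ u : (V →L[ℝ] V)ˣ) : V →L[ℝ] V)) 0
  injective : Function.Injective (fderiv ℝ (fun u => ((φ u : (V →L[ℝ] V)ˣ) : V →L[ℝ] V)) 0)
  nhds_le : 𝓝 (1 : G) ≤ map φ (𝓝 0)
  stab : ∀ y z, Tensor4.act (φ (y, z)) K = Tensor4.act (φ (y, 0)) K
  orb_injective : Function.Injective (fderiv ℝ (fun y => Tensor4.act (φ (y, 0)) K) 0)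

namespace IsOrbitParam

variable {d k : ℕ} {G : Subgroup (V →L[ℝ] V)ˣ} {R : Submodule ℝ (Tensor4 V)} {C : Set R}
  {K : Tensor4 V} {orb : G → C} {φ : EuclideanSpace ℝ (Fin d) × EuclideanSpace ℝ (Fin k) → G}

theorem orb_mul (h : IsOrbitParam G K orb φ) (A B : G) :
    ((orb (A * B) : R) : Tensor4 V) = Tensor4.act A (Tensor4.act B K) := by
  rw [h.orb_eq, ← Tensor4.act_mul]; rfl

theorem continuous_orb [FiniteDimensional ℝ V] (h : IsOrbitParam G K orb φ) : Continuous orb := by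
  have : CompleteSpace V := FiniteDimensional.complete ℝ V
  obtain ⟨f, hf⟩ := Tensor4.exists_contDiffAt_act K
  rw [IsEmbedding.subtypeVal.continuous_iff, IsEmbedding.subtypeVal.continuous_iff]
  refine continuous_iff_continuousAt.2 fun A => ?_
  have h1 : ContinuousAt (fun B : G => f ((B : (V →L[ℝ] V)ˣ) : V →L[ℝ] V)) A :=
    (hf A).1.continuousAt.comp (f := fun B : G => ((B : (V →L[ℝ] V)ˣ) : V →L[ℝ] V))
      (isEmbedding_subgroup_val G).continuous.continuousAt
  refine h1.congr (Eventually.of_forall fun B => ?_)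
  simp only [(hf _).2, Function.comp_apply, h.orb_eq]

theorem eq_iff (h : IsOrbitParam G K orb φ) (H : Subgroup (V →L[ℝ] V)ˣ)
    (hH : ∀ A : G, Tensor4.act A K = K ↔ (A : (V →L[ℝ] V)ˣ) ∈ H) (A B : G) :
    (A : G ⧸ H.subgroupOf G) = B ↔ orb A = orb B := by
  rw [QuotientGroup.eq, Subgroup.mem_subgroupOf, ← hH, ← Subtype.coe_inj, ← Subtype.coe_inj,
    h.orb_eq, h.orb_eq]
  rw [← (Tensor4.act_injective (A : (V →L[ℝ] V)ˣ)).eq_iff, ← Tensor4.act_mul, eq_comm]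
  simp

/-- The orbit map as a homeomorphism `G / H ≅ C`. -/
theorem exists_homeomorph [FiniteDimensional ℝ V] (h : IsOrbitParam G K orb φ) (H : Subgroup (V →L[ℝ] V)ˣ)
    (hH : ∀ A : G, Tensor4.act A K = K ↔ (A : (V →L[ℝ] V)ˣ) ∈ H) :
    ∃ Φ : G ⧸ H.subgroupOf G ≃ₜ C, ∀ A : G, Φ A = orb A := by
  have : CompactSpace G := isCompact_iff_compactSpace.1 h.isCompact
  have hwd : ∀ A B : G, (QuotientGroup.leftRel (H.subgroupOf G)) A B → orb A = orb B :=
    fun A B hAB => (h.eq_iff H hH A B).1 (Quotient.sound hAB)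
  let f : G ⧸ H.subgroupOf G → C := Quotient.lift orb hwd
  have hf : Continuous f := continuous_quot_lift _ h.continuous_orb
  have hbij : Function.Bijective f := by
    constructor
    · intro a b
      induction a using QuotientGroup.induction_on
      induction b using QuotientGroup.induction_on
      exact fun hab => (h.eq_iff H hH _ _).2 hab
    · intro x
      obtain ⟨A, hA⟩ := h.surjective x
      exact ⟨A, hA⟩
  exact ⟨Continuous.homeoOfEquivCompactToT2 (f := Equiv.ofBijective f hbij) hf, fun A => rfl⟩

/-- With `H` the full stabilizer of `K`, the orbit map is the open projection to `G / H` followed by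
a homeomorphism, the latter because a continuous bijection from a compact space to a Hausdorff space
is one. -/
theorem isOpenMap_orb [FiniteDimensional ℝ V] (h : IsOrbitParam G K orb φ) : IsOpenMap orb := by
  let H : Subgroup (V →L[ℝ] V)ˣ :=
    { carrier := {A | Tensor4.act A K = K}
      one_mem' := Tensor4.act_one K
      mul_mem' := fun {A B} hA hB => by
        rw [mem_ofPred_eq] at hA hB ⊢
        rw [Tensor4.act_mul, hB, hA]
      inv_mem' := fun {A} hA => by
        rw [mem_ofPred_eq] at hA ⊢
        nth_rw 1 [← hA]
        rw [Tensor4.act_inv_act] }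
  obtain ⟨Φ, hΦ⟩ := h.exists_homeomorph H fun A => Iff.rfl
  have : orb = Φ ∘ ((↑) : G → G ⧸ H.subgroupOf G) := funext fun A => (hΦ A).symm
  rw [this]
  exact Φ.isOpenMap.comp QuotientGroup.isOpenMap_coe

/-- Charts of `G` by translates of `φ`. -/
theorem exists_chart [FiniteDimensional ℝ V] (h : IsOrbitParam G K orb φ) {m : ℕ}
    (L : EuclideanSpace ℝ (Fin m) ≃L[ℝ] EuclideanSpace ℝ (Fin d) × EuclideanSpace ℝ (Fin k))
    (A : G) : ∃ c : OpenPartialHomeomorph G (EuclideanSpace ℝ (Fin m)),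
      IsAdaptedChart (fun A : G => ((A : (V →L[ℝ] V)ˣ) : V →L[ℝ] V)) c ∧ A ∈ c.source ∧ c A = 0 ∧
      ∀ u ∈ c.target, c.symm u = A * φ (L u) := by
  have hA : A * φ (L 0) = A := by simp [h.zero]
  let l : (V →L[ℝ] V) →L[ℝ] (V →L[ℝ] V) :=
    ContinuousLinearMap.mul ℝ (V →L[ℝ] V) ((A : (V →L[ℝ] V)ˣ) : V →L[ℝ] V)
  have hl : Function.Injective l := fun B B' hB => by
    simpa [l] using hB
  have hφ' : ContDiffAt ℝ ω (fun u => ((φ u : (V →L[ℝ] V)ˣ) : V →L[ℝ] V)) (L 0) := by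
    simpa using h.contDiffAt
  have hfd : HasFDerivAt (fun u => ((φ (L u) : (V →L[ℝ] V)ˣ) : V →L[ℝ] V))
      ((fderiv ℝ (fun u => ((φ u : (V →L[ℝ] V)ˣ) : V →L[ℝ] V)) 0).comp
        (L : EuclideanSpace ℝ (Fin m) →L[ℝ] _)) 0 := by
    have h1 : HasFDerivAt (fun u => ((φ u : (V →L[ℝ] V)ˣ) : V →L[ℝ] V))
        (fderiv ℝ (fun u => ((φ u : (V →L[ℝ] V)ˣ) : V →L[ℝ] V)) 0) (L 0) := by
      rw [map_zero]
      exact (h.contDiffAt.differentiableAt (by simp)).hasFDerivAt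
    exact h1.comp (0 : EuclideanSpace ℝ (Fin m)) L.hasFDerivAt
  have hcd : ContDiffAt ℝ ω
      ((fun A : G => ((A : (V →L[ℝ] V)ˣ) : V →L[ℝ] V)) ∘ fun u => A * φ (L u)) 0 :=
    l.contDiff.contDiffAt.comp (0 : EuclideanSpace ℝ (Fin m))
      (hφ'.comp (0 : EuclideanSpace ℝ (Fin m)) L.contDiff.contDiffAt)
  have hinj : Function.Injective (fderiv ℝ
      ((fun A : G => ((A : (V →L[ℝ] V)ˣ) : V →L[ℝ] V)) ∘ fun u => A * φ (L u)) 0) := by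
    have h2 := (l.hasFDerivAt.comp (0 : EuclideanSpace ℝ (Fin m)) hfd).fderiv
    have h3 : fderiv ℝ
      ((fun A : G => ((A : (V →L[ℝ] V)ˣ) : V →L[ℝ] V)) ∘ fun u => A * φ (L u)) 0 = _ := h2
    rw [h3]
    exact hl.comp (h.injective.comp L.injective)
  have hopen : 𝓝 (A * φ (L 0)) ≤ map (fun u => A * φ (L u)) (𝓝 0) := by
    have h1 : map (fun u => A * φ (L u)) (𝓝 0) = map (A * ·) (map φ (map L (𝓝 0))) := by
      rw [map_map, map_map]; rfl
    have h2 : map L (𝓝 0) = 𝓝 0 := (L.toHomeomorph.map_nhds_eq 0).trans (by simp)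
    have h3 : map (A * ·) (𝓝 1) = 𝓝 A := by
      simp
    rw [h1, h2, hA, ← h3]
    exact map_mono h.nhds_le
  obtain ⟨c, hc, h0, h0', hs⟩ := exists_isAdaptedChart_of_open (isEmbedding_subgroup_val G)
    hcd hinj hopen
  rw [hA] at h0 h0'
  exact ⟨c, hc, h0, h0', hs⟩

/-- Charts of the orbit `C` by translates of the orbit map along the first factor. -/
theorem exists_orbit_chart [FiniteDimensional ℝ V] (h : IsOrbitParam G K orb φ) (A : G) :
    ∃ c : OpenPartialHomeomorph C (EuclideanSpace ℝ (Fin d)),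
      IsAdaptedChart (Subtype.val : C → R) c ∧ orb A ∈ c.source ∧ c (orb A) = 0 ∧
      ∀ u ∈ c.target, c.symm u = orb (A * φ (u, 0)) := by
  have : CompleteSpace V := FiniteDimensional.complete ℝ V
  have hA : A * φ (0, 0) = A := by
    rw [show ((0, 0) : EuclideanSpace ℝ (Fin d) × EuclideanSpace ℝ (Fin k)) = 0 from rfl,
      h.zero, mul_one]
  obtain ⟨f, hf⟩ := Tensor4.exists_contDiffAt_act K
  obtain ⟨P, hP⟩ := exists_continuousLinearMap_projection (F := Tensor4 V) R
  have hact : ContDiffAt ℝ ω (fun y => Tensor4.act (φ (y, 0)) K) 0 := by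
    have h1 : ContDiffAt ℝ ω (fun y : EuclideanSpace ℝ (Fin d) =>
        ((φ (y, 0) : (V →L[ℝ] V)ˣ) : V →L[ℝ] V)) 0 :=
      ContDiffAt.comp (g := fun u => ((φ u : (V →L[ℝ] V)ˣ) : V →L[ℝ] V))
        (0 : EuclideanSpace ℝ (Fin d)) h.contDiffAt
        (contDiffAt_id.prodMk contDiffAt_const)
    have h2 : ContDiffAt ℝ ω (fun y : EuclideanSpace ℝ (Fin d) =>
        f ((φ (y, 0) : (V →L[ℝ] V)ˣ) : V →L[ℝ] V)) 0 :=
      ContDiffAt.comp (g := f) (0 : EuclideanSpace ℝ (Fin d)) (hf _).1 h1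
    exact h2.congr_of_eventuallyEq (Eventually.of_forall fun y => ((hf _).2).symm)
  have hval : ∀ y, ((orb (A * φ (y, 0)) : R) : Tensor4 V) =
      Tensor4.actL A (Tensor4.act (φ (y, 0)) K) := fun y => h.orb_mul _ _
  have hval' : (Subtype.val : C → R) ∘ (fun y => orb (A * φ (y, 0))) =
      fun y => P (Tensor4.actL A (Tensor4.act (φ (y, 0)) K)) := funext fun y => by
    rw [← hval, hP]; rfl
  have hcd : ContDiffAt ℝ ω ((Subtype.val : C → R) ∘ (fun y => orb (A * φ (y, 0)))) 0 := by
    rw [hval']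
    exact P.contDiff.contDiffAt.comp (0 : EuclideanSpace ℝ (Fin d))
      ((Tensor4.actL (A : (V →L[ℝ] V)ˣ)).contDiff.contDiffAt.comp
        (0 : EuclideanSpace ℝ (Fin d)) hact)
  have hinj : Function.Injective
      (fderiv ℝ ((Subtype.val : C → R) ∘ (fun y => orb (A * φ (y, 0)))) 0) := by
    have h1 := R.subtypeL.hasFDerivAt.comp (0 : EuclideanSpace ℝ (Fin d))
      (hcd.differentiableAt (by simp)).hasFDerivAt
    have h2 := (Tensor4.actL (A : (V →L[ℝ] V)ˣ)).hasFDerivAt.comp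
      (0 : EuclideanSpace ℝ (Fin d)) (hact.differentiableAt (by simp)).hasFDerivAt
    have h3 := h2.congr_of_eventuallyEq (Eventually.of_forall fun y => hval y)
    have h4 := HasFDerivAt.unique h1 h3
    have h5 : Function.Injective ((Tensor4.actL (A : (V →L[ℝ] V)ˣ)).comp
        (fderiv ℝ (fun y => Tensor4.act (φ (y, 0)) K) 0)) :=
      (Tensor4.act_injective (A : (V →L[ℝ] V)ˣ)).comp h.orb_injective
    rw [← h4] at h5
    exact Function.Injective.of_comp (f := R.subtypeL) h5
  -- The second factor does not move `K`, so the orbit map along `A * φ` factors through the first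
  -- projection. Openness of `orb` and of the projection then passes to the first factor alone.
  have hopen : 𝓝 (orb (A * φ (0, 0))) ≤ map (fun y => orb (A * φ (y, 0))) (𝓝 0) := by
    have h1 : (fun u : EuclideanSpace ℝ (Fin d) × EuclideanSpace ℝ (Fin k) => orb (A * φ u)) =
        (fun y => orb (A * φ (y, 0))) ∘ Prod.fst := by
      funext ⟨y, z⟩
      apply Subtype.ext
      apply Subtype.ext
      rw [Function.comp_apply, h.orb_mul, h.orb_mul, h.stab]
    have h2 : map (A * ·) (𝓝 1) = 𝓝 A := by
      simp
    calc 𝓝 (orb (A * φ (0, 0))) ≤ map orb (𝓝 A) := by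
          rw [hA]; exact h.isOpenMap_orb.nhds_le A
      _ ≤ map orb (map (A * ·) (map φ (𝓝 0))) := by
          rw [← h2]; exact map_mono (map_mono h.nhds_le)
      _ = map (fun u => orb (A * φ u)) (𝓝 0) := by rw [map_map, map_map]; rfl
      _ = map (fun y => orb (A * φ (y, 0))) (𝓝 0) := by
          rw [h1, ← map_map, map_fst_nhds]; rfl
  obtain ⟨c, hc, h0, h0', hs⟩ := exists_isAdaptedChart_of_open
    (IsEmbedding.subtypeVal : IsEmbedding (Subtype.val : C → R)) hcd hinj hopen
  rw [hA] at h0 h0'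
  exact ⟨c, hc, h0, h0', hs⟩

theorem hasAdaptedCharts [FiniteDimensional ℝ V] (h : IsOrbitParam G K orb φ) :
    HasAdaptedCharts d (Subtype.val : C → R) := by
  intro x
  obtain ⟨A, rfl⟩ := h.surjective x
  obtain ⟨c, hc, hx, -⟩ := h.exists_orbit_chart A
  exact ⟨c, hc, hx⟩

/-- The quotient receives the smooth structure of `C` through the homeomorphism `Φ`, so `Φ` is a
diffeomorphism because it respects the inclusions into `R`. What remains is that the projection is a
submersion: in the charts coming from `A * φ (L u)` and `orb (A * φ (y, 0))` it is `u ↦ (L u).1`, by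
`h.stab`. -/
theorem diffeoToHomogeneous [FiniteDimensional ℝ V] (h : IsOrbitParam G K orb φ)
    (hC : HasAdaptedCharts d (Subtype.val : C → R))
    {m : ℕ} (hm : m = d + k) (H : Subgroup (V →L[ℝ] V)ˣ)
    (hH : ∀ A : G, Tensor4.act A K = K ↔ (A : (V →L[ℝ] V)ˣ) ∈ H) :
    let _ := hC.chartedSpace
    DiffeoToHomogeneous m d G H R C K := by
  let _ := hC.chartedSpace
  obtain ⟨Φ, hΦ⟩ := h.exists_homeomorph H hH
  let L : EuclideanSpace ℝ (Fin m) ≃L[ℝ]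
      EuclideanSpace ℝ (Fin d) × EuclideanSpace ℝ (Fin k) :=
    ContinuousLinearEquiv.ofFinrankEq (by simp [hm])
  have hG : HasAdaptedCharts m (fun A : G => ((A : (V →L[ℝ] V)ˣ) : V →L[ℝ] V)) := fun A => by
    obtain ⟨c, hc, hx, -⟩ := h.exists_chart L A
    exact ⟨c, hc, hx⟩
  have hQ := hC.comp_homeomorph Φ
  let _ := hG.chartedSpace
  let _ := hQ.chartedSpace
  refine ⟨hG.chartedSpace, hG.isManifold, hQ.chartedSpace, hQ.isManifold,
    hG.isSmoothEmbedding (isEmbedding_subgroup_val G), ?_, ?_⟩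
  · refine Manifold.IsSubmersionOfComplement.isSubmersion (F := EuclideanSpace ℝ (Fin k))
      fun A => ?_
    obtain ⟨c, hc, hA, hA0, hcs⟩ := h.exists_chart L A
    obtain ⟨c', hc', hA', hA0', hcs'⟩ := h.exists_orbit_chart A
    -- The chart of `G` is shrunk so that the first component of `L u` stays in the target of the
    -- orbit chart.
    let s : Set (EuclideanSpace ℝ (Fin m)) := {u | (L u).1 ∈ c'.target}
    have hs : IsOpen s := c'.open_target.preimage (continuous_fst.comp L.continuous)
    refine Manifold.IsSubmersionAtOfComplement.mk_of_continuousAt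
      (QuotientGroup.continuous_mk.continuousAt) L
      (c.restrOpen _ (c.isOpen_inter_preimage hs)) (Φ.transOpenPartialHomeomorph c')
      ⟨hA, hA, ?_⟩ ?_ (hG.mem_maximalAtlas (hc.restrOpen _ _))
      (hQ.mem_maximalAtlas (hc'.comp_homeomorph Φ)) ?_
    · change (L (c A)).1 ∈ c'.target
      rw [hA0, map_zero]
      simpa [hA0'] using c'.map_source hA'
    · change Φ A ∈ c'.source
      rwa [hΦ]
    · intro u hu
      have hu1 : u ∈ (c.restrOpen _ (c.isOpen_inter_preimage hs)).target := by simpa using hu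
      have hu2 : u ∈ c.target := hu1.1
      have hu3 : (L u).1 ∈ c'.target := by
        have h1 : c (c.symm u) ∈ s := hu1.2.2
        rwa [c.right_inv hu2] at h1
      have h4 : orb (A * φ (L u)) = c'.symm (L u).1 := by
        rw [hcs' _ hu3]
        apply Subtype.ext
        apply Subtype.ext
        rw [h.orb_mul, h.orb_mul, ← h.stab _ (L u).2]
      have h5 : c' (Φ ((c.symm u : G) : G ⧸ H.subgroupOf G)) = (L u).1 := by
        rw [hΦ, hcs _ hu2, h4, c'.right_inv hu3]
      simpa [OpenPartialHomeomorph.extend] using h5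
  · refine ⟨⟨Φ.toEquiv, ?_, ?_⟩, fun A => ?_⟩
    · exact hQ.contMDiff_of_comp_eq hC Φ.continuous fun x => rfl
    · exact hC.contMDiff_of_comp_eq hQ Φ.symm.continuous fun x => by
        simp
    · rw [← h.orb_eq, ← hΦ]; rfl

end IsOrbitParam

end Homogeneous

end

/-! ### Complexification, adapted bases and frames -/

noncomputable section

/-! ### Coordinates on `V^ℂ` and `W` -/

namespace Cplx

variable {V : Type*} [NormedAddCommGroup V] [InnerProductSpace ℝ V]

/-- The vector `u + i v` of `V^ℂ`. -/
def mk (u v : V) : Cplx V := (1 : ℂ) ⊗ₜ[ℝ] u + Complex.I ⊗ₜ[ℝ] v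

@[simp] theorem re_mk (u v : V) : re (mk u v) = u := by simp [re, mk]

@[simp] theorem im_mk (u v : V) : im (mk u v) = v := by simp [im, mk]

theorem mk_add (u v u' v' : V) : mk (u + u') (v + v') = mk u v + mk u' v' := by
  simp only [mk, TensorProduct.tmul_add]; abel

theorem mk_re_im (x : Cplx V) : mk (re x) (im x) = x := by
  induction x using TensorProduct.induction_on with
  | zero => simp [mk]
  | add x y hx hy => rw [map_add, map_add, mk_add, hx, hy]
  | tmul z v =>
    simp only [re, im, mk, LinearMap.comp_apply, LinearMap.rTensor_tmul,
      LinearEquiv.coe_coe, TensorProduct.lid_tmul, Complex.reLm_coe, Complex.imLm_coe]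
    rw [← TensorProduct.smul_tmul, ← TensorProduct.smul_tmul, ← TensorProduct.add_tmul]
    congr 1
    simpa [mul_comm] using Complex.re_add_im z

theorem ext_iff {x y : Cplx V} : x = y ↔ re x = re y ∧ im x = im y :=
  ⟨fun h => by rw [h]; exact ⟨rfl, rfl⟩, fun h => by rw [← mk_re_im x, ← mk_re_im y, h.1, h.2]⟩

theorem mk_inj {u v u' v' : V} : mk u v = mk u' v' ↔ u = u' ∧ v = v' := by
  simp [ext_iff]

theorem ext_mk (A : V →L[ℝ] V) (u v : V) : ext A (mk u v) = mk (A u) (A v) := by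
  simp [ext, mk]

theorem conj_mk (u v : V) : conj (mk u v) = mk u (-v) := by
  simp [conj, mk, TensorProduct.tmul_neg, TensorProduct.neg_tmul]

theorem I_smul_mk (u v : V) : Complex.I • mk u v = mk (-v) u := by
  simp only [mk, smul_add, TensorProduct.smul_tmul', smul_eq_mul, mul_one, Complex.I_mul_I,
    TensorProduct.tmul_neg, TensorProduct.neg_tmul]
  abel

theorem real_smul_mk (r : ℝ) (u v : V) : (r : ℂ) • mk u v = mk (r • u) (r • v) := by
  simp only [mk, smul_add, TensorProduct.smul_tmul', smul_eq_mul, mul_one]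
  simp only [TensorProduct.tmul_smul, TensorProduct.smul_tmul']
  congr 2; simp

theorem g_mk (u v u' v' : V) : g (mk u v) (mk u' v') =
    ((inner ℝ u u' - inner ℝ v v' : ℝ) : ℂ) +
      Complex.I * ((inner ℝ u v' + inner ℝ v u' : ℝ) : ℂ) := by
  simp only [g, mk, map_add, LinearMap.add_apply, LinearMap.BilinForm.baseChange_tmul,
    innerₗ_apply_apply, one_mul, mul_one, Complex.I_mul_I]
  simp
  ring

end Cplx

namespace HyperHermitian

variable {V : Type*} [NormedAddCommGroup V] [InnerProductSpace ℝ V] (h : HyperHermitian V)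

theorem J₁_J₁ (v : V) : h.J₁ (h.J₁ v) = -v := congrArg (fun T : V →L[ℝ] V => T v) h.J₁_sq
theorem J₂_J₂ (v : V) : h.J₂ (h.J₂ v) = -v := congrArg (fun T : V →L[ℝ] V => T v) h.J₂_sq
theorem J₁_J₂ (v : V) : h.J₁ (h.J₂ v) = h.J₃ v :=
  congrArg (fun T : V →L[ℝ] V => T v) h.J₁_mul_J₂
theorem J₂_J₁ (v : V) : h.J₂ (h.J₁ v) = -h.J₃ v :=
  congrArg (fun T : V →L[ℝ] V => T v) h.J₂_mul_J₁
theorem J₁_J₃ (v : V) : h.J₁ (h.J₃ v) = -h.J₂ v := by rw [← J₁_J₂, J₁_J₁]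
theorem J₂_J₃ (v : V) : h.J₂ (h.J₃ v) = h.J₁ v := by
  rw [← neg_eq_iff_eq_neg.2 (J₂_J₁ h v), map_neg, J₂_J₂, neg_neg]
theorem J₃_J₁ (v : V) : h.J₃ (h.J₁ v) = h.J₂ v := by
  rw [← J₁_J₂, J₂_J₁, map_neg, J₁_J₃, neg_neg]
theorem J₃_J₂ (v : V) : h.J₃ (h.J₂ v) = -h.J₁ v := by
  rw [← J₁_J₂, J₂_J₂, map_neg]
theorem J₃_J₃ (v : V) : h.J₃ (h.J₃ v) = -v := congrArg (fun T : V →L[ℝ] V => T v) h.J₃_sq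

theorem inner_J₁_left (u v : V) : inner ℝ (h.J₁ u) v = -inner ℝ u (h.J₁ v) := by
  rw [← h.inner_J₁ u (h.J₁ v), J₁_J₁, inner_neg_right, neg_neg]
theorem inner_J₂_left (u v : V) : inner ℝ (h.J₂ u) v = -inner ℝ u (h.J₂ v) := by
  rw [← h.inner_J₂ u (h.J₂ v), J₂_J₂, inner_neg_right, neg_neg]
theorem inner_J₃_left (u v : V) : inner ℝ (h.J₃ u) v = -inner ℝ u (h.J₃ v) := by
  rw [← h.inner_J₃ u (h.J₃ v), J₃_J₃, inner_neg_right, neg_neg]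

theorem mem_W_iff (x : Cplx V) : x ∈ h.W ↔ Cplx.im x = -h.J₁ (Cplx.re x) := by
  obtain ⟨u, v, rfl⟩ : ∃ u v, x = Cplx.mk u v := ⟨_, _, (Cplx.mk_re_im x).symm⟩
  rw [W, LinearMap.mem_ker, LinearMap.sub_apply, sub_eq_zero, Cplx.ext_mk, LinearMap.smul_apply,
    LinearMap.id_apply, Cplx.I_smul_mk, Cplx.mk_inj, Cplx.re_mk, Cplx.im_mk]
  constructor
  · rintro ⟨h1, -⟩; rw [h1, neg_neg]
  · rintro rfl; simp [J₁_J₁]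

theorem mem_Wbar_iff (x : Cplx V) : x ∈ h.Wbar ↔ Cplx.im x = h.J₁ (Cplx.re x) := by
  obtain ⟨u, v, rfl⟩ : ∃ u v, x = Cplx.mk u v := ⟨_, _, (Cplx.mk_re_im x).symm⟩
  rw [Wbar, LinearMap.mem_ker, LinearMap.add_apply, add_eq_zero_iff_eq_neg, Cplx.ext_mk,
    LinearMap.smul_apply, LinearMap.id_apply, Cplx.I_smul_mk, Cplx.ext_iff]
  simp only [map_neg, Cplx.re_mk, Cplx.im_mk, neg_neg]
  constructor
  · rintro ⟨h1, -⟩; rw [h1]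
  · rintro rfl; simp [J₁_J₁]

/-- The vector `v - i J₁ v` of `W` with real part `v`. -/
def toW (v : V) : h.W := ⟨Cplx.mk v (-h.J₁ v), by simp [mem_W_iff]⟩

@[simp] theorem re_toW (v : V) : Cplx.re (h.toW v : Cplx V) = v := by simp [toW]
@[simp] theorem im_toW (v : V) : Cplx.im (h.toW v : Cplx V) = -h.J₁ v := by simp [toW]

theorem toW_re (x : h.W) : h.toW (Cplx.re (x : Cplx V)) = x := by
  apply Subtype.ext
  rw [Cplx.ext_iff, re_toW, im_toW]
  exact ⟨rfl, ((h.mem_W_iff _).1 x.2).symm⟩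

theorem toW_add (u v : V) : h.toW (u + v) = h.toW u + h.toW v := by
  apply Subtype.ext
  simp only [toW, Submodule.coe_add, map_add, neg_add, Cplx.mk_add]

theorem toW_smul (r : ℝ) (v : V) : h.toW (r • v) = (r : ℂ) • h.toW v := by
  apply Subtype.ext
  simp only [toW, Submodule.coe_smul, map_smul, Cplx.real_smul_mk, smul_neg]

theorem toW_J₁ (v : V) : h.toW (h.J₁ v) = Complex.I • h.toW v := by
  apply Subtype.ext
  simp only [toW, Submodule.coe_smul, Cplx.I_smul_mk, J₁_J₁, neg_neg]

theorem j_toW (v : V) : h.j (h.toW v : Cplx V) = h.toW (h.J₂ v) := by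
  simp only [j, toW, Cplx.conj_mk, Cplx.ext_mk, neg_neg, J₂_J₁, J₁_J₂]

theorem ext_toW {A : V →L[ℝ] V} {u v : V} :
    Cplx.ext A (h.toW u : Cplx V) = h.toW v ↔ A u = v ∧ A (h.J₁ u) = h.J₁ v := by
  simp only [toW, Cplx.ext_mk, Cplx.mk_inj, map_neg, neg_inj]

theorem pi_toW (u v : V) : h.pi (h.toW u) (h.toW v) =
    -(2 * (inner ℝ u (h.J₂ v) : ℝ) : ℂ) - 2 * Complex.I * (inner ℝ u (h.J₃ v) : ℝ) := by
  simp only [pi, toW, Cplx.ext_mk, Cplx.g_mk, map_neg, J₂_J₁, neg_neg, inner_neg_left, inner_J₁_left,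
    J₁_J₃, J₁_J₂, inner_neg_right]
  push_cast
  ring

/-- The quaternionic structure `j` in the coordinates of an adapted basis. -/
def jCoord (x : Fin 4 → ℂ) : Fin 4 → ℂ :=
  ![-(starRingEnd ℂ) (x 2), -(starRingEnd ℂ) (x 3), (starRingEnd ℂ) (x 0), (starRingEnd ℂ) (x 1)]

/-- The standard Hermitian form of `ℂ⁴`. -/
def herm (x y : Fin 4 → ℂ) : ℂ := ∑ k, x k * (starRingEnd ℂ) (y k)

/-- Coordinates `V ≅ ℂ⁴` in which the hyper-Hermitian structure is the standard one. -/
structure IsFrame (κ : V ≃ₗ[ℝ] (Fin 4 → ℂ)) : Prop where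
  J₁ : ∀ v, κ (h.J₁ v) = Complex.I • κ v
  J₂ : ∀ v, κ (h.J₂ v) = jCoord (κ v)
  inner_eq : ∀ u v, inner ℝ u v = 1 / 2 * (herm (κ u) (κ v)).re

/-- The coordinates of `v - i J₁ v` with respect to a basis of `W`. -/
def coord (e : Module.Basis (Fin 4) ℂ h.W) : V ≃ₗ[ℝ] (Fin 4 → ℂ) where
  toFun v := e.equivFun (h.toW v)
  map_add' u v := by rw [toW_add, map_add]
  map_smul' r v := by
    rw [toW_smul, map_smul]; rfl
  invFun x := Cplx.re (e.equivFun.symm x : Cplx V)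
  left_inv v := by simp
  right_inv x := by simp only [toW_re, LinearEquiv.apply_symm_apply]

theorem coord_apply (e : Module.Basis (Fin 4) ℂ h.W) (v : V) (k : Fin 4) :
    h.coord e v k = e.repr (h.toW v) k := rfl

theorem toW_coord_symm (e : Module.Basis (Fin 4) ℂ h.W) (x : Fin 4 → ℂ) :
    h.toW ((h.coord e).symm x) = e.equivFun.symm x := toW_re h _

theorem coord_J₁ (e : Module.Basis (Fin 4) ℂ h.W) (v : V) :
    h.coord e (h.J₁ v) = Complex.I • h.coord e v := by
  change e.equivFun (h.toW (h.J₁ v)) = _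
  rw [toW_J₁, map_smul]; rfl

theorem conj_smul_jCoord (a : ℂ) (x : Fin 4 → ℂ) :
    jCoord (a • x) = (starRingEnd ℂ) a • jCoord x := by
  ext k; fin_cases k <;> simp [jCoord]

theorem jCoord_add (x y : Fin 4 → ℂ) : jCoord (x + y) = jCoord x + jCoord y := by
  ext k; fin_cases k <;> simp [jCoord, add_comm]

theorem herm_smul_right (a : ℂ) (x y : Fin 4 → ℂ) :
    herm x (a • y) = (starRingEnd ℂ) a * herm x y := by
  simp only [herm, Pi.smul_apply, smul_eq_mul, map_mul, Finset.mul_sum]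
  exact Finset.sum_congr rfl fun k _ => by ring

theorem IsFrame.inner_J₁ {κ : V ≃ₗ[ℝ] (Fin 4 → ℂ)} (hκ : h.IsFrame κ) (u v : V) :
    inner ℝ u (h.J₁ v) = 1 / 2 * (herm (κ u) (κ v)).im := by
  rw [hκ.inner_eq, hκ.J₁, herm_smul_right]
  simp

/-- The coordinates of an adapted basis form a frame. -/
theorem isFrame_coord {e : Module.Basis (Fin 4) ℂ h.W} (he : h.IsAdapted e) :
    h.IsFrame (h.coord e) := by
  have hJ₂ : ∀ v, h.coord e (h.J₂ v) = jCoord (h.coord e v) := by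
    -- The relation is checked on the basis vectors, where `e₃ = j e₁`, `e₄ = j e₂` and `j² = -1`
    -- give it, and then spreads by antilinearity of both sides.
    have key : ∀ k, h.coord e (h.J₂ ((h.coord e).symm (Pi.single k 1))) =
        jCoord (Pi.single k 1) := by
      have hk : ∀ k, e k = h.toW ((h.coord e).symm (Pi.single k 1)) := fun k => by
        rw [toW_coord_symm]; simp
      have h0 : ∀ k l : Fin 4, (e l : Cplx V) = h.j (e k) →
          h.coord e (h.J₂ ((h.coord e).symm (Pi.single k 1))) = Pi.single l 1 := by
        intro k l hkl
        rw [hk k, j_toW] at hkl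
        have h1 : e l = h.toW (h.J₂ ((h.coord e).symm (Pi.single k 1))) := Subtype.ext hkl
        change e.equivFun _ = _
        rw [← h1]; ext m; simp [Pi.single_apply, eq_comm]
      have h1 : ∀ k l : Fin 4, (e l : Cplx V) = h.j (e k) →
          h.coord e (h.J₂ ((h.coord e).symm (Pi.single l 1))) = -Pi.single k 1 := by
        intro k l hkl
        have h2 := h0 k l hkl
        rw [← h2, LinearEquiv.symm_apply_apply, J₂_J₂, map_neg, LinearEquiv.apply_symm_apply]
      have j0 := h0 0 2 he.j_zero
      have j1 := h0 1 3 he.j_one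
      have j2 := h1 0 2 he.j_zero
      have j3 := h1 1 3 he.j_one
      intro k
      fin_cases k
      · refine j0.trans ?_
        ext m; fin_cases m <;> simp [jCoord]
      · refine j1.trans ?_
        ext m; fin_cases m <;> simp [jCoord]
      · refine j2.trans ?_
        ext m; fin_cases m <;> simp [jCoord]
      · refine j3.trans ?_
        ext m; fin_cases m <;> simp [jCoord]
    have hanti : ∀ (a b : ℝ) (v : V), h.coord e (h.J₂ v) = jCoord (h.coord e v) →
        h.coord e (h.J₂ (a • v + b • h.J₁ v)) = jCoord (h.coord e (a • v + b • h.J₁ v)) := by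
      intro a b v hv
      have h3 : h.J₂ (h.J₁ v) = -h.J₁ (h.J₂ v) := by rw [J₂_J₁, J₁_J₂]
      rw [map_add, map_smul, map_smul, h3, map_add, map_smul, map_smul, map_neg, coord_J₁, hv,
        map_add, map_smul, map_smul, coord_J₁, jCoord_add]
      have h4 : ∀ (r : ℝ) (x : Fin 4 → ℂ), jCoord (r • x) = r • jCoord x := fun r x => by
        have := conj_smul_jCoord (r : ℂ) x
        rw [Complex.conj_ofReal] at this
        exact this
      rw [h4, h4, conj_smul_jCoord, Complex.conj_I, neg_smul]
    intro v
    have hv : v = ∑ k, ((h.coord e v k).re • (h.coord e).symm (Pi.single k 1) +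
        (h.coord e v k).im • h.J₁ ((h.coord e).symm (Pi.single k 1))) := by
      apply (h.coord e).injective
      rw [map_sum]
      ext m
      simp only [map_add, map_smul, coord_J₁, LinearEquiv.apply_symm_apply, Finset.sum_apply,
        Pi.add_apply, Pi.smul_apply]
      rw [Finset.sum_eq_single m (fun k _ hk => by simp [hk.symm]) (by simp)]
      simp [Complex.re_add_im]
    have hjs : ∀ f : Fin 4 → V, (∀ k, h.coord e (h.J₂ (f k)) = jCoord (h.coord e (f k))) →
        h.coord e (h.J₂ (∑ k, f k)) = jCoord (h.coord e (∑ k, f k)) := by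
      intro f hf
      simp only [Fin.sum_univ_four, map_add, jCoord_add, hf]
    rw [hv]
    exact hjs _ fun k => hanti _ _ _ (by rw [key, LinearEquiv.apply_symm_apply])
  refine ⟨h.coord_J₁ e, hJ₂, fun u v => ?_⟩
  -- With `J₂ v` in the second slot, `π` becomes `2 g(u, v) + 2 i g(u, J₁ v)`. Its real part yields
  -- the metric, with the factor `1/2` of a frame.
  have h1 := he.pi_eq (h.toW u) (h.toW (h.J₂ v))
  rw [pi_toW, J₂_J₂, J₃_J₂] at h1
  have h2 := congrArg Complex.re h1
  simp only [← coord_apply, hJ₂] at h2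
  simp only [inner_neg_right, herm, Fin.sum_univ_four] at h2 ⊢
  simp [jCoord] at h2 ⊢
  linarith

/-- The basis of `W` defined by a frame. -/
def frameBasis {κ : V ≃ₗ[ℝ] (Fin 4 → ℂ)} (hκ : h.IsFrame κ) : Module.Basis (Fin 4) ℂ h.W :=
  Module.Basis.ofEquivFun
    { toFun := fun x => κ (Cplx.re (x : Cplx V))
      map_add' := fun x y => by simp
      map_smul' := fun a x => by
        have h1 : a • x = h.toW (a.re • Cplx.re (x : Cplx V) + a.im • h.J₁ (Cplx.re (x : Cplx V))) := by
          rw [toW_add, toW_smul, toW_smul, toW_J₁, toW_re, smul_smul, ← add_smul,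
            Complex.re_add_im]
        rw [h1, re_toW, map_add, map_smul, map_smul, hκ.J₁]
        ext k
        simp only [Pi.add_apply, Pi.smul_apply, RingHom.id_apply, smul_eq_mul, Complex.real_smul]
        rw [← mul_assoc, ← add_mul, Complex.re_add_im]
      invFun := fun x => h.toW (κ.symm x)
      left_inv := fun x => by simp [toW_re]
      right_inv := fun x => by simp }

theorem coord_frameBasis {κ : V ≃ₗ[ℝ] (Fin 4 → ℂ)} (hκ : h.IsFrame κ) :
    h.coord (h.frameBasis hκ) = κ := by
  ext v k
  simp [coord_apply, frameBasis]

/-- Together with `isFrame_coord` and `coord_frameBasis` this identifies frames with adapted bases.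
The form `π` is recovered because its value on `u, v` is minus the Hermitian product of `κ u` with
`j (κ v)`. -/
theorem isAdapted_frameBasis {κ : V ≃ₗ[ℝ] (Fin 4 → ℂ)} (hκ : h.IsFrame κ) :
    h.IsAdapted (h.frameBasis hκ) := by
  have hk : ∀ k, h.frameBasis hκ k = h.toW (κ.symm (Pi.single k 1)) := fun k => by
    simp [frameBasis]
  refine ⟨?_, ?_, fun x y => ?_⟩
  · rw [hk, hk, j_toW]
    congr 2
    apply κ.injective
    rw [hκ.J₂]
    ext m; fin_cases m <;> simp [jCoord]
  · rw [hk, hk, j_toW]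
    congr 2
    apply κ.injective
    rw [hκ.J₂]
    ext m; fin_cases m <;> simp [jCoord]
  · rw [← h.toW_re x, ← h.toW_re y]
    simp only [← coord_apply, coord_frameBasis, pi_toW]
    generalize Cplx.re (x : Cplx V) = u
    generalize Cplx.re (y : Cplx V) = v
    rw [← J₁_J₂, IsFrame.inner_J₁ h hκ, hκ.inner_eq, hκ.J₂]
    have h2 := Complex.re_add_im (herm (κ u) (jCoord (κ v)))
    have h3 : herm (κ u) (jCoord (κ v)) = -(κ u 0 * κ v 2 - κ u 2 * κ v 0 +
        (κ u 1 * κ v 3 - κ u 3 * κ v 1)) := by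
      simp [herm, Fin.sum_univ_four, jCoord]; ring
    rw [h3] at h2 ⊢
    push_cast
    linear_combination -h2

/-- Every hyper-Hermitian structure on an 8-dimensional space has a frame. -/
theorem exists_isFrame (hV : Module.finrank ℝ V = 8) :
    ∃ κ : V ≃ₗ[ℝ] (Fin 4 → ℂ), h.IsFrame κ := by
  have hfin : FiniteDimensional ℝ V := Module.finite_of_finrank_pos (by omega)
  have hskew₁ : ∀ u, inner ℝ u (h.J₁ u) = 0 := fun u => by
    have := h.inner_J₁_left u u; rw [real_inner_comm] at this; linarith
  have hskew₂ : ∀ u, inner ℝ u (h.J₂ u) = 0 := fun u => by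
    have := h.inner_J₂_left u u; rw [real_inner_comm] at this; linarith
  have hskew₃ : ∀ u, inner ℝ u (h.J₃ u) = 0 := fun u => by
    have := h.inner_J₃_left u u; rw [real_inner_comm] at this; linarith
  -- The squared length `1/2` matches the factor `1/2` in the metric of a frame.
  have hnorm : ∀ u : V, u ≠ 0 → ∃ r : ℝ, inner ℝ (r • u) (r • u) = 1 / 2 := fun u hu => by
    refine ⟨Real.sqrt (1 / 2) / ‖u‖, ?_⟩
    have h1 : ‖u‖ ≠ 0 := norm_ne_zero_iff.2 hu
    have h2 : Real.sqrt (1 / 2) * Real.sqrt (1 / 2) = 1 / 2 := Real.mul_self_sqrt (by norm_num)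
    rw [real_inner_smul_left, real_inner_smul_right, real_inner_self_eq_norm_sq]
    field_simp
    rw [sq, h2]; norm_num
  have hnt : Nontrivial V := Module.nontrivial_of_finrank_pos (R := ℝ) (by omega)
  obtain ⟨u, hu⟩ := exists_ne (0 : V)
  obtain ⟨r, hr⟩ := hnorm u hu
  generalize r • u = a at hr
  let S : Submodule ℝ V := Submodule.span ℝ (Set.range ![a, h.J₁ a, h.J₂ a, h.J₃ a])
  have hS : S ≠ ⊤ := fun hS => by
    have h1 : Module.finrank ℝ S ≤ 4 :=
      finrank_range_le_card (R := ℝ) (b := ![a, h.J₁ a, h.J₂ a, h.J₃ a])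
    rw [hS, finrank_top] at h1
    omega
  -- The quaternionic line through `a` has dimension at most 4, so a nonzero vector is orthogonal to
  -- it. By skewness of the `J_s` the quaternionic lines through `a` and `b` are then orthogonal.
  obtain ⟨w, hw, hw0⟩ := Submodule.exists_mem_ne_zero_of_ne_bot
    (fun hbot => hS ((Submodule.orthogonal_eq_bot_iff).1 hbot))
  obtain ⟨r', hr'⟩ := hnorm w hw0
  have hw' : r' • w ∈ Sᗮ := Sᗮ.smul_mem r' hw
  generalize r' • w = b at hr' hw'
  have hS' : ∀ k, inner ℝ (![a, h.J₁ a, h.J₂ a, h.J₃ a] k) b = 0 := fun k =>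
    (Submodule.mem_orthogonal S b).1 hw' _ (Submodule.subset_span ⟨k, rfl⟩)
  have hab0 : inner ℝ a b = 0 := hS' 0
  have hab1 : inner ℝ a (h.J₁ b) = 0 := by
    have := hS' 1; simpa [inner_J₁_left] using this
  have hab2 : inner ℝ a (h.J₂ b) = 0 := by
    have := hS' 2; simpa [inner_J₂_left] using this
  have hab3 : inner ℝ a (h.J₃ b) = 0 := by
    have := hS' 3; simpa [inner_J₃_left] using this
  have hba0 : inner ℝ b a = 0 := by rw [real_inner_comm, hab0]
  have hba1 : inner ℝ b (h.J₁ a) = 0 := by rw [real_inner_comm, inner_J₁_left, hab1, neg_zero]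
  have hba2 : inner ℝ b (h.J₂ a) = 0 := by rw [real_inner_comm, inner_J₂_left, hab2, neg_zero]
  have hba3 : inner ℝ b (h.J₃ a) = 0 := by rw [real_inner_comm, inner_J₃_left, hab3, neg_zero]
  -- This is the quaternion `x + y J₂` applied to `c`, with `J₁` as imaginary unit: the coordinates
  -- `x⁰, x²` belong to the line of `a`, and `x¹, x³` to that of `b`.
  let q : V → ℂ → ℂ → V := fun c x y =>
    x.re • c + x.im • h.J₁ c + y.re • h.J₂ c + y.im • h.J₃ c
  let l : (Fin 4 → ℂ) →ₗ[ℝ] V :=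
    { toFun := fun x => q a (x 0) (x 2) + q b (x 1) (x 3)
      map_add' := fun x y => by simp only [q, Pi.add_apply, Complex.add_re, Complex.add_im]; module
      map_smul' := fun t x => by
        simp only [q, Pi.smul_apply, Complex.real_smul, Complex.re_ofReal_mul,
          Complex.im_ofReal_mul, RingHom.id_apply]
        module }
  have hq : ∀ c x y c' x' y', inner ℝ (q c x y) (q c' x' y') =
      (x.re * x'.re + x.im * x'.im + y.re * y'.re + y.im * y'.im) * inner ℝ c c' +
      (x.re * x'.im - x.im * x'.re - y.re * y'.im + y.im * y'.re) * inner ℝ c (h.J₁ c') +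
      (x.re * y'.re + x.im * y'.im - y.re * x'.re - y.im * x'.im) * inner ℝ c (h.J₂ c') +
      (x.re * y'.im - x.im * y'.re + y.re * x'.im - y.im * x'.re) * inner ℝ c (h.J₃ c') := by
    intro c x y c' x' y'
    simp only [q, inner_add_left, inner_add_right, real_inner_smul_left, real_inner_smul_right,
      inner_J₁_left, inner_J₂_left, inner_J₃_left, J₁_J₁, J₁_J₂, J₁_J₃, J₂_J₁, J₂_J₂, J₂_J₃,
      J₃_J₁, J₃_J₂, J₃_J₃, inner_neg_right]
    ring
  have hl : ∀ x y, inner ℝ (l x) (l y) = 1 / 2 * (herm x y).re := by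
    intro x y
    change inner ℝ (q a (x 0) (x 2) + q b (x 1) (x 3)) (q a (y 0) (y 2) + q b (y 1) (y 3)) = _
    rw [inner_add_left (q a (x 0) (x 2)), inner_add_right _ (q a (y 0) (y 2)) (q b (y 1) (y 3)),
      inner_add_right _ (q a (y 0) (y 2)) (q b (y 1) (y 3))]
    simp only [hq, hr, hr', hab0, hab1, hab2, hab3, hba0, hba1, hba2, hba3, hskew₁,
      hskew₂, hskew₃, herm, Fin.sum_univ_four]
    simp
    ring
  have hinj : Function.Injective l := by
    rw [← LinearMap.ker_eq_bot, LinearMap.ker_eq_bot']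
    intro x hx
    have h1 := hl x x
    rw [hx, inner_zero_left] at h1
    simp only [herm, Fin.sum_univ_four, Complex.mul_conj, Complex.add_re, Complex.ofReal_re] at h1
    have h2 := fun k => Complex.normSq_nonneg (x k)
    ext k
    apply Complex.normSq_eq_zero.1
    fin_cases k <;> simp only [Fin.zero_eta, Fin.mk_one, Fin.reduceFinMk] <;>
      linarith [h2 0, h2 1, h2 2, h2 3]
  let κ' : (Fin 4 → ℂ) ≃ₗ[ℝ] V := LinearEquiv.ofInjectiveOfFinrankEq l hinj (by
    rw [hV, Module.finrank_pi_fintype]; simp)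
  have hκ' : ∀ x, κ' x = l x := fun x => rfl
  refine ⟨κ'.symm, fun v => ?_, fun v => ?_, fun u v => ?_⟩
  · obtain ⟨x, rfl⟩ := κ'.surjective v
    rw [LinearEquiv.symm_apply_apply, LinearEquiv.symm_apply_eq, hκ', hκ']
    simp only [l, q, LinearMap.coe_mk, AddHom.coe_mk, map_add, map_smul, J₁_J₁, J₁_J₂, J₁_J₃,
      Pi.smul_apply, smul_eq_mul, Complex.I_mul_re, Complex.I_mul_im]
    module
  · obtain ⟨x, rfl⟩ := κ'.surjective v
    rw [LinearEquiv.symm_apply_apply, LinearEquiv.symm_apply_eq, hκ', hκ']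
    simp only [l, q, LinearMap.coe_mk, AddHom.coe_mk, map_add, map_smul, J₂_J₁, J₂_J₂, J₂_J₃,
      jCoord, Matrix.cons_val_zero, Matrix.cons_val_one, Matrix.cons_val, Complex.neg_re,
      Complex.neg_im, Complex.conj_re, Complex.conj_im]
    module
  · obtain ⟨x, rfl⟩ := κ'.surjective u
    obtain ⟨y, rfl⟩ := κ'.surjective v
    rw [LinearEquiv.symm_apply_apply, LinearEquiv.symm_apply_apply, hκ', hκ', hl]

end HyperHermitian
end

/-! ### Symmetric tensors, the map `𝒦` and the polarized discriminant -/

noncomputable section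

/-! ### Symmetric 4-tensors -/

namespace Tensor4

variable {V : Type*} [NormedAddCommGroup V] [InnerProductSpace ℝ V] (S : Tensor4 V)

theorem vec_eq {α : Type*} (x : Fin 4 → α) : x = ![x 0, x 1, x 2, x 3] := by
  ext k; fin_cases k <;> rfl

theorem add₀ (a a' b c d : V) : S ![a + a', b, c, d] = S ![a, b, c, d] + S ![a', b, c, d] := by
  have h : ∀ t, Function.update ![0, b, c, d] 0 t = ![t, b, c, d] := fun t => by
    ext k; fin_cases k <;> rfl
  simpa only [h] using S.map_update_add ![0, b, c, d] 0 a a'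
theorem add₁ (a b b' c d : V) : S ![a, b + b', c, d] = S ![a, b, c, d] + S ![a, b', c, d] := by
  have h : ∀ t, Function.update ![a, 0, c, d] 1 t = ![a, t, c, d] := fun t => by
    ext k; fin_cases k <;> rfl
  simpa only [h] using S.map_update_add ![a, 0, c, d] 1 b b'
theorem add₂ (a b c c' d : V) : S ![a, b, c + c', d] = S ![a, b, c, d] + S ![a, b, c', d] := by
  have h : ∀ t, Function.update ![a, b, 0, d] 2 t = ![a, b, t, d] := fun t => by
    ext k; fin_cases k <;> rfl
  simpa only [h] using S.map_update_add ![a, b, 0, d] 2 c c'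
theorem add₃ (a b c d d' : V) : S ![a, b, c, d + d'] = S ![a, b, c, d] + S ![a, b, c, d'] := by
  have h : ∀ t, Function.update ![a, b, c, 0] 3 t = ![a, b, c, t] := fun t => by
    ext k; fin_cases k <;> rfl
  simpa only [h] using S.map_update_add ![a, b, c, 0] 3 d d'

theorem smul₀ (r : ℝ) (a b c d : V) : S ![r • a, b, c, d] = r * S ![a, b, c, d] := by
  have h : ∀ t, Function.update ![0, b, c, d] 0 t = ![t, b, c, d] := fun t => by
    ext k; fin_cases k <;> rfl
  simpa only [h, smul_eq_mul] using S.map_update_smul ![0, b, c, d] 0 r a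
theorem smul₁ (r : ℝ) (a b c d : V) : S ![a, r • b, c, d] = r * S ![a, b, c, d] := by
  have h : ∀ t, Function.update ![a, 0, c, d] 1 t = ![a, t, c, d] := fun t => by
    ext k; fin_cases k <;> rfl
  simpa only [h, smul_eq_mul] using S.map_update_smul ![a, 0, c, d] 1 r b
theorem smul₂ (r : ℝ) (a b c d : V) : S ![a, b, r • c, d] = r * S ![a, b, c, d] := by
  have h : ∀ t, Function.update ![a, b, 0, d] 2 t = ![a, b, t, d] := fun t => by
    ext k; fin_cases k <;> rfl
  simpa only [h, smul_eq_mul] using S.map_update_smul ![a, b, 0, d] 2 r c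
theorem smul₃ (r : ℝ) (a b c d : V) : S ![a, b, c, r • d] = r * S ![a, b, c, d] := by
  have h : ∀ t, Function.update ![a, b, c, 0] 3 t = ![a, b, c, t] := fun t => by
    ext k; fin_cases k <;> rfl
  simpa only [h, smul_eq_mul] using S.map_update_smul ![a, b, c, 0] 3 r d

theorem neg₀ (a b c d : V) : S ![-a, b, c, d] = -S ![a, b, c, d] := by
  simpa using smul₀ S (-1) a b c d
theorem neg₁ (a b c d : V) : S ![a, -b, c, d] = -S ![a, b, c, d] := by
  simpa using smul₁ S (-1) a b c d
theorem neg₂ (a b c d : V) : S ![a, b, -c, d] = -S ![a, b, c, d] := by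
  simpa using smul₂ S (-1) a b c d
theorem neg₃ (a b c d : V) : S ![a, b, c, -d] = -S ![a, b, c, d] := by
  simpa using smul₃ S (-1) a b c d

theorem ext_eq (x : Fin 4 → Cplx V) : S.ext x =
    let r := fun k => Cplx.re (x k)
    let i := fun k => Cplx.im (x k)
    ((S ![r 0, r 1, r 2, r 3] - S ![i 0, i 1, r 2, r 3] - S ![i 0, r 1, i 2, r 3]
      - S ![i 0, r 1, r 2, i 3] - S ![r 0, i 1, i 2, r 3] - S ![r 0, i 1, r 2, i 3]
      - S ![r 0, r 1, i 2, i 3] + S ![i 0, i 1, i 2, i 3] : ℝ) : ℂ) + Complex.I *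
    ((S ![i 0, r 1, r 2, r 3] + S ![r 0, i 1, r 2, r 3] + S ![r 0, r 1, i 2, r 3]
      + S ![r 0, r 1, r 2, i 3] - S ![r 0, i 1, i 2, i 3] - S ![i 0, r 1, i 2, i 3]
      - S ![i 0, i 1, r 2, i 3] - S ![i 0, i 1, i 2, r 3] : ℝ) : ℂ) := by
  have huniv : (Finset.univ : Finset (Finset (Fin 4))) =
      {∅, {0}, {1}, {2}, {3}, {0, 1}, {0, 2}, {0, 3}, {1, 2}, {1, 3}, {2, 3}, {0, 1, 2},
        {0, 1, 3}, {0, 2, 3}, {1, 2, 3}, {0, 1, 2, 3}} := by decide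
  have hI3 : Complex.I ^ 3 = -Complex.I := by rw [pow_succ, Complex.I_sq]; ring
  have hI4 : Complex.I ^ 4 = 1 := Complex.I_pow_four
  unfold ext
  rw [huniv]
  repeat rw [Finset.sum_insert (by decide)]
  rw [Finset.sum_singleton]
  have hf : ∀ s : Finset (Fin 4), (fun k => if k ∈ s then Cplx.im (x k) else Cplx.re (x k)) =
      ![if 0 ∈ s then Cplx.im (x 0) else Cplx.re (x 0),
        if 1 ∈ s then Cplx.im (x 1) else Cplx.re (x 1),
        if 2 ∈ s then Cplx.im (x 2) else Cplx.re (x 2),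
        if 3 ∈ s then Cplx.im (x 3) else Cplx.re (x 3)] := fun s => vec_eq _
  simp only [hf]
  simp [Finset.card_insert_of_notMem, hI3, hI4]
  ring

variable {S}

section Symm

variable (hS : ∀ (σ : Equiv.Perm (Fin 4)) (x : Fin 4 → V), S (x ∘ σ) = S x)

include hS

theorem swap₀₁ (a b c d : V) : S ![b, a, c, d] = S ![a, b, c, d] := by
  rw [← hS (Equiv.swap 0 1) ![a, b, c, d]]
  congr 1; ext k; fin_cases k <;> rfl
theorem swap₁₂ (a b c d : V) : S ![a, c, b, d] = S ![a, b, c, d] := by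
  rw [← hS (Equiv.swap 1 2) ![a, b, c, d]]
  congr 1; ext k; fin_cases k <;> rfl
theorem swap₂₃ (a b c d : V) : S ![a, b, d, c] = S ![a, b, c, d] := by
  rw [← hS (Equiv.swap 2 3) ![a, b, c, d]]
  congr 1; ext k; fin_cases k <;> rfl

theorem diag_add_smul (t : ℝ) (x y : V) : S ![x + t • y, x + t • y, x + t • y, x + t • y] =
    S ![x, x, x, x] + 4 * t * S ![x, x, x, y] + 6 * t ^ 2 * S ![x, x, y, y]
      + 4 * t ^ 3 * S ![x, y, y, y] + t ^ 4 * S ![y, y, y, y] := by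
  have a1 := swap₂₃ hS x x x y
  have a2 := swap₁₂ hS x x y x
  have a3 := swap₀₁ hS x y x x
  have b1 := swap₁₂ hS x x y y
  have b2 := swap₀₁ hS x y x y
  have b3 := swap₂₃ hS x y x y
  have b4 := swap₂₃ hS y x x y
  have b5 := swap₁₂ hS y x y x
  have c1 := swap₀₁ hS x y y y
  have c2 := swap₁₂ hS y x y y
  have c3 := swap₂₃ hS y y x y
  simp only [add₀, add₁, add₂, add₃, smul₀, smul₁, smul₂, smul₃]
  rw [c3, c2, c1, b5, b4, b3, b2, b1, a3, a2, a1]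
  ring

/-- A symmetric tensor that vanishes on the diagonal is zero. -/
theorem eq_zero_of_diag (h0 : ∀ v, S ![v, v, v, v] = 0) : S = 0 := by
  -- Adding the expansions at `t = 1` and `t = -1` cancels the odd terms and leaves `12 S(x,x,y,y) =
  -- 0`; the other values follow by polarizing one pair at a time.
  have h1 : ∀ x y, S ![x, x, y, y] = 0 := fun x y => by
    have e1 := diag_add_smul hS 1 x y
    have e2 := diag_add_smul hS (-1) x y
    simp only [h0] at e1 e2
    linarith
  have h2 : ∀ x y z, S ![x, x, y, z] = 0 := fun x y z => by
    have e1 := h1 x (y + z)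
    have e2 := swap₂₃ hS x x y z
    rw [add₂, add₃, add₃] at e1
    linarith [h1 x y, h1 x z]
  have h3 : ∀ x y z w, S ![x, w, y, z] = 0 := fun x y z w => by
    have e1 := h2 (x + w) y z
    have e2 := swap₀₁ hS x w y z
    rw [add₀, add₁, add₁] at e1
    linarith [h2 x y z, h2 w y z]
  ext x
  rw [vec_eq x, h3]; rfl

end Symm

theorem symm_ext {S T : Tensor4 V} (hS : ∀ (σ : Equiv.Perm (Fin 4)) (x : Fin 4 → V), S (x ∘ σ) = S x)
    (hT : ∀ (σ : Equiv.Perm (Fin 4)) (x : Fin 4 → V), T (x ∘ σ) = T x)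
    (h : ∀ v, S ![v, v, v, v] = T ![v, v, v, v]) : S = T := by
  rw [← sub_eq_zero]
  refine eq_zero_of_diag (fun σ x => ?_) fun v => ?_
  · change S _ - T _ = S _ - T _
    rw [hS, hT]
  · change S _ - T _ = 0
    rw [h, sub_self]

end Tensor4

namespace HyperHermitian

open Tensor4

variable {V : Type*} [NormedAddCommGroup V] [InnerProductSpace ℝ V] {h : HyperHermitian V}

namespace IsSymType

variable {S : Tensor4 V} (hS : h.IsSymType S)

include hS

/-- The mixed component is evaluated on `x - i J₁ x` in `W` and `y + i J₁ y` in the conjugate space,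
with real `z, w`. Its real part is `S(x,y,z,w) + S(J₁x,J₁y,z,w)`. -/
theorem J₁₀₁ (x y z w : V) : S ![h.J₁ x, h.J₁ y, z, w] = -S ![x, y, z, w] := by
  have h1 := hS.mixed ![h.toW x, Cplx.mk y (h.J₁ y), Cplx.mk z 0, Cplx.mk w 0] (h.toW x).2
    (by simp [mem_Wbar_iff])
  rw [ext_eq] at h1
  have h2 := congrArg Complex.re h1
  have hz : ∀ a b c : V, S ![a, b, c, 0] = 0 := fun a b c => by
    simpa using smul₃ S 0 a b c 0
  have hz' : ∀ a b c : V, S ![a, b, 0, c] = 0 := fun a b c => by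
    simpa using smul₂ S 0 a b 0 c
  simp [hz, hz', neg₀] at h2
  linarith

theorem J₁₁₂ (x y z w : V) : S ![x, h.J₁ y, h.J₁ z, w] = -S ![x, y, z, w] := by
  rw [← swap₀₁ hS.symm, ← swap₁₂ hS.symm, hS.J₁₀₁, swap₁₂ hS.symm, swap₀₁ hS.symm]

theorem J₁₂₃ (x y z w : V) : S ![x, y, h.J₁ z, h.J₁ w] = -S ![x, y, z, w] := by
  rw [← swap₁₂ hS.symm, ← swap₂₃ hS.symm, hS.J₁₁₂, swap₂₃ hS.symm, swap₁₂ hS.symm]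

/-- `J₁` may be moved from one argument to another. -/
theorem J₁_move₁ (x y z w : V) : S ![x, h.J₁ y, z, w] = S ![h.J₁ x, y, z, w] := by
  have := hS.J₁₀₁ x (h.J₁ y) z w
  rw [J₁_J₁, neg₁] at this
  linarith
theorem J₁_move₂ (x y z w : V) : S ![x, y, h.J₁ z, w] = S ![h.J₁ x, y, z, w] := by
  rw [← swap₁₂ hS.symm, hS.J₁_move₁, swap₁₂ hS.symm]
theorem J₁_move₃ (x y z w : V) : S ![x, y, z, h.J₁ w] = S ![h.J₁ x, y, z, w] := by
  rw [← swap₂₃ hS.symm, hS.J₁_move₂, swap₂₃ hS.symm]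

theorem J₂_all (x y z w : V) : S ![h.J₂ x, h.J₂ y, h.J₂ z, h.J₂ w] = S ![x, y, z, w] := by
  rw [← hS.J₂_inv ![x, y, z, w]]
  congr 1; ext k; fin_cases k <;> rfl

end IsSymType

/-- Converse of `J₁₀₁`: once every `J₁` produced by the imaginary parts of the first two arguments
is moved to the first slot, the terms of the complex extension cancel in pairs. Membership in `𝔖`
thereby becomes a condition on real vectors. -/
theorem isSymType_of_real {S : Tensor4 V}
    (hS : ∀ (σ : Equiv.Perm (Fin 4)) (x : Fin 4 → V), S (x ∘ σ) = S x)
    (hJ₁ : ∀ x y z w, S ![h.J₁ x, h.J₁ y, z, w] = -S ![x, y, z, w])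
    (hJ₂ : ∀ x : Fin 4 → V, S (fun k => h.J₂ (x k)) = S x) : h.IsSymType S := by
  refine ⟨hS, fun x hx hx' => ?_, hJ₂⟩
  rw [mem_W_iff] at hx
  rw [mem_Wbar_iff] at hx'
  have hJ₁' : ∀ x y z w, S ![x, h.J₁ y, z, w] = S ![h.J₁ x, y, z, w] := fun x y z w => by
    have := hJ₁ x (h.J₁ y) z w
    rw [J₁_J₁, neg₁] at this
    linarith
  rw [ext_eq]
  dsimp only
  simp only [hx, hx', neg₀, hJ₁', map_neg, J₁_J₁, neg_neg]
  push_cast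
  ring

theorem act_vec (A : (V →L[ℝ] V)ˣ) (S : Tensor4 V) (x y z w : V) :
    act A S ![x, y, z, w] =
      S ![((A⁻¹ : (V →L[ℝ] V)ˣ) : V →L[ℝ] V) x, ((A⁻¹ : (V →L[ℝ] V)ˣ) : V →L[ℝ] V) y,
        ((A⁻¹ : (V →L[ℝ] V)ˣ) : V →L[ℝ] V) z, ((A⁻¹ : (V →L[ℝ] V)ˣ) : V →L[ℝ] V) w] := by
  exact congrArg S (funext fun k => by fin_cases k <;> rfl)

theorem IsSymType.act {S : Tensor4 V} (hS : h.IsSymType S) {A : (V →L[ℝ] V)ˣ} (hA : A ∈ h.Sp) :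
    h.IsSymType (act A S) := by
  obtain ⟨-, h1, h2, -⟩ := h.Sp.inv_mem hA
  have h1' : ∀ v, ((A⁻¹ : (V →L[ℝ] V)ˣ) : V →L[ℝ] V) (h.J₁ v) =
      h.J₁ (((A⁻¹ : (V →L[ℝ] V)ˣ) : V →L[ℝ] V) v) := fun v =>
    congrArg (fun T : V →L[ℝ] V => T v) h1
  have h2' : ∀ v, ((A⁻¹ : (V →L[ℝ] V)ˣ) : V →L[ℝ] V) (h.J₂ v) =
      h.J₂ (((A⁻¹ : (V →L[ℝ] V)ˣ) : V →L[ℝ] V) v) := fun v =>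
    congrArg (fun T : V →L[ℝ] V => T v) h2
  refine isSymType_of_real (fun σ x => ?_) (fun x y z w => ?_) fun x => ?_
  · exact hS.symm σ fun k => ((A⁻¹ : (V →L[ℝ] V)ˣ) : V →L[ℝ] V) (x k)
  · rw [act_vec, act_vec, h1', h1', hS.J₁₀₁]
  · simp only [act_apply, h2']
    exact hS.J₂_inv _

/-! ### The map `𝒦` -/

theorem calK_apply (S : Tensor4 V) (x y z w : V) : h.calK S ![x, y, z, w] =
    S ![x, h.J₂ y, z, h.J₂ w] - S ![x, h.J₂ y, h.J₂ z, w] := by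
  exact congrArg₂ (fun a b => S a - S b) (funext fun k => by fin_cases k <;> rfl)
    (funext fun k => by fin_cases k <;> rfl)

theorem calK_act (S : Tensor4 V) {A : (V →L[ℝ] V)ˣ} (hA : A ∈ h.Sp) :
    h.calK (act A S) = act A (h.calK S) := by
  obtain ⟨-, -, h2, -⟩ := h.Sp.inv_mem hA
  have h2' : ∀ v, ((A⁻¹ : (V →L[ℝ] V)ˣ) : V →L[ℝ] V) (h.J₂ v) =
      h.J₂ (((A⁻¹ : (V →L[ℝ] V)ˣ) : V →L[ℝ] V) v) := fun v =>
    congrArg (fun T : V →L[ℝ] V => T v) h2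
  ext x
  rw [vec_eq x, calK_apply, act_vec, act_vec, act_vec, calK_apply, h2', h2', h2']

theorem calK_J₂₂₃ (S : Tensor4 V) (x y z w : V) :
    h.calK S ![x, y, h.J₂ z, h.J₂ w] = h.calK S ![x, y, z, w] := by
  rw [calK_apply, calK_apply, J₂_J₂, J₂_J₂, neg₂, neg₃]
  ring

section calK

variable {S : Tensor4 V} (hS : h.IsSymType S)

include hS

theorem calK_skew₀₁ (x y z w : V) : h.calK S ![x, y, z, w] = -h.calK S ![y, x, z, w] := by
  rw [calK_apply, calK_apply]
  have e1 := hS.J₂_all y (h.J₂ x) z (h.J₂ w)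
  have e2 := hS.J₂_all y (h.J₂ x) (h.J₂ z) w
  simp only [J₂_J₂, neg₁, neg₃, neg₂, neg_neg] at e1 e2
  rw [swap₀₁ hS.symm] at e1 e2
  linarith

theorem calK_skew₂₃ (x y z w : V) : h.calK S ![x, y, z, w] = -h.calK S ![x, y, w, z] := by
  rw [calK_apply, calK_apply, swap₂₃ hS.symm _ _ (h.J₂ z) w, swap₂₃ hS.symm _ _ z (h.J₂ w)]
  ring

/-- By `J₂`-invariance the second term of `𝒦(S)` can be rewritten so that `J₂ w` stands last in both
terms. The cyclic sum then telescopes by symmetry of `S`. -/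
theorem calK_bianchi (x y z w : V) :
    h.calK S ![x, y, z, w] + h.calK S ![y, z, x, w] + h.calK S ![z, x, y, w] = 0 := by
  have key : ∀ a b c, h.calK S ![a, b, c, w] =
      S ![a, h.J₂ b, c, h.J₂ w] - S ![h.J₂ a, b, c, h.J₂ w] := fun a b c => by
    have e1 := hS.J₂_all a (h.J₂ b) (h.J₂ c) w
    simp only [J₂_J₂, neg₁, neg₂, neg_neg] at e1
    rw [calK_apply, e1]
  have cyc : ∀ a b c, S ![b, c, a, h.J₂ w] = S ![a, b, c, h.J₂ w] := fun a b c => by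
    rw [swap₁₂ hS.symm, swap₀₁ hS.symm]
  rw [key, key, key]
  linarith [cyc x y (h.J₂ z), cyc y (h.J₂ z) x, cyc x (h.J₂ y) z, cyc z (h.J₂ x) y]

theorem calK_J₁₂₃ (x y z w : V) : h.calK S ![x, y, h.J₁ z, h.J₁ w] = h.calK S ![x, y, z, w] := by
  rw [calK_apply, calK_apply, J₂_J₁, J₂_J₁, ← J₁_J₂, ← J₁_J₂, neg₂, neg₃, hS.J₁₂₃, hS.J₁₂₃]
  ring

theorem calK_J₃₂₃ (x y z w : V) : h.calK S ![x, y, h.J₃ z, h.J₃ w] = h.calK S ![x, y, z, w] := by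
  rw [← J₁_J₂, ← J₁_J₂, calK_J₁₂₃ hS, calK_J₂₂₃ S]

theorem calK_mem_Curv : h.calK S ∈ h.Curv :=
  ⟨calK_skew₀₁ hS, calK_skew₂₃ hS, calK_bianchi hS, calK_J₁₂₃ hS, calK_J₂₂₃ S, calK_J₃₂₃ hS⟩

/-- Invariance properties known for the last pair of arguments carry over to the first pair through
this symmetry. -/
theorem calK_pair (x y z w : V) : h.calK S ![x, y, z, w] = h.calK S ![z, w, x, y] := by
  have hp : ∀ a b c d, S ![c, d, a, b] = S ![a, b, c, d] := fun a b c d => by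
    rw [swap₁₂ hS.symm, swap₀₁ hS.symm, swap₂₃ hS.symm, swap₁₂ hS.symm]
  have e1 := hS.J₂_all z (h.J₂ w) (h.J₂ x) y
  simp only [J₂_J₂, neg₁, neg₂, neg_neg] at e1
  rw [calK_apply, calK_apply, ← e1, hp x (h.J₂ y) z (h.J₂ w), hp x (h.J₂ y) (h.J₂ z) w]

/-- `S` is recovered from `𝒦(S)`. -/
theorem eq_calK (x y z w : V) : S ![x, y, z, w] = 1 / 2 * (h.calK S ![h.J₁ x, h.J₂ y, z, h.J₃ w] +
    h.calK S ![x, h.J₂ y, z, h.J₂ w]) := by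
  -- Each of the two curvature terms contributes `S(x,y,z,w)`; what remains of them is
  -- `∓S(x,y,J₂z,J₂w)`, which cancels.
  rw [calK_apply, calK_apply]
  simp only [J₂_J₂, J₂_J₃]
  rw [← J₁_J₂]
  simp only [neg₁, neg₃, hS.J₁_move₃, J₁_J₁, neg₀]
  ring

end calK

theorem calK_injOn {S T : Tensor4 V} (hS : h.IsSymType S) (hT : h.IsSymType T)
    (hST : h.calK S = h.calK T) : S = T := by
  ext x
  rw [vec_eq x, eq_calK hS, eq_calK hT, hST]

/-- `Sp(1)` acts trivially on hyper-Kähler curvature tensors of the form `𝒦(S)`. -/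
theorem act_SpOne {S : Tensor4 V} (hS : h.IsSymType S) {q : (V →L[ℝ] V)ˣ} (hq : q ∈ h.SpOne) :
    act q (h.calK S) = h.calK S := by
  obtain ⟨x, hx, hqx⟩ := h.SpOne.inv_mem hq
  rw [Fin.sum_univ_four] at hx
  set K := h.calK S with hK
  -- Each `J_s` is skew with respect to the last pair, so in the expansion of `K(a,b,qc,qd)` the
  -- cross terms cancel and the factor `|q|² = 1` is left. The first pair is handled by pair
  -- symmetry.
  have key : ∀ a b c d, K ![a, b, h.quat x c, h.quat x d] = K ![a, b, c, d] := by
    intro a b c d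
    have m1 : ∀ c d, K ![a, b, h.J₁ c, d] = -K ![a, b, c, h.J₁ d] := fun c d => by
      rw [← calK_J₁₂₃ hS, J₁_J₁, neg₂]
    have m2 : ∀ c d, K ![a, b, h.J₂ c, d] = -K ![a, b, c, h.J₂ d] := fun c d => by
      rw [← calK_J₂₂₃ S, J₂_J₂, neg₂]
    have m3 : ∀ c d, K ![a, b, h.J₃ c, d] = -K ![a, b, c, h.J₃ d] := fun c d => by
      rw [← calK_J₃₂₃ hS, J₃_J₃, neg₂]
    have hqv : ∀ v, h.quat x v = x 0 • v + x 1 • h.J₁ v + x 2 • h.J₂ v + x 3 • h.J₃ v := fun v => rfl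
    simp only [hqv, add₂, add₃, smul₂, smul₃, m1, m2, m3, J₁_J₁, J₁_J₂, J₁_J₃, J₂_J₁, J₂_J₂, J₂_J₃,
      J₃_J₁, J₃_J₂, J₃_J₃, neg₃]
    linear_combination K ![a, b, c, d] * hx
  ext y
  rw [vec_eq y, act_vec, hqx, key, calK_pair hS, key, calK_pair hS]

/-! ### The discriminant tensor -/

/-- Expanding on `v - i J₁ v` gives sixteen terms. Moving every `J₁` to one slot, the eight with an
even number of `J₁` become `S(v,v,v,v)` and the eight odd ones `-i S(J₁v,v,v,v)`. This is the origin
of the factor `1/8` below. -/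
theorem ext_toW_diag {S : Tensor4 V} (hS : h.IsSymType S) (v : V) :
    S.ext (fun _ => (h.toW v : Cplx V)) =
      8 * ((S ![v, v, v, v] : ℂ) - Complex.I * S ![h.J₁ v, v, v, v]) := by
  rw [ext_eq]
  dsimp only
  simp only [re_toW, im_toW]
  simp only [neg₀, neg₁, neg₂, neg₃, hS.J₁_move₁, hS.J₁_move₂, hS.J₁_move₃, J₁_J₁]
  simp only [neg₀, map_neg, J₁_J₁, neg_neg]
  push_cast
  ring

theorem isDiscTensor_iff {e : Module.Basis (Fin 4) ℂ h.W} {S : Tensor4 V} :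
    h.IsDiscTensor e S ↔ h.IsSymType S ∧
      (∀ v, S ![v, v, v, v] = 1 / 8 * (disc (h.coord e v)).re) ∧
      ∀ v, S ![h.J₁ v, v, v, v] = -(1 / 8 * (disc (h.coord e v)).im) := by
  have key : ∀ (hS : h.IsSymType S) (v : V),
      S.ext (fun _ => (h.toW v : Cplx V)) = disc (e.repr (h.toW v)) ↔
        S ![v, v, v, v] = 1 / 8 * (disc (h.coord e v)).re ∧
        S ![h.J₁ v, v, v, v] = -(1 / 8 * (disc (h.coord e v)).im) := fun hS v => by
    rw [ext_toW_diag hS]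
    change _ = disc (h.coord e v) ↔ _
    rw [Complex.ext_iff]
    simp only [Complex.re_ofNat, Complex.im_ofNat, Complex.mul_re, Complex.mul_im, Complex.sub_re,
      Complex.sub_im, Complex.ofReal_re, Complex.ofReal_im, Complex.I_re, Complex.I_im]
    constructor <;> rintro ⟨h1, h2⟩ <;> constructor <;> linarith
  constructor
  · rintro ⟨hS, hd⟩
    exact ⟨hS, fun v => ((key hS v).1 (hd _)).1, fun v => ((key hS v).1 (hd _)).2⟩
  · rintro ⟨hS, h1, h2⟩
    refine ⟨hS, fun x => ?_⟩
    rw [← h.toW_re x]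
    exact (key hS _).2 ⟨h1 _, h2 _⟩

/-- The symmetrized product of four coordinate functions. -/
def symmMonomial (κ : V ≃ₗ[ℝ] (Fin 4 → ℂ)) (i : Fin 4 → Fin 4) : MultilinearMap ℝ (fun _ : Fin 4 => V) ℂ :=
  ∑ σ : Equiv.Perm (Fin 4), ((MultilinearMap.mkPiAlgebra ℝ (Fin 4) ℂ).compLinearMap
    fun k => LinearMap.proj (i k) ∘ₗ κ.toLinearMap).domDomCongr σ

theorem symmMonomial_apply (κ : V ≃ₗ[ℝ] (Fin 4 → ℂ)) (i : Fin 4 → Fin 4) (x : Fin 4 → V) :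
    symmMonomial κ i x = ∑ σ : Equiv.Perm (Fin 4), ∏ k, κ (x (σ k)) (i k) := by
  simp [symmMonomial]

theorem symmMonomial_comp (κ : V ≃ₗ[ℝ] (Fin 4 → ℂ)) (i : Fin 4 → Fin 4) (τ : Equiv.Perm (Fin 4))
    (x : Fin 4 → V) : symmMonomial κ i (x ∘ τ) = symmMonomial κ i x := by
  rw [symmMonomial_apply, symmMonomial_apply]
  exact Fintype.sum_equiv (Equiv.mulLeft τ) _ _ fun σ => rfl

theorem symmMonomial_smul (κ : V ≃ₗ[ℝ] (Fin 4 → ℂ)) (i : Fin 4 → Fin 4) (a : Fin 4 → ℂ)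
    {x y : Fin 4 → V} (hxy : ∀ k, κ (y k) = a k • κ (x k)) :
    symmMonomial κ i y = (∏ k, a k) * symmMonomial κ i x := by
  rw [symmMonomial_apply, symmMonomial_apply, Finset.mul_sum]
  refine Finset.sum_congr rfl fun σ _ => ?_
  rw [← Equiv.prod_comp σ a, ← Finset.prod_mul_distrib]
  exact Finset.prod_congr rfl fun k _ => by rw [hxy]; rfl

theorem symmMonomial_diag (κ : V ≃ₗ[ℝ] (Fin 4 → ℂ)) (i : Fin 4 → Fin 4) (v : V) :
    symmMonomial κ i ![v, v, v, v] = 24 * (κ v (i 0) * κ v (i 1) * κ v (i 2) * κ v (i 3)) := by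
  have h1 : ∀ k, (![v, v, v, v] : Fin 4 → V) k = v := fun k => by fin_cases k <;> rfl
  rw [symmMonomial_apply]
  simp only [h1, Finset.sum_const, Finset.card_univ, Fintype.card_perm, Fintype.card_fin,
    Fin.prod_univ_four]
  simp [Nat.factorial]

/-- The coefficients are real and the substitution by `j` permutes the monomials with the right
signs. This reality property is what makes the real part of the discriminant `J₂`-invariant. -/
theorem disc_jCoord (x : Fin 4 → ℂ) : disc (jCoord x) = (starRingEnd ℂ) (disc x) := by
  simp only [disc, jCoord, map_add, map_sub, map_mul, map_pow, map_neg, map_ofNat,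
    Complex.conj_ofReal, Matrix.cons_val_zero, Matrix.cons_val_one, Matrix.cons_val]
  ring

/-- The complexified polarization of the discriminant. -/
def discPolar (κ : V ≃ₗ[ℝ] (Fin 4 → ℂ)) : MultilinearMap ℝ (fun _ : Fin 4 => V) ℂ :=
  -- Each `symmMonomial` is an unnormalized sum over the 24 permutations.
  (1 / 24 : ℂ) • ((-18 : ℂ) • symmMonomial κ ![0, 1, 2, 3]
    + (4 * (Real.sqrt 3 : ℂ)) • symmMonomial κ ![0, 3, 3, 3]
    - (4 * (Real.sqrt 3 : ℂ)) • symmMonomial κ ![1, 1, 1, 2]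
    + (3 : ℂ) • symmMonomial κ ![1, 1, 3, 3] - (9 : ℂ) • symmMonomial κ ![0, 0, 2, 2])

theorem discPolar_comp (κ : V ≃ₗ[ℝ] (Fin 4 → ℂ)) (τ : Equiv.Perm (Fin 4))
    (x : Fin 4 → V) : discPolar κ (x ∘ τ) = discPolar κ x := by
  simp only [discPolar, smul_apply, add_apply, sub_apply, symmMonomial_comp]

theorem discPolar_smul (κ : V ≃ₗ[ℝ] (Fin 4 → ℂ)) (a : Fin 4 → ℂ)
    {x y : Fin 4 → V} (hxy : ∀ k, κ (y k) = a k • κ (x k)) :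
    discPolar κ y = (∏ k, a k) * discPolar κ x := by
  simp only [discPolar, smul_apply, add_apply, sub_apply, symmMonomial_smul κ _ a hxy, smul_eq_mul]
  ring

theorem discPolar_diag (κ : V ≃ₗ[ℝ] (Fin 4 → ℂ)) (v : V) :
    discPolar κ ![v, v, v, v] = disc (κ v) := by
  simp only [discPolar, smul_apply, add_apply, sub_apply, symmMonomial_diag, smul_eq_mul, disc, Matrix.cons_val_zero,
    Matrix.cons_val_one, Matrix.cons_val]
  ring

/-- `S` is the cubic discriminant in the coordinates `κ`. -/
structure IsDiscFor (h : HyperHermitian V) (κ : V ≃ₗ[ℝ] (Fin 4 → ℂ)) (S : Tensor4 V) : Prop where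
  isSymType : h.IsSymType S
  diag : ∀ v, S ![v, v, v, v] = 1 / 8 * (disc (κ v)).re

theorem IsDiscFor.unique {κ : V ≃ₗ[ℝ] (Fin 4 → ℂ)} {S T : Tensor4 V} (hS : IsDiscFor h κ S)
    (hT : IsDiscFor h κ T) : S = T :=
  symm_ext hS.isSymType.symm hT.isSymType.symm fun v => by rw [hS.diag, hT.diag]

/-- The tensor is the real part of the polarized discriminant divided by 8. Two slots multiplied by
`i` give the sign required of `J₁`; for `J₂`, two symmetric tensors are compared on the diagonal by
`disc_jCoord`. -/
theorem exists_isDiscFor [FiniteDimensional ℝ V] {κ : V ≃ₗ[ℝ] (Fin 4 → ℂ)} (hκ : h.IsFrame κ) :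
    ∃ S, IsDiscFor h κ S ∧ ∀ x, S x = 1 / 8 * (discPolar κ x).re := by
  let S₀ : MultilinearMap ℝ (fun _ : Fin 4 => V) ℝ :=
    (1 / 8 : ℝ) • Complex.reLm.compMultilinearMap (discPolar κ)
  let S : Tensor4 V := ⟨S₀, by
    have hκc : Continuous κ := κ.toLinearMap.continuous_of_finiteDimensional
    change Continuous fun x : Fin 4 → V => (1 / 8 : ℝ) * (discPolar κ x).re
    simp only [discPolar, smul_apply, add_apply, sub_apply, symmMonomial_apply]
    fun_prop⟩
  have hS : ∀ x, S x = 1 / 8 * (discPolar κ x).re := fun x => rfl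
  have hsymm : ∀ (σ : Equiv.Perm (Fin 4)) (x : Fin 4 → V), S (x ∘ σ) = S x := fun σ x => by
    rw [hS, hS, discPolar_comp]
  have hdiag : ∀ v, S ![v, v, v, v] = 1 / 8 * (disc (κ v)).re := fun v => by
    rw [hS, discPolar_diag]
  refine ⟨S, ⟨isSymType_of_real hsymm (fun x y z w => ?_) fun x => ?_, hdiag⟩, hS⟩
  · have h1 := discPolar_smul κ ![Complex.I, Complex.I, 1, 1] (x := ![x, y, z, w])
      (y := ![h.J₁ x, h.J₁ y, z, w]) (fun k => by fin_cases k <;> simp [hκ.J₁])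
    rw [hS, hS, h1]
    simp [Fin.prod_univ_four]
  · have h1 : S.compContinuousLinearMap (fun _ => h.J₂) = S := by
      refine symm_ext (fun σ x => hsymm σ fun k => h.J₂ (x k)) hsymm fun v => ?_
      have h2 : S.compContinuousLinearMap (fun _ => h.J₂) ![v, v, v, v] =
          S ![h.J₂ v, h.J₂ v, h.J₂ v, h.J₂ v] :=
        congrArg S (funext fun k => by fin_cases k <;> rfl)
      rw [h2, hdiag, hdiag, hκ.J₂, disc_jCoord, Complex.conj_re]
    exact congrArg (fun T : Tensor4 V => T x) h1

/-- The imaginary part of the discriminant is no further condition on `S`: putting `J₁ v` in one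
slot multiplies the polarized form by `i`, and `Re(iz) = -Im z`. -/
theorem IsDiscFor.J₁_diag [FiniteDimensional ℝ V] {κ : V ≃ₗ[ℝ] (Fin 4 → ℂ)} (hκ : h.IsFrame κ)
    {S : Tensor4 V} (hS : IsDiscFor h κ S) (v : V) :
    S ![h.J₁ v, v, v, v] = -(1 / 8 * (disc (κ v)).im) := by
  obtain ⟨T, hT, hT'⟩ := exists_isDiscFor hκ
  have h1 := discPolar_smul κ ![Complex.I, 1, 1, 1] (x := ![v, v, v, v])
    (y := ![h.J₁ v, v, v, v]) (fun k => by fin_cases k <;> simp [hκ.J₁])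
  rw [hS.unique hT, hT', h1, discPolar_diag]
  simp [Fin.prod_univ_four]

theorem isDiscTensor_iff_isDiscFor [FiniteDimensional ℝ V] {e : Module.Basis (Fin 4) ℂ h.W}
    (he : h.IsAdapted e) {S : Tensor4 V} : h.IsDiscTensor e S ↔ IsDiscFor h (h.coord e) S := by
  rw [isDiscTensor_iff]
  exact ⟨fun hS => ⟨hS.1, hS.2.1⟩, fun hS => ⟨hS.1, hS.2, hS.J₁_diag (h.isFrame_coord he)⟩⟩

end HyperHermitian
end

/-! ### Invariant theory of binary cubics -/

noncomputable section

/-! ### The representation of `SU(2)` on binary cubics -/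

namespace SymCube

/-- The vector with components `c₀₀₀, c₀₀₁, c₀₁₁, c₁₁₁` as a symmetric tensor. -/
def cubicVec (c : Fin 4 → ℂ) : Fin 4 → ℂ :=
  ![c 0, (Real.sqrt 3 : ℂ) * c 1, c 3, -((Real.sqrt 3 : ℂ) * c 2)]

theorem exists_cubicVec (x : Fin 4 → ℂ) : ∃ c, cubicVec c = x := by
  have h3 := sqrt3_ne
  refine ⟨![x 0, x 1 / (Real.sqrt 3 : ℂ), -x 3 / (Real.sqrt 3 : ℂ), x 2], ?_⟩
  ext k; fin_cases k <;> simp [cubicVec] <;> field_simp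

/-- The action of a matrix on `S³Δ` in the coordinates of the basis `ê₁, ê₂, ê₃, ê₄`. -/
def cubicRep (A : Matrix (Fin 2) (Fin 2) ℂ) : (Fin 4 → ℂ) →ₗ[ℂ] (Fin 4 → ℂ) :=
  hatEquiv.toLinearMap ∘ₗ rep A ∘ₗ hatEquiv.symm.toLinearMap

theorem cubicRep_hatEquiv (A : Matrix (Fin 2) (Fin 2) ℂ) (t : S3) :
    cubicRep A (hatEquiv t) = hatEquiv (rep A t) := by
  simp [cubicRep]

theorem cubicRep_mul (A B : Matrix (Fin 2) (Fin 2) ℂ) (x : Fin 4 → ℂ) :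
    cubicRep (A * B) x = cubicRep A (cubicRep B x) := by
  simp [cubicRep, rep_mul]

theorem cubicRep_one (x : Fin 4 → ℂ) : cubicRep 1 x = x := by
  simp [cubicRep, rep_one]

theorem repr_cubeAct (A : Matrix (Fin 2) (Fin 2) ℂ) (t : Cube) (i j k : Fin 2) :
    cubeBasis.repr (cubeAct A t) ((i, j), k) =
      ∑ l, ∑ m, ∑ n, A i l * A j m * A k n * cubeBasis.repr t ((l, m), n) := by
  induction t using TensorProduct.induction_on with
  | zero => simp
  | add x y hx hy =>
    simp only [map_add, Finsupp.add_apply, hx, hy, mul_add, Finset.sum_add_distrib]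
  | tmul x z =>
    induction x using TensorProduct.induction_on with
    | zero => simp
    | add x y hx hy =>
      simp only [TensorProduct.add_tmul, map_add, Finsupp.add_apply, hx, hy, mul_add,
        Finset.sum_add_distrib]
    | tmul x y =>
      simp only [cubeAct, cubeBasis, TensorProduct.map_tmul, Module.Basis.tensorProduct_repr_tmul_apply,
        Pi.basisFun_repr, Matrix.toLin'_apply, Matrix.mulVec, dotProduct, smul_eq_mul,
        Fin.sum_univ_two]
      ring

theorem cubicRep_cubicVec (A : Matrix (Fin 2) (Fin 2) ℂ) (c : Fin 4 → ℂ) :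
    cubicRep A (cubicVec c) = cubicVec
      ![A 0 0 ^ 3 * c 0 + 3 * A 0 0 ^ 2 * A 0 1 * c 1 + 3 * A 0 0 * A 0 1 ^ 2 * c 2
          + A 0 1 ^ 3 * c 3,
        A 0 0 ^ 2 * A 1 0 * c 0 + (A 0 0 ^ 2 * A 1 1 + 2 * A 0 0 * A 0 1 * A 1 0) * c 1
          + (2 * A 0 0 * A 0 1 * A 1 1 + A 0 1 ^ 2 * A 1 0) * c 2 + A 0 1 ^ 2 * A 1 1 * c 3,
        A 0 0 * A 1 0 ^ 2 * c 0 + (2 * A 0 0 * A 1 0 * A 1 1 + A 0 1 * A 1 0 ^ 2) * c 1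
          + (A 0 0 * A 1 1 ^ 2 + 2 * A 0 1 * A 1 0 * A 1 1) * c 2 + A 0 1 * A 1 1 ^ 2 * c 3,
        A 1 0 ^ 3 * c 0 + 3 * A 1 0 ^ 2 * A 1 1 * c 1 + 3 * A 1 0 * A 1 1 ^ 2 * c 2
          + A 1 1 ^ 3 * c 3] := by
  have h3 := sqrt3_ne
  change hatCoord (cubeAct A (∑ m, cubicVec c m • hat m)) = _
  ext k
  rw [hatCoord]
  simp only [repr_cubeAct, repr_sum_hat, Fin.sum_univ_two]
  fin_cases k <;> simp [cubicVec] <;> field_simp <;> ring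

theorem jCoord_cubicVec (c : Fin 4 → ℂ) : HyperHermitian.jCoord (cubicVec c) =
    cubicVec ![-(starRingEnd ℂ) (c 3), (starRingEnd ℂ) (c 2), -(starRingEnd ℂ) (c 1),
      (starRingEnd ℂ) (c 0)] := by
  ext k; fin_cases k <;> simp [HyperHermitian.jCoord, cubicVec]

theorem sqrt3_mul_self : (Real.sqrt 3 : ℂ) * (Real.sqrt 3 : ℂ) = 3 := by
  rw [← Complex.ofReal_mul, Real.mul_self_sqrt (by norm_num)]; norm_num

theorem herm_cubicVec (c c' : Fin 4 → ℂ) : HyperHermitian.herm (cubicVec c) (cubicVec c') =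
    c 0 * (starRingEnd ℂ) (c' 0) + 3 * c 1 * (starRingEnd ℂ) (c' 1) +
      3 * c 2 * (starRingEnd ℂ) (c' 2) + c 3 * (starRingEnd ℂ) (c' 3) := by
  simp only [HyperHermitian.herm, cubicVec, Fin.sum_univ_four, map_mul, map_neg, Complex.conj_ofReal,
    Matrix.cons_val_zero, Matrix.cons_val_one, Matrix.cons_val]
  linear_combination (c 1 * (starRingEnd ℂ) (c' 1) + c 2 * (starRingEnd ℂ) (c' 2)) * sqrt3_mul_self

/-- With `p = c₀c₂ - c₁²`, `q = c₀c₃ - c₁c₂`, `r = c₁c₃ - c₂²` the right side is `9 (4pr - q²)`: up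
to a constant, the discriminant of a cubic is that of its Hessian `pX² + qXY + rY²`. Both the
invariance and the critical points are read off from this form. -/
theorem disc_cubicVec (c : Fin 4 → ℂ) : HyperHermitian.disc (cubicVec c) =
    9 * (4 * (c 0 * c 2 - c 1 ^ 2) * (c 1 * c 3 - c 2 ^ 2) - (c 0 * c 3 - c 1 * c 2) ^ 2) := by
  have h := sqrt3_mul_self
  have h4 : (Real.sqrt 3 : ℂ) ^ 4 = 9 := by
    rw [show (Real.sqrt 3 : ℂ) ^ 4 = (Real.sqrt 3 * Real.sqrt 3) * (Real.sqrt 3 * Real.sqrt 3) by ring, h]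
    norm_num
  simp only [HyperHermitian.disc, cubicVec, Matrix.cons_val_zero, Matrix.cons_val_one, Matrix.cons_val]
  linear_combination (18 * c 0 * c 1 * c 2 * c 3) * h
    + (-4 * c 0 * c 2 ^ 3 - 4 * c 1 ^ 3 * c 3 + 3 * c 1 ^ 2 * c 2 ^ 2) * h4

/-- The Hessian is a covariant: the new `p, q, r` are `(det A)²` times a quadratic substitution in
the old ones, and this substitution multiplies `4pr - q²` by `(det A)²` once more. -/
theorem disc_cubicRep {A : Matrix (Fin 2) (Fin 2) ℂ} (hA : A.det = 1) (x : Fin 4 → ℂ) :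
    HyperHermitian.disc (cubicRep A x) = HyperHermitian.disc x := by
  obtain ⟨c, rfl⟩ := exists_cubicVec x
  rw [cubicRep_cubicVec, disc_cubicVec, disc_cubicVec]
  rw [Matrix.det_fin_two] at hA
  simp only [Matrix.cons_val_zero, Matrix.cons_val_one, Matrix.cons_val]
  generalize A 0 0 = a, A 0 1 = b, A 1 0 = c', A 1 1 = d at *
  generalize c 0 = c₀, c 1 = c₁, c 2 = c₂, c 3 = c₃
  set p := c₀ * c₂ - c₁ ^ 2 with hp
  set q := c₀ * c₃ - c₁ * c₂ with hq
  set r := c₁ * c₃ - c₂ ^ 2 with hr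
  have e1 : ∀ {u v w : ℂ}, u = (a * d - b * c') ^ 2 * v → v = w → u = w := fun h1 h2 => by
    rw [h1, hA, h2]; ring
  rw [e1 (u := (a ^ 3 * c₀ + 3 * a ^ 2 * b * c₁ + 3 * a * b ^ 2 * c₂ + b ^ 3 * c₃) *
      (a * c' ^ 2 * c₀ + (2 * a * c' * d + b * c' ^ 2) * c₁ + (a * d ^ 2 + 2 * b * c' * d) * c₂
        + b * d ^ 2 * c₃) -
      (a ^ 2 * c' * c₀ + (a ^ 2 * d + 2 * a * b * c') * c₁ + (2 * a * b * d + b ^ 2 * c') * c₂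
        + b ^ 2 * d * c₃) ^ 2) (v := a ^ 2 * p + a * b * q + b ^ 2 * r)
      (by rw [hp, hq, hr]; ring) rfl,
    e1 (u := (a ^ 2 * c' * c₀ + (a ^ 2 * d + 2 * a * b * c') * c₁
        + (2 * a * b * d + b ^ 2 * c') * c₂ + b ^ 2 * d * c₃) *
      (c' ^ 3 * c₀ + 3 * c' ^ 2 * d * c₁ + 3 * c' * d ^ 2 * c₂ + d ^ 3 * c₃) -
      (a * c' ^ 2 * c₀ + (2 * a * c' * d + b * c' ^ 2) * c₁ + (a * d ^ 2 + 2 * b * c' * d) * c₂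
        + b * d ^ 2 * c₃) ^ 2) (v := c' ^ 2 * p + c' * d * q + d ^ 2 * r)
      (by rw [hp, hq, hr]; ring) rfl,
    e1 (u := (a ^ 3 * c₀ + 3 * a ^ 2 * b * c₁ + 3 * a * b ^ 2 * c₂ + b ^ 3 * c₃) *
      (c' ^ 3 * c₀ + 3 * c' ^ 2 * d * c₁ + 3 * c' * d ^ 2 * c₂ + d ^ 3 * c₃) -
      (a ^ 2 * c' * c₀ + (a ^ 2 * d + 2 * a * b * c') * c₁
        + (2 * a * b * d + b ^ 2 * c') * c₂ + b ^ 2 * d * c₃) *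
      (a * c' ^ 2 * c₀ + (2 * a * c' * d + b * c' ^ 2) * c₁ + (a * d ^ 2 + 2 * b * c' * d) * c₂
        + b * d ^ 2 * c₃)) (v := 2 * a * c' * p + (a * d + b * c') * q + 2 * b * d * r)
      (by rw [hp, hq, hr]; ring) rfl]
  linear_combination 9 * (4 * p * r - q ^ 2) * (a * d - b * c' + 1) * hA

/-- The matrix with first column `(a, b)` in the image of the quaternions. -/
def quatMatrix (a b : ℂ) : Matrix (Fin 2) (Fin 2) ℂ :=
  !![a, -(starRingEnd ℂ) b; b, (starRingEnd ℂ) a]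

/-- For a unitary matrix of determinant one the adjoint equals the adjugate, and comparing entries
gives the quaternionic shape. -/
theorem mem_specialUnitaryGroup_iff_quatMatrix {A : Matrix (Fin 2) (Fin 2) ℂ} :
    A ∈ Matrix.specialUnitaryGroup (Fin 2) ℂ ↔ ∃ a b : ℂ,
      a * (starRingEnd ℂ) a + b * (starRingEnd ℂ) b = 1 ∧ A = quatMatrix a b := by
  rw [Matrix.mem_specialUnitaryGroup_iff]
  constructor
  · rintro ⟨hU, hd⟩
    have h1 : A * star A = 1 := Matrix.mem_unitaryGroup_iff.1 hU
    have h2 : star A = A.adjugate := by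
      have h3 := Matrix.adjugate_mul A
      rw [hd, one_smul] at h3
      calc star A = (A.adjugate * A) * star A := by rw [h3, one_mul]
        _ = A.adjugate := by rw [mul_assoc, h1, mul_one]
    rw [Matrix.adjugate_fin_two] at h2
    have e1 := congrFun (congrFun h2 0) 0
    have e2 := congrFun (congrFun h2 1) 0
    have e3 := congrFun (congrFun h2 0) 1
    simp only [Matrix.star_apply, Matrix.of_apply, Matrix.cons_val', Matrix.cons_val_zero,
      Matrix.cons_val_one, Matrix.cons_val_fin_one, RCLike.star_def] at e1 e2 e3
    rw [Matrix.det_fin_two] at hd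
    refine ⟨A 0 0, A 1 0, ?_, ?_⟩
    · rw [e1, e3]; linear_combination hd
    · ext i j
      fin_cases i <;> fin_cases j <;> simp [quatMatrix, e1, e3]
  · rintro ⟨a, b, hab, rfl⟩
    refine ⟨Matrix.mem_unitaryGroup_iff.2 ?_, ?_⟩
    · ext i j
      fin_cases i <;> fin_cases j <;>
        simp [quatMatrix, Matrix.mul_apply, Fin.sum_univ_two] <;>
        first | linear_combination hab | ring
    · rw [quatMatrix, Matrix.det_fin_two_of]; linear_combination hab

theorem jCoord_cubicRep (a b : ℂ) (x : Fin 4 → ℂ) :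
    cubicRep (quatMatrix a b) (HyperHermitian.jCoord x) =
      HyperHermitian.jCoord (cubicRep (quatMatrix a b) x) := by
  obtain ⟨c, rfl⟩ := exists_cubicVec x
  rw [cubicRep_cubicVec, jCoord_cubicVec, jCoord_cubicVec, cubicRep_cubicVec]
  congr 1
  ext k; fin_cases k <;> simp [quatMatrix, map_ofNat] <;> ring

/-- A quaternion scales the Hermitian form of `Δ` by `|a|² + |b|²`, hence that of the third
symmetric power by the cube of this number. -/
theorem herm_cubicRep {a b : ℂ} (hab : a * (starRingEnd ℂ) a + b * (starRingEnd ℂ) b = 1)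
    (x y : Fin 4 → ℂ) :
    HyperHermitian.herm (cubicRep (quatMatrix a b) x) (cubicRep (quatMatrix a b) y) =
      HyperHermitian.herm x y := by
  obtain ⟨c, rfl⟩ := exists_cubicVec x
  obtain ⟨c', rfl⟩ := exists_cubicVec y
  have h3 : (a * (starRingEnd ℂ) a + b * (starRingEnd ℂ) b) ^ 3 = 1 := by rw [hab, one_pow]
  rw [cubicRep_cubicVec, cubicRep_cubicVec, herm_cubicVec, herm_cubicVec]
  simp only [quatMatrix, Matrix.cons_val_zero, Matrix.cons_val_one, Matrix.cons_val,
    Matrix.of_apply, Matrix.cons_val', Matrix.cons_val_fin_one, map_add, map_mul, map_pow, map_neg,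
    map_ofNat, Complex.conj_conj]
  linear_combination (c 0 * (starRingEnd ℂ) (c' 0) + 3 * c 1 * (starRingEnd ℂ) (c' 1) +
      3 * c 2 * (starRingEnd ℂ) (c' 2) + c 3 * (starRingEnd ℂ) (c' 3)) * h3

open HyperHermitian

/-- The derivative of the discriminant at `x` in direction `y`. -/
def dDisc (x y : Fin 4 → ℂ) : ℂ :=
  (8 * (disc (x + y) - disc (x - y)) - (disc (x + (2 : ℂ) • y) - disc (x - (2 : ℂ) • y))) / 12

/-- The five-point difference quotient is exact on polynomials of degree four, so it is the true
derivative. Defined through values of `disc`, it inherits invariance under linear maps without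
calculus, as used in `dDisc_map`. -/
theorem dDisc_eq (x y : Fin 4 → ℂ) : dDisc x y =
    (-18 * x 1 * x 2 * x 3 + 4 * (Real.sqrt 3 : ℂ) * x 3 ^ 3 - 18 * x 0 * x 2 ^ 2) * y 0
    + (-18 * x 0 * x 2 * x 3 - 12 * (Real.sqrt 3 : ℂ) * x 1 ^ 2 * x 2 + 6 * x 1 * x 3 ^ 2) * y 1
    + (-18 * x 0 * x 1 * x 3 - 4 * (Real.sqrt 3 : ℂ) * x 1 ^ 3 - 18 * x 0 ^ 2 * x 2) * y 2
    + (-18 * x 0 * x 1 * x 2 + 12 * (Real.sqrt 3 : ℂ) * x 0 * x 3 ^ 2 + 6 * x 1 ^ 2 * x 3) * y 3 := by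
  simp only [dDisc, disc, Pi.add_apply, Pi.sub_apply, Pi.smul_apply, smul_eq_mul]
  ring

/-- A cubic at which the derivative of the discriminant vanishes is a cube. -/
theorem exists_eq_cube {c : Fin 4 → ℂ} (h : ∀ y, dDisc (cubicVec c) y = 0) :
    ∃ a b, c 0 = a ^ 3 ∧ c 1 = a ^ 2 * b ∧ c 2 = a * b ^ 2 ∧ c 3 = b ^ 3 := by
  have h3 := sqrt3_mul_self
  have h3' := sqrt3_ne
  have g0 := h (Pi.single 0 1)
  have g1 := h (Pi.single 1 1)
  have g2 := h (Pi.single 2 1)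
  have g3 := h (Pi.single 3 1)
  rw [dDisc_eq] at g0 g1 g2 g3
  simp [cubicVec] at g0 g1 g2 g3
  generalize (Real.sqrt 3 : ℂ) = s at *
  generalize c 0 = c₀, c 1 = c₁, c 2 = c₂, c 3 = c₃ at *
  obtain ⟨p, hp⟩ : ∃ p, p = c₀ * c₂ - c₁ ^ 2 := ⟨_, rfl⟩
  obtain ⟨q, hq⟩ : ∃ q, q = c₀ * c₃ - c₁ * c₂ := ⟨_, rfl⟩
  obtain ⟨r, hr⟩ : ∃ r, r = c₁ * c₃ - c₂ ^ 2 := ⟨_, rfl⟩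
  have h4 : s ^ 4 = 9 := by linear_combination (s * s + 3) * h3
  -- The relations `k0` to `k3` are the partial derivatives of `4pr - q²`, each up to the factor
  -- `-1/2`.
  have k0 : q * c₃ - 2 * (r * c₂) = 0 := by
    apply mul_left_cancel₀ (show (18 : ℂ) ≠ 0 by norm_num)
    rw [hq, hr]
    linear_combination -g0 + 18 * c₁ * c₂ * c₃ * h3 - 4 * c₂ ^ 3 * h4
  have k1 : -(q * c₂) + 4 * (r * c₁) - 2 * (p * c₃) = 0 := by
    apply mul_left_cancel₀ (mul_ne_zero (show (18 : ℂ) ≠ 0 by norm_num) h3')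
    rw [hp, hq, hr]
    linear_combination -3 * g1 + s * (-36 * c₁ ^ 2 * c₃ + 18 * c₁ * c₂ ^ 2) * h3
  have k2 : -(q * c₁) + 4 * (p * c₂) - 2 * (r * c₀) = 0 := by
    apply mul_left_cancel₀ (mul_ne_zero (show (18 : ℂ) ≠ 0 by norm_num) h3')
    rw [hp, hq, hr]
    linear_combination 3 * g3 - s * (36 * c₀ * c₂ ^ 2 - 18 * c₁ ^ 2 * c₂) * h3
  have k3 : q * c₀ - 2 * (p * c₁) = 0 := by
    apply mul_left_cancel₀ (show (18 : ℂ) ≠ 0 by norm_num)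
    rw [hp, hq]
    linear_combination -g2 + 18 * c₀ * c₁ * c₂ * h3 - 4 * c₁ ^ 3 * h4
  -- The syzygies `c₀r - c₁q + c₂p = 0` and `c₁r - c₂q + c₃p = 0` of the Hessian simplify the two
  -- middle relations. Afterwards `p²`, `r²` and `q²` are combinations of vanishing expressions.
  have l1 : q * c₁ - 2 * (p * c₂) = 0 := by
    have : c₀ * r - c₁ * q + c₂ * p = 0 := by rw [hp, hq, hr]; ring
    linear_combination (-1 / 3) * k2 - 2 / 3 * this
  have l2 : q * c₂ - 2 * (r * c₁) = 0 := by
    have : c₁ * r - c₂ * q + c₃ * p = 0 := by rw [hp, hq, hr]; ring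
    linear_combination (-1 / 3) * k1 - 2 / 3 * this
  have p0 : p = 0 := by
    have : p * p = 0 := by
      linear_combination (p : ℂ) * hp - c₀ / 2 * l1 + c₁ / 2 * k3
    simpa using this
  have r0 : r = 0 := by
    have : r * r = 0 := by
      linear_combination (r : ℂ) * hr - c₃ / 2 * l2 + c₂ / 2 * k0
    simpa using this
  have q0 : q = 0 := by
    have : q * q = 0 := by
      rw [p0] at k3 l1
      linear_combination (q : ℂ) * hq + c₃ * k3 - c₂ * l1
    simpa using this
  rw [p0] at hp
  rw [q0] at hq
  rw [r0] at hr
  -- A zero Hessian means that `(c₀,c₁,c₂)` and `(c₁,c₂,c₃)` are proportional, so the coefficients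
  -- form a geometric progression and a cube root of `c₀`, or of `c₃` if `c₀ = 0`, exhibits the
  -- cube.
  by_cases h0 : c₀ = 0
  · subst h0
    have h1 : c₁ = 0 := by simpa using hp
    subst h1
    have h2 : c₂ = 0 := by simpa using hr
    subst h2
    obtain ⟨b, hb⟩ := IsAlgClosed.exists_pow_nat_eq c₃ (n := 3) (by norm_num)
    exact ⟨0, b, by simp, by simp, by simp, hb.symm⟩
  · obtain ⟨a, ha⟩ := IsAlgClosed.exists_pow_nat_eq c₀ (n := 3) (by norm_num)
    have ha0 : a ≠ 0 := by rintro rfl; exact h0 (by rw [← ha]; simp)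
    subst ha
    refine ⟨a, c₁ / a ^ 2, rfl, by field_simp, ?_, ?_⟩
    · field_simp
      linear_combination -hp
    · field_simp
      apply mul_left_cancel₀ (pow_ne_zero 3 ha0)
      linear_combination -a ^ 6 * hq - c₁ * hp * a ^ 3

theorem dDisc_map (L : (Fin 4 → ℂ) →ₗ[ℂ] (Fin 4 → ℂ)) (hd : ∀ x, disc (L x) = disc x)
    (x y : Fin 4 → ℂ) : dDisc (L x) (L y) = dDisc x y := by
  simp only [dDisc, ← map_smul, ← map_add, ← map_sub, hd]

/-- A quaternionic unitary map of `ℂ⁴` that preserves the discriminant belongs to `SU(2)`. -/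
theorem exists_eq_cubicRep (L : (Fin 4 → ℂ) →ₗ[ℂ] (Fin 4 → ℂ)) (hd : ∀ x, disc (L x) = disc x)
    (hJ : ∀ x, L (jCoord x) = jCoord (L x)) (hh : ∀ x y, herm (L x) (L y) = herm x y) :
    ∃ U ∈ Matrix.specialUnitaryGroup (Fin 2) ℂ, ∀ x, L x = cubicRep U x := by
  have hinj : Function.Injective L := by
    rw [← LinearMap.ker_eq_bot, LinearMap.ker_eq_bot']
    intro x hx
    have h1 := congrArg Complex.re (hh x x)
    rw [hx] at h1
    simp only [herm, Fin.sum_univ_four, Complex.mul_conj, Complex.add_re, Complex.ofReal_re] at h1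
    simp at h1
    have h2 := fun k => Complex.normSq_nonneg (x k)
    ext k
    apply Complex.normSq_eq_zero.1
    fin_cases k <;> simp only [Fin.zero_eta, Fin.mk_one, Fin.reduceFinMk] <;>
      linarith [h2 0, h2 1, h2 2, h2 3]
  have hsurj := LinearMap.injective_iff_surjective.1 hinj
  obtain ⟨c, hc⟩ := exists_cubicVec (L (Pi.single 0 1))
  -- The vector `e₁` is a critical point of the discriminant; `L` is onto and preserves the
  -- discriminant, so `L e₁` is critical as well and hence a cube.
  obtain ⟨a, b, c0, c1, c2, c3⟩ := exists_eq_cube (c := c) fun y => by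
    obtain ⟨y, rfl⟩ := hsurj y
    rw [hc, dDisc_map L hd, dDisc_eq]
    simp
  have hab : a * (starRingEnd ℂ) a + b * (starRingEnd ℂ) b = 1 := by
    have h1 := hh (Pi.single 0 1) (Pi.single 0 1)
    rw [← hc, herm_cubicVec, c0, c1, c2, c3] at h1
    have h2 : (a * (starRingEnd ℂ) a + b * (starRingEnd ℂ) b) ^ 3 = 1 := by
      have h3 : herm (Pi.single 0 1) (Pi.single 0 1) = 1 := by
        simp [herm, Fin.sum_univ_four]
      rw [h3] at h1
      simp only [map_mul, map_pow] at h1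
      linear_combination h1
    rw [Complex.mul_conj, Complex.mul_conj, ← Complex.ofReal_add] at h2 ⊢
    have h4 : (Complex.normSq a + Complex.normSq b) ^ 3 = 1 := by exact_mod_cast h2
    have h5 := (pow_eq_one_iff_of_nonneg (add_nonneg (Complex.normSq_nonneg a)
      (Complex.normSq_nonneg b)) (by norm_num : (3 : ℕ) ≠ 0)).1 h4
    rw [h5]; simp
  have hinv : quatMatrix ((starRingEnd ℂ) a) (-b) * quatMatrix a b = 1 := by
    ext i j
    fin_cases i <;> fin_cases j <;>
      simp [quatMatrix, Matrix.mul_apply, Fin.sum_univ_two] <;>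
      first | linear_combination hab | ring
  have hinv' : quatMatrix a b * quatMatrix ((starRingEnd ℂ) a) (-b) = 1 := by
    rwa [mul_eq_one_comm]
  have hab' : (starRingEnd ℂ) a * (starRingEnd ℂ) ((starRingEnd ℂ) a) +
      -b * (starRingEnd ℂ) (-b) = 1 := by
    rw [Complex.conj_conj, map_neg]; linear_combination hab
  have hdet : (quatMatrix ((starRingEnd ℂ) a) (-b)).det = 1 :=
    (Matrix.mem_specialUnitaryGroup_iff.1 (mem_specialUnitaryGroup_iff_quatMatrix.2 ⟨_, _, hab', rfl⟩)).2
  -- reduce to a map that fixes the first basis vector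
  set M := cubicRep (quatMatrix ((starRingEnd ℂ) a) (-b)) ∘ₗ L with hM
  have hMd : ∀ x, disc (M x) = disc x := fun x => by
    rw [hM, LinearMap.comp_apply, disc_cubicRep hdet, hd]
  have hMJ : ∀ x, M (jCoord x) = jCoord (M x) := fun x => by
    rw [hM, LinearMap.comp_apply, hJ, jCoord_cubicRep]; rfl
  have hMh : ∀ x y, herm (M x) (M y) = herm x y := fun x y => by
    rw [hM, LinearMap.comp_apply, LinearMap.comp_apply, herm_cubicRep hab', hh]
  have hLM : ∀ x, L x = cubicRep (quatMatrix a b) (M x) := fun x => by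
    rw [hM, LinearMap.comp_apply, ← cubicRep_mul, hinv', cubicRep_one]
  have hM0 : M (Pi.single 0 1) = Pi.single 0 1 := by
    have h1 : L (Pi.single 0 1) = cubicRep (quatMatrix a b) (Pi.single 0 1) := by
      have h2 : (Pi.single 0 1 : Fin 4 → ℂ) = cubicVec ![1, 0, 0, 0] := by
        ext k; fin_cases k <;> simp [cubicVec]
      rw [← hc, h2, cubicRep_cubicVec]
      congr 1
      ext k; fin_cases k <;> simp [quatMatrix, c0, c1, c2, c3]
    rw [hM, LinearMap.comp_apply, h1, ← cubicRep_mul, hinv, cubicRep_one]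
  have hM2 : M (Pi.single 2 1) = Pi.single 2 1 := by
    have h1 : jCoord (Pi.single 0 1) = Pi.single 2 1 := by
      ext k; fin_cases k <;> simp [jCoord]
    rw [← h1, hMJ, hM0]
  -- The vectors `e₁` and `e₃ = j e₁` are fixed, so by unitarity `M e₂` lies in the span of `e₂,
  -- e₄`, and it determines `M` through `j`.
  obtain ⟨u, hu⟩ : ∃ u, u = M (Pi.single 1 1) := ⟨_, rfl⟩
  have hM3 : M (Pi.single 3 1) = jCoord u := by
    have h1 : jCoord (Pi.single 1 1) = Pi.single 3 1 := by
      ext k; fin_cases k <;> simp [jCoord]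
    rw [← h1, hMJ, hu]
  have u0 : u 0 = 0 := by
    have h1 := hMh (Pi.single 1 1) (Pi.single 0 1)
    rw [hM0, ← hu] at h1
    simpa [herm, Fin.sum_univ_four] using h1
  have u2 : u 2 = 0 := by
    have h1 := hMh (Pi.single 1 1) (Pi.single 2 1)
    rw [hM2, ← hu] at h1
    simpa [herm, Fin.sum_univ_four] using h1
  have hMx : ∀ x, M x = ![x 0, u 1 * x 1 - (starRingEnd ℂ) (u 3) * x 3, x 2,
      u 3 * x 1 + (starRingEnd ℂ) (u 1) * x 3] := fun x => by
    have hx : x = x 0 • Pi.single 0 1 + x 1 • Pi.single 1 1 + x 2 • Pi.single 2 1 +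
        x 3 • Pi.single 3 1 := by
      ext k; fin_cases k <;> simp
    conv_lhs => rw [hx]
    simp only [map_add, map_smul, hM0, hM2, hM3, ← hu]
    ext k; fin_cases k <;> simp [jCoord, u0, u2] <;> ring
  -- The discriminant vanishes at `e₂` and at `e₁ + e₂`. At the images this reads `u₁u₃ = 0` and
  -- `4√3 u₃³ + 3u₁²u₃² = 0`.
  have hu3 : u 3 = 0 := by
    have e1 := hMd ![1, 1, 0, 0]
    have e2 := hMd ![0, 1, 0, 0]
    rw [hMx] at e1 e2
    simp [disc] at e1 e2
    rcases e2 with e2 | e2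
    · simpa [e2] using e1
    · exact e2
  -- At `e₁ + e₄` the discriminant is `4√3`, and at the image it is `4√3` times the cube of the
  -- conjugate of `u₁`.
  have hu1 : u 1 ^ 3 = 1 := by
    have e1 := hMd ![1, 0, 0, 1]
    rw [hMx] at e1
    simp [disc, hu3] at e1
    have e2 := congrArg (starRingEnd ℂ) e1
    simpa using e2
  have hu1' : u 1 * (starRingEnd ℂ) (u 1) = 1 := by
    have h1 := hMh (Pi.single 1 1) (Pi.single 1 1)
    rw [← hu] at h1
    simpa [herm, Fin.sum_univ_four, u0, u2, hu3] using h1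
  -- The matrix `diag(u, ū)` acts on cubics with weights `u³, u, ū, ū³`. For `u³ = 1` the outer two
  -- are trivial, which is exactly `M`.
  have hMrep : ∀ x, M x = cubicRep (quatMatrix (u 1) 0) x := fun x => by
    obtain ⟨c, rfl⟩ := exists_cubicVec x
    rw [hMx, cubicRep_cubicVec]
    have e1 : (starRingEnd ℂ) (u 1) ^ 3 = 1 := by rw [← map_pow, hu1, map_one]
    have e2 : u 1 ^ 2 * (starRingEnd ℂ) (u 1) = u 1 := by linear_combination u 1 * hu1'
    have e3 : u 1 * (starRingEnd ℂ) (u 1) ^ 2 = (starRingEnd ℂ) (u 1) := by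
      linear_combination (starRingEnd ℂ) (u 1) * hu1'
    ext k; fin_cases k <;> simp [cubicVec, quatMatrix, hu3, hu1, e1, e2, e3] <;> ring
  refine ⟨quatMatrix a b * quatMatrix (u 1) 0, mul_mem
    (mem_specialUnitaryGroup_iff_quatMatrix.2 ⟨a, b, hab, rfl⟩)
    (mem_specialUnitaryGroup_iff_quatMatrix.2 ⟨u 1, 0, by simpa using hu1', rfl⟩), fun x => ?_⟩
  rw [hLM, hMrep, cubicRep_mul]

end SymCube
end

/-! ### The stabilizers in `Sp(2)` and in `Sp(2)Sp(1)` -/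

noncomputable section

namespace HyperHermitian

open Tensor4 SymCube

variable {V : Type*} [NormedAddCommGroup V] [InnerProductSpace ℝ V]

theorem units_apply_inv (A : (V →L[ℝ] V)ˣ) (v : V) :
    (A : V →L[ℝ] V) (((A⁻¹ : (V →L[ℝ] V)ˣ) : V →L[ℝ] V) v) = v :=
  congrArg (fun T : V →L[ℝ] V => T v) (Units.mul_inv A)

variable (h : HyperHermitian V)

theorem mem_Sp_iff {A : (V →L[ℝ] V)ˣ} : A ∈ h.Sp ↔
    (∀ x y, inner ℝ ((A : V →L[ℝ] V) x) ((A : V →L[ℝ] V) y) = inner ℝ x y) ∧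
    (∀ v, (A : V →L[ℝ] V) (h.J₁ v) = h.J₁ ((A : V →L[ℝ] V) v)) ∧
    (∀ v, (A : V →L[ℝ] V) (h.J₂ v) = h.J₂ ((A : V →L[ℝ] V) v)) := by
  constructor
  · rintro ⟨h0, h1, h2, -⟩
    exact ⟨h0, fun v => congrArg (fun T : V →L[ℝ] V => T v) h1,
      fun v => congrArg (fun T : V →L[ℝ] V => T v) h2⟩
  · rintro ⟨h0, h1, h2⟩
    refine ⟨h0, ContinuousLinearMap.ext h1, ContinuousLinearMap.ext h2,
      ContinuousLinearMap.ext fun v => ?_⟩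
    change (A : V →L[ℝ] V) (h.J₃ v) = h.J₃ ((A : V →L[ℝ] V) v)
    rw [← J₁_J₂, ← J₁_J₂, h1, h2]

variable {h}

/-! ### The stabilizer in `Sp(2)` -/

/-- The definition on `S³Δ` is transported to the coordinates of `V`. Since `cubicRep U` is complex
linear, the imaginary part of the condition follows from the real part. -/
theorem mem_SpOneIr_iff {e : Module.Basis (Fin 4) ℂ h.W} {B : (V →L[ℝ] V)ˣ} : B ∈ h.SpOneIr e ↔
    ∃ U ∈ Matrix.specialUnitaryGroup (Fin 2) ℂ, ∀ v,
      h.coord e ((B : V →L[ℝ] V) v) = cubicRep U (h.coord e v) := by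
  have hequiv : ∀ t, (hatBasis.equiv e (Equiv.refl _) t : Cplx V) =
      h.toW ((h.coord e).symm (hatEquiv t)) := fun t => by
    rw [toW_coord_symm]
    congr 1
    have : hatBasis.equiv e (Equiv.refl _) = hatEquiv.trans e.equivFun.symm :=
      hatBasis.ext' fun k => by
        rw [Module.Basis.equiv_apply]; simp [hatBasis]
    rw [this]; rfl
  change (∃ U ∈ Matrix.specialUnitaryGroup (Fin 2) ℂ, _) ↔ _
  refine exists_congr fun U => and_congr_right fun hU => ?_
  simp only [hequiv, ext_toW, ← cubicRep_hatEquiv]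
  constructor
  · intro hB v
    have h1 := (hB (hatEquiv.symm (h.coord e v))).1
    rw [LinearEquiv.apply_symm_apply, LinearEquiv.symm_apply_apply] at h1
    rw [h1, LinearEquiv.apply_symm_apply]
  · intro hB t
    constructor
    · apply (h.coord e).injective
      rw [hB, LinearEquiv.apply_symm_apply, LinearEquiv.apply_symm_apply]
    · apply (h.coord e).injective
      rw [hB, coord_J₁, coord_J₁, LinearEquiv.apply_symm_apply, LinearEquiv.apply_symm_apply,
        map_smul]

/-- An element of `Sp(2)` as a complex linear map of `ℂ⁴`. -/
def frameMap {κ : V ≃ₗ[ℝ] (Fin 4 → ℂ)} (hκ : h.IsFrame κ) {A : V →L[ℝ] V}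
    (hA : ∀ v, A (h.J₁ v) = h.J₁ (A v)) : (Fin 4 → ℂ) →ₗ[ℂ] (Fin 4 → ℂ) where
  toFun x := κ (A (κ.symm x))
  map_add' x y := by simp
  map_smul' a x := by
    have h1 : κ.symm (a • x) = a.re • κ.symm x + a.im • h.J₁ (κ.symm x) := by
      apply κ.injective
      rw [LinearEquiv.apply_symm_apply, map_add, map_smul, map_smul, hκ.J₁,
        LinearEquiv.apply_symm_apply]
      ext k
      simp only [Pi.add_apply, Pi.smul_apply, smul_eq_mul, Complex.real_smul]
      rw [← mul_assoc, ← add_mul, Complex.re_add_im]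
    rw [h1, map_add, map_smul, map_smul, hA, map_add, map_smul, map_smul, hκ.J₁]
    ext k
    simp only [Pi.add_apply, Pi.smul_apply, smul_eq_mul, Complex.real_smul, RingHom.id_apply]
    rw [← mul_assoc, ← add_mul, Complex.re_add_im]

theorem frameMap_apply {κ : V ≃ₗ[ℝ] (Fin 4 → ℂ)} (hκ : h.IsFrame κ) {A : V →L[ℝ] V}
    (hA : ∀ v, A (h.J₁ v) = h.J₁ (A v)) (v : V) : frameMap hκ hA (κ v) = κ (A v) := by
  simp [frameMap]

/-- A real isometry commuting with `J₁` is unitary in coordinates because the Hermitian form is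
built from `g` and `J₁`. -/
theorem IsFrame.inner_herm {κ : V ≃ₗ[ℝ] (Fin 4 → ℂ)} (hκ : h.IsFrame κ) (u v : V) :
    herm (κ u) (κ v) = 2 * ((inner ℝ u v : ℝ) : ℂ) + 2 * ((inner ℝ u (h.J₁ v) : ℝ) : ℂ) * Complex.I := by
  rw [hκ.inner_J₁, hκ.inner_eq]
  push_cast
  linear_combination -Complex.re_add_im (herm (κ u) (κ v))

theorem mem_Sp_of_frame {κ : V ≃ₗ[ℝ] (Fin 4 → ℂ)} (hκ : h.IsFrame κ) {A : (V →L[ℝ] V)ˣ}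
    (L : (Fin 4 → ℂ) →ₗ[ℂ] (Fin 4 → ℂ)) (hL : ∀ v, κ ((A : V →L[ℝ] V) v) = L (κ v))
    (hJ : ∀ x, L (jCoord x) = jCoord (L x)) (hh : ∀ x y, herm (L x) (L y) = herm x y) :
    A ∈ h.Sp := by
  refine (h.mem_Sp_iff).2 ⟨fun x y => ?_, fun v => ?_, fun v => ?_⟩
  · rw [hκ.inner_eq, hκ.inner_eq, hL, hL, hh]
  · apply κ.injective
    rw [hL, hκ.J₁, hκ.J₁, hL, map_smul]
  · apply κ.injective
    rw [hL, hκ.J₂, hκ.J₂, hL, hJ]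

theorem SpOneIr_le_Sp {e : Module.Basis (Fin 4) ℂ h.W} (he : h.IsAdapted e) :
    h.SpOneIr e ≤ h.Sp := by
  intro A hA
  obtain ⟨U, hU, hUA⟩ := mem_SpOneIr_iff.1 hA
  obtain ⟨a, b, hab, rfl⟩ := mem_specialUnitaryGroup_iff_quatMatrix.1 hU
  exact mem_Sp_of_frame (h.isFrame_coord he) _ hUA (jCoord_cubicRep a b) (herm_cubicRep hab)

/-- The action of `Sp(2)` on discriminant tensors corresponds to the action on frames. -/
theorem IsDiscFor.act {κ : V ≃ₗ[ℝ] (Fin 4 → ℂ)} {S : Tensor4 V} (hS : IsDiscFor h κ S)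
    {A : (V →L[ℝ] V)ˣ} (hA : A ∈ h.Sp) {κ' : V ≃ₗ[ℝ] (Fin 4 → ℂ)}
    (hκ' : ∀ v, κ' ((A : V →L[ℝ] V) v) = κ v) : IsDiscFor h κ' (act A S) := by
  refine ⟨hS.isSymType.act hA, fun v => ?_⟩
  rw [act_vec, hS.diag, ← hκ', units_apply_inv]

/-- Invariance of `S` at `(v,v,v,v)` and at `(J₁v,v,v,v)` preserves the real and imaginary parts of
the discriminant, so `exists_eq_cubicRep` applies to `A` in coordinates. The converse is
`disc_cubicRep` with uniqueness of the tensor. -/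
theorem act_eq_self_iff [FiniteDimensional ℝ V] {e : Module.Basis (Fin 4) ℂ h.W}
    (he : h.IsAdapted e) {S : Tensor4 V} (hS : IsDiscFor h (h.coord e) S) {A : (V →L[ℝ] V)ˣ}
    (hA : A ∈ h.Sp) : act A S = S ↔ A ∈ h.SpOneIr e := by
  have hκ := h.isFrame_coord he
  obtain ⟨h0, h1, h2⟩ := h.mem_Sp_iff.1 hA
  constructor
  · intro hAS
    have hAS' : act A⁻¹ S = S := by
      nth_rw 1 [← hAS]; rw [act_inv_act]
    have hSA : ∀ x y z w, S ![(A : V →L[ℝ] V) x, (A : V →L[ℝ] V) y, (A : V →L[ℝ] V) z,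
        (A : V →L[ℝ] V) w] = S ![x, y, z, w] := fun x y z w => by
      conv_rhs => rw [← hAS', act_vec, inv_inv]
    have hd : ∀ v, disc (h.coord e ((A : V →L[ℝ] V) v)) = disc (h.coord e v) := fun v => by
      apply Complex.ext
      · have e1 := hSA v v v v
        rw [hS.diag, hS.diag] at e1
        linarith
      · have e1 := hSA (h.J₁ v) v v v
        rw [h1, hS.J₁_diag hκ, hS.J₁_diag hκ] at e1
        linarith
    obtain ⟨U, hU, hUA⟩ := exists_eq_cubicRep (frameMap hκ h1)
      (fun x => by
        obtain ⟨v, rfl⟩ := (h.coord e).surjective x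
        rw [frameMap_apply, hd])
      (fun x => by
        obtain ⟨v, rfl⟩ := (h.coord e).surjective x
        rw [← hκ.J₂, frameMap_apply, frameMap_apply, ← hκ.J₂, h2])
      (fun x y => by
        obtain ⟨u, rfl⟩ := (h.coord e).surjective x
        obtain ⟨v, rfl⟩ := (h.coord e).surjective y
        rw [frameMap_apply, frameMap_apply, hκ.inner_herm, hκ.inner_herm, ← h1, h0, h0])
    exact mem_SpOneIr_iff.2 ⟨U, hU, fun v => by rw [← hUA, frameMap_apply]⟩
  · intro hAe
    obtain ⟨U, hU, hUA⟩ := mem_SpOneIr_iff.1 hAe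
    refine IsDiscFor.unique (κ := h.coord e) ⟨hS.isSymType.act hA, fun v => ?_⟩ hS
    have e1 := hUA (((A⁻¹ : (V →L[ℝ] V)ˣ) : V →L[ℝ] V) v)
    rw [units_apply_inv] at e1
    rw [act_vec, hS.diag, e1, disc_cubicRep (Matrix.mem_specialUnitaryGroup_iff.1 hU).2]

/-- `Sp(2)` acts transitively on frames. -/
theorem exists_Sp_frame [FiniteDimensional ℝ V] {κ κ' : V ≃ₗ[ℝ] (Fin 4 → ℂ)} (hκ : h.IsFrame κ)
    (hκ' : h.IsFrame κ') : ∃ A ∈ h.Sp, ∀ v, κ' ((A : V →L[ℝ] V) v) = κ v := by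
  let A := (κ.trans κ'.symm).toContinuousLinearEquiv
  have hA : ∀ v, κ' (A v) = κ v := fun v => κ'.apply_symm_apply _
  refine ⟨ContinuousLinearEquiv.toUnit A, (h.mem_Sp_iff).2 ⟨fun x y => ?_, fun v => ?_, fun v => ?_⟩, hA⟩
  · change inner ℝ (A x) (A y) = _
    rw [hκ'.inner_eq, hκ.inner_eq, hA, hA]
  · apply κ'.injective
    change κ' (A _) = κ' (h.J₁ (A v))
    rw [hA, hκ.J₁, hκ'.J₁, hA]
  · apply κ'.injective
    change κ' (A _) = κ' (h.J₂ (A v))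
    rw [hA, hκ.J₂, hκ'.J₂, hA]

/-- The orbit `𝒞` is the `Sp(2)`-orbit of any of its elements. -/
theorem mem_orbitC_iff [FiniteDimensional ℝ V] {κ : V ≃ₗ[ℝ] (Fin 4 → ℂ)} (hκ : h.IsFrame κ)
    {S : Tensor4 V} (hS : IsDiscFor h κ S) (K : h.Curv) :
    K ∈ h.orbitC ↔ ∃ A ∈ h.Sp, act A (h.calK S) = K := by
  constructor
  · rintro ⟨T, -, hTK, e, he, hT⟩
    rw [isDiscTensor_iff_isDiscFor he] at hT
    obtain ⟨A, hA, hA'⟩ := exists_Sp_frame hκ (h.isFrame_coord he)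
    refine ⟨A, hA, ?_⟩
    rw [← calK_act S hA, (hS.act hA hA').unique hT, hTK]
  · rintro ⟨A, hA, hAK⟩
    let B : V ≃ₗ[ℝ] V := (ContinuousLinearEquiv.ofUnit A).toLinearEquiv
    have hB : ∀ v, B v = (A : V →L[ℝ] V) v := fun v => rfl
    have hB' : ∀ v, B.symm ((A : V →L[ℝ] V) v) = v := fun v => B.symm_apply_apply v
    obtain ⟨h0, h1, h2⟩ := h.mem_Sp_iff.1 hA
    -- The frame moved by `A` is again a frame, and `A · S` is the discriminant tensor of its
    -- adapted basis.
    have hf : h.IsFrame (B.symm.trans κ) := by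
      refine ⟨fun v => ?_, fun v => ?_, fun u v => ?_⟩
      · obtain ⟨v, rfl⟩ := B.surjective v
        simp only [LinearEquiv.trans_apply, hB, ← h1, hB', hκ.J₁]
      · obtain ⟨v, rfl⟩ := B.surjective v
        simp only [LinearEquiv.trans_apply, hB, ← h2, hB', hκ.J₂]
      · obtain ⟨u, rfl⟩ := B.surjective u
        obtain ⟨v, rfl⟩ := B.surjective v
        simp only [LinearEquiv.trans_apply, hB, hB', h0, hκ.inner_eq]
    refine ⟨Tensor4.act A S, hS.isSymType.act hA, by rw [calK_act S hA, hAK], h.frameBasis hf,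
      h.isAdapted_frameBasis hf, ?_⟩
    rw [isDiscTensor_iff_isDiscFor (h.isAdapted_frameBasis hf), coord_frameBasis]
    exact hS.act hA fun v => by simp [hB']

/-! ### The group `Sp(2)Sp(1)` -/

theorem mem_Q_iff {q : V →L[ℝ] V} : q ∈ h.Q ↔ ∃ y : Fin 4 → ℝ, y 0 = 0 ∧ q = h.quat y := by
  rw [Q, Submodule.mem_span_triple]
  constructor
  · rintro ⟨a, b, c, rfl⟩
    exact ⟨![0, a, b, c], rfl, by simp [quat]⟩
  · rintro ⟨y, hy, rfl⟩
    exact ⟨y 1, y 2, y 3, by simp [quat, hy]⟩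

theorem inner_quat (x : Fin 4 → ℝ) (u v : V) :
    inner ℝ (h.quat x u) (h.quat x v) = (∑ s, x s ^ 2) * inner ℝ u v := by
  have hq : ∀ v, h.quat x v = x 0 • v + x 1 • h.J₁ v + x 2 • h.J₂ v + x 3 • h.J₃ v := fun v => rfl
  simp only [hq, inner_add_left, inner_add_right, real_inner_smul_left, real_inner_smul_right,
    inner_J₁_left, inner_J₂_left, inner_J₃_left, J₁_J₁, J₁_J₂, J₁_J₃, J₂_J₁, J₂_J₂, J₂_J₃,
    J₃_J₁, J₃_J₂, J₃_J₃, inner_neg_right, Fin.sum_univ_four]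
  ring

theorem det_sq_eq_one_of_inner [FiniteDimensional ℝ V] {A : V →L[ℝ] V}
    (hA : ∀ x y, inner ℝ (A x) (A y) = inner ℝ x y) :
    LinearMap.det (A : V →ₗ[ℝ] V) ^ 2 = 1 := by
  have h1 : LinearMap.adjoint (A : V →ₗ[ℝ] V) * (A : V →ₗ[ℝ] V) = 1 := by
    ext v
    refine ext_inner_right ℝ fun w => ?_
    change inner ℝ (LinearMap.adjoint (A : V →ₗ[ℝ] V) ((A : V →ₗ[ℝ] V) v)) w = inner ℝ v w
    rw [LinearMap.adjoint_inner_left]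
    exact hA v w
  have h2 := congrArg LinearMap.det h1
  have b := stdOrthonormalBasis ℝ V
  rw [map_mul, map_one, ← LinearMap.det_toMatrix b.toBasis, LinearMap.toMatrix_adjoint,
    Matrix.det_conjTranspose, LinearMap.det_toMatrix] at h2
  simpa [sq] using h2

/-- A map commuting with `J₁` is complex linear, so its real determinant is the squared modulus of
its complex one. Being nonnegative with square one, it is one. -/
theorem Sp_le_SpSpOne [FiniteDimensional ℝ V] {κ : V ≃ₗ[ℝ] (Fin 4 → ℂ)} (hκ : h.IsFrame κ) :
    h.Sp ≤ h.SpSpOne := by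
  intro A hA
  obtain ⟨h0, h1, h2, h3⟩ := hA
  refine ⟨h0, ?_, ?_⟩
  · have hA1 : ∀ v, (A : V →L[ℝ] V) (h.J₁ v) = h.J₁ ((A : V →L[ℝ] V) v) :=
      fun v => congrArg (fun T : V →L[ℝ] V => T v) h1
    have e1 : LinearMap.det ((A : V →L[ℝ] V) : V →ₗ[ℝ] V) =
        Complex.normSq (LinearMap.det (frameMap hκ hA1)) := by
      rw [← Algebra.norm_complex_apply, ← LinearMap.det_restrictScalars,
        ← LinearMap.det_conj ((A : V →L[ℝ] V) : V →ₗ[ℝ] V) κ]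
      rfl
    have e2 := det_sq_eq_one_of_inner h0
    have e3 : 0 ≤ LinearMap.det ((A : V →L[ℝ] V) : V →ₗ[ℝ] V) := by
      rw [e1]; exact Complex.normSq_nonneg _
    exact (pow_eq_one_iff_of_nonneg e3 two_ne_zero).1 e2
  · intro q hq
    obtain ⟨y, hy, rfl⟩ := mem_Q_iff.1 hq
    have e1 : (A : V →L[ℝ] V) * h.quat y = h.quat y * A := by
      simp only [quat, mul_add, add_mul, mul_smul_comm, smul_mul_assoc, h1, h2, h3, mul_one, one_mul]
    rwa [e1, mul_assoc, Units.mul_inv, mul_one]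

theorem commute_Sp_quat {A : (V →L[ℝ] V)ˣ} (hA : A ∈ h.Sp) (y : Fin 4 → ℝ) :
    (A : V →L[ℝ] V) * h.quat y = h.quat y * A := by
  obtain ⟨h0, h1, h2, h3⟩ := hA
  simp only [quat, mul_add, add_mul, mul_smul_comm, smul_mul_assoc, h1, h2, h3, mul_one, one_mul]

theorem commute_Sp_SpOne {A q : (V →L[ℝ] V)ˣ} (hA : A ∈ h.Sp) (hq : q ∈ h.SpOne) :
    A * q = q * A := by
  obtain ⟨y, -, hy⟩ := hq
  apply Units.ext
  rw [Units.val_mul, Units.val_mul, hy, commute_Sp_quat hA]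

theorem quat_conj_mul (x : Fin 4 → ℝ) :
    h.quat x * h.quat ![x 0, -x 1, -x 2, -x 3] = (∑ s, x s ^ 2) • 1 := by
  rw [quat_mul]
  have e : ∀ a b c d : ℝ, b = 0 → c = 0 → d = 0 → h.quat ![a, b, c, d] = a • 1 := by
    rintro a b c d rfl rfl rfl; simp [quat]
  simp only [Matrix.cons_val_zero, Matrix.cons_val_one, Matrix.cons_val]
  rw [e _ _ _ _ (by ring) (by ring) (by ring), Fin.sum_univ_four]
  congr 1; ring

/-- A unit quaternion as an invertible transformation. -/
theorem exists_SpOne {x : Fin 4 → ℝ} (hx : ∑ s, x s ^ 2 = 1) :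
    ∃ q ∈ h.SpOne, ((q : (V →L[ℝ] V)ˣ) : V →L[ℝ] V) = h.quat x := by
  have h1 : h.quat x * h.quat ![x 0, -x 1, -x 2, -x 3] = 1 := by
    rw [quat_conj_mul, hx, one_smul]
  have h2 : h.quat ![x 0, -x 1, -x 2, -x 3] * h.quat x = 1 := by
    have := h.quat_conj_mul ![x 0, -x 1, -x 2, -x 3]
    simp only [Matrix.cons_val_zero, Matrix.cons_val_one, Matrix.cons_val, neg_neg,
      Fin.sum_univ_four, neg_sq] at this
    rw [Fin.sum_univ_four] at hx
    rw [hx, one_smul, ← Tensor4.vec_eq x] at this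
    exact this
  exact ⟨⟨_, _, h1, h2⟩, ⟨x, hx, rfl⟩, rfl⟩

/-- A square root of `q ≠ -1` is `(1 + q) / |1 + q|`, where `|1 + q|² = 2 + 2x₀`; a root of `-1` is
`J₁`. Squares of isometries have determinant one, which places `Sp(1)` in `SO(V)`. -/
theorem exists_sq_eq_of_mem_SpOne {q : (V →L[ℝ] V)ˣ} (hq : q ∈ h.SpOne) :
    ∃ p ∈ h.SpOne, p * p = q := by
  obtain ⟨x, hx, hqx⟩ := hq
  obtain ⟨y, hy, hyx⟩ : ∃ y : Fin 4 → ℝ, ∑ s, y s ^ 2 = 1 ∧ h.quat y * h.quat y = h.quat x := by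
    simp only [Fin.sum_univ_four] at hx ⊢
    by_cases h0 : x 0 = -1
    · refine ⟨![0, 1, 0, 0], by simp, ?_⟩
      have e1 : x 1 = 0 := by nlinarith [sq_nonneg (x 1), sq_nonneg (x 2), sq_nonneg (x 3)]
      have e2 : x 2 = 0 := by nlinarith [sq_nonneg (x 1), sq_nonneg (x 2), sq_nonneg (x 3)]
      have e3 : x 3 = 0 := by nlinarith [sq_nonneg (x 1), sq_nonneg (x 2), sq_nonneg (x 3)]
      rw [quat_mul]
      congr 1
      ext k; fin_cases k <;> simp [h0, e1, e2, e3]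
    · have hpos : 0 < 2 + 2 * x 0 := by
        have : -1 ≤ x 0 := by nlinarith [sq_nonneg (x 1), sq_nonneg (x 2), sq_nonneg (x 3)]
        have : -1 < x 0 := lt_of_le_of_ne this (Ne.symm h0)
        linarith
      obtain ⟨r, hr⟩ : ∃ r : ℝ, r * r * (2 + 2 * x 0) = 1 := by
        refine ⟨(Real.sqrt (2 + 2 * x 0))⁻¹, ?_⟩
        rw [← mul_inv, Real.mul_self_sqrt hpos.le, inv_mul_cancel₀ hpos.ne']
      refine ⟨![r * (1 + x 0), r * x 1, r * x 2, r * x 3], ?_, ?_⟩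
      · simp only [Matrix.cons_val_zero, Matrix.cons_val_one, Matrix.cons_val]
        linear_combination r ^ 2 * hx + hr
      · rw [quat_mul]
        congr 1
        ext k; fin_cases k <;> simp
        · linear_combination (-r ^ 2) * hx + x 0 * hr
        · linear_combination x 1 * hr
        · linear_combination x 2 * hr
        · linear_combination x 3 * hr
  obtain ⟨p, hp, hpy⟩ := h.exists_SpOne hy
  exact ⟨p, hp, Units.ext (by rw [Units.val_mul, hpy, hyx, hqx])⟩

theorem inner_of_mem_SpOne {q : (V →L[ℝ] V)ˣ} (hq : q ∈ h.SpOne) (u v : V) :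
    inner ℝ ((q : V →L[ℝ] V) u) ((q : V →L[ℝ] V) v) = inner ℝ u v := by
  obtain ⟨x, hx, hqx⟩ := hq
  rw [hqx, inner_quat, hx, one_mul]

theorem SpOne_le_SpSpOne [FiniteDimensional ℝ V] : h.SpOne ≤ h.SpSpOne := by
  intro q hq
  refine ⟨inner_of_mem_SpOne hq, ?_, ?_⟩
  · obtain ⟨p, hp, rfl⟩ := exists_sq_eq_of_mem_SpOne hq
    rw [Units.val_mul, ContinuousLinearMap.toLinearMap_mul, map_mul, ← sq]
    exact det_sq_eq_one_of_inner (inner_of_mem_SpOne hp)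
  · intro r hr
    obtain ⟨y, hy, rfl⟩ := mem_Q_iff.1 hr
    obtain ⟨x, hx, hqx⟩ := hq
    have hinv : ((q⁻¹ : (V →L[ℝ] V)ˣ) : V →L[ℝ] V) = h.quat ![x 0, -x 1, -x 2, -x 3] := by
      apply Units.inv_eq_of_mul_eq_one_right
      rw [hqx, quat_conj_mul, hx, one_smul]
    rw [mem_Q_iff, hqx, hinv, quat_mul, quat_mul]
    refine ⟨_, ?_, rfl⟩
    simp [hy]; ring

/-- `Sp(2)Sp(1)` is the product of `Sp(2)` and `Sp(1)`. -/
theorem mem_SpSpOne_iff [FiniteDimensional ℝ V] [Nontrivial V] {κ : V ≃ₗ[ℝ] (Fin 4 → ℂ)}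
    (hκ : h.IsFrame κ) {A : (V →L[ℝ] V)ˣ} :
    A ∈ h.SpSpOne ↔ ∃ B ∈ h.Sp, ∃ q ∈ h.SpOne, A = B * q := by
  constructor
  · rintro ⟨h0, -, hQ⟩
    have hJQ : h.J₁ ∈ h.Q ∧ h.J₂ ∈ h.Q ∧ h.J₃ ∈ h.Q :=
      ⟨Submodule.subset_span (by simp), Submodule.subset_span (by simp),
        Submodule.subset_span (by simp)⟩
    obtain ⟨y₁, -, hy₁⟩ := mem_Q_iff.1 (hQ _ hJQ.1)
    obtain ⟨y₂, -, hy₂⟩ := mem_Q_iff.1 (hQ _ hJQ.2.1)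
    obtain ⟨y₃, -, hy₃⟩ := mem_Q_iff.1 (hQ _ hJQ.2.2)
    set A' := ((A⁻¹ : (V →L[ℝ] V)ˣ) : V →L[ℝ] V) with hA'
    have hAA : A' * A = 1 := Units.inv_mul A
    have hconj : ∀ a b : V →L[ℝ] V, ((A : V →L[ℝ] V) * a * A') * ((A : V →L[ℝ] V) * b * A') =
        (A : V →L[ℝ] V) * (a * b) * A' := fun a b => by
      rw [show ((A : V →L[ℝ] V) * a * A') * ((A : V →L[ℝ] V) * b * A') =
        (A : V →L[ℝ] V) * a * (A' * A) * b * A' by noncomm_ring, hAA]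
      noncomm_ring
    have hconj' : ∀ a : V →L[ℝ] V, ((A : V →L[ℝ] V) * a * A') * A = A * a := fun a => by
      rw [mul_assoc, hAA, mul_one]
    -- The conjugates `I_s = A J_s A⁻¹` form another quaternionic triple inside `𝒬`. A unit
    -- quaternion `q` with `I_s q = q J_s` makes `q⁻¹ A` commute with all `J_s`.
    obtain ⟨I₁, hI₁⟩ : ∃ I, I = (A : V →L[ℝ] V) * h.J₁ * A' := ⟨_, rfl⟩
    obtain ⟨I₂, hI₂⟩ : ∃ I, I = (A : V →L[ℝ] V) * h.J₂ * A' := ⟨_, rfl⟩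
    obtain ⟨I₃, hI₃⟩ : ∃ I, I = (A : V →L[ℝ] V) * h.J₃ * A' := ⟨_, rfl⟩
    have hI11 : I₁ * I₁ = -1 := by
      rw [hI₁, hconj, h.J₁_sq, mul_neg, mul_one, neg_mul, hA', Units.mul_inv]
    have hI22 : I₂ * I₂ = -1 := by
      rw [hI₂, hconj, h.J₂_sq, mul_neg, mul_one, neg_mul, hA', Units.mul_inv]
    have hI12 : I₁ * I₂ = I₃ := by rw [hI₁, hI₂, hI₃, hconj, h.J₁_mul_J₂]
    have hI21 : I₂ * I₁ = -I₃ := by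
      rw [hI₁, hI₂, hI₃, hconj, h.J₂_mul_J₁, mul_neg, neg_mul]
    have hI13 : I₁ * I₃ = -I₂ := by rw [← hI12, ← mul_assoc, hI11, neg_mul, one_mul]
    have hI23 : I₂ * I₃ = I₁ := by
      rw [← neg_eq_iff_eq_neg.2 hI21, mul_neg, ← mul_assoc, hI22, neg_mul, one_mul, neg_neg]
    -- Averaging `p` over the two triples makes it an intertwiner: `I_s T(p) = T(p) J_s`.
    let T : (V →L[ℝ] V) → (V →L[ℝ] V) := fun p =>
      p - I₁ * (p * h.J₁) - I₂ * (p * h.J₂) - I₃ * (p * h.J₃)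
    have j13 : h.J₁ * h.J₃ = -h.J₂ := ContinuousLinearMap.ext h.J₁_J₃
    have j23 : h.J₂ * h.J₃ = h.J₁ := ContinuousLinearMap.ext h.J₂_J₃
    have j31 : h.J₃ * h.J₁ = h.J₂ := ContinuousLinearMap.ext h.J₃_J₁
    have j32 : h.J₃ * h.J₂ = -h.J₁ := ContinuousLinearMap.ext h.J₃_J₂
    have hT1 : ∀ p, I₁ * T p = T p * h.J₁ := fun p => by
      simp only [T, mul_sub, sub_mul, ← mul_assoc, hI11, hI12, hI13]
      simp only [mul_assoc, h.J₁_sq, h.J₂_mul_J₁, j31, neg_mul, mul_neg, one_mul, mul_one]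
      abel
    have hT2 : ∀ p, I₂ * T p = T p * h.J₂ := fun p => by
      simp only [T, mul_sub, sub_mul, ← mul_assoc, hI21, hI22, hI23]
      simp only [mul_assoc, h.J₁_mul_J₂, h.J₂_sq, j32, neg_mul, mul_neg, one_mul, mul_one]
      abel
    -- This identity shows that `T` is nonzero on one of `1, J₁, J₂, J₃`. That value is a nonzero
    -- quaternion, since the `I_s` lie in `𝒬`, and can be normalized.
    have hsum : T 1 - T h.J₁ * h.J₁ - T h.J₂ * h.J₂ - T h.J₃ * h.J₃ = (4 : ℝ) • 1 := by
      simp only [T, sub_mul, mul_assoc, h.J₁_sq, h.J₂_sq, h.J₃_sq, h.J₁_mul_J₂, h.J₂_mul_J₁, j13, j23,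
        j31, j32, neg_mul, mul_neg, one_mul, mul_one]
      module
    let P : Set (V →L[ℝ] V) := {a | ∃ z, a = h.quat z}
    have hPmul : ∀ {a b}, a ∈ P → b ∈ P → a * b ∈ P := by
      rintro a b ⟨z, rfl⟩ ⟨w, rfl⟩
      exact ⟨_, quat_mul h z w⟩
    have hPsub : ∀ {a b}, a ∈ P → b ∈ P → a - b ∈ P := by
      rintro a b ⟨z, rfl⟩ ⟨w, rfl⟩
      exact ⟨z - w, by simp only [quat, Pi.sub_apply]; module⟩
    have hP0 : (1 : V →L[ℝ] V) ∈ P := ⟨![1, 0, 0, 0], by simp [quat]⟩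
    have hP1 : h.J₁ ∈ P := ⟨![0, 1, 0, 0], by simp [quat]⟩
    have hP2 : h.J₂ ∈ P := ⟨![0, 0, 1, 0], by simp [quat]⟩
    have hP3 : h.J₃ ∈ P := ⟨![0, 0, 0, 1], by simp [quat]⟩
    have hPI1 : I₁ ∈ P := ⟨y₁, by rw [hI₁, hy₁]⟩
    have hPI2 : I₂ ∈ P := ⟨y₂, by rw [hI₂, hy₂]⟩
    have hPI3 : I₃ ∈ P := ⟨y₃, by rw [hI₃, hy₃]⟩
    have hPT : ∀ p ∈ P, T p ∈ P := fun p hp =>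
      hPsub (hPsub (hPsub hp (hPmul hPI1 (hPmul hp hP1))) (hPmul hPI2 (hPmul hp hP2)))
        (hPmul hPI3 (hPmul hp hP3))
    obtain ⟨p, hp, hTp⟩ : ∃ p ∈ P, T p ≠ 0 := by
      by_contra! hne
      rw [hne _ hP0, hne _ hP1, hne _ hP2, hne _ hP3] at hsum
      simp only [zero_mul, sub_zero] at hsum
      exact smul_ne_zero four_ne_zero one_ne_zero hsum.symm
    obtain ⟨z, hz⟩ := hPT p hp
    have hn : 0 < ∑ s, z s ^ 2 := by
      refine lt_of_le_of_ne (Finset.sum_nonneg fun s _ => sq_nonneg _) fun h0 => hTp ?_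
      have h1 := (Finset.sum_eq_zero_iff_of_nonneg fun s _ => sq_nonneg (z s)).1 h0.symm
      have h2 : ∀ s, z s = 0 := fun s => by simpa using h1 s (Finset.mem_univ s)
      rw [hz, quat, h2, h2, h2, h2]; simp
    let r := (Real.sqrt (∑ s, z s ^ 2))⁻¹
    have hr : r * r * ∑ s, z s ^ 2 = 1 := by
      rw [← mul_inv, Real.mul_self_sqrt hn.le, inv_mul_cancel₀ hn.ne']
    obtain ⟨q, hq, hqx⟩ := h.exists_SpOne (x := r • z) (by
      simp only [Pi.smul_apply, smul_eq_mul, mul_pow, ← Finset.mul_sum]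
      rw [sq, hr])
    have hqT : (q : V →L[ℝ] V) = r • T p := by
      rw [hqx, hz]; simp only [quat, Pi.smul_apply, smul_eq_mul]; module
    have hq1 : I₁ * q = q * h.J₁ := by rw [hqT, mul_smul_comm, hT1, smul_mul_assoc]
    have hq2 : I₂ * q = q * h.J₂ := by rw [hqT, mul_smul_comm, hT2, smul_mul_assoc]
    have hcomm : ∀ I J : V →L[ℝ] V, I = (A : V →L[ℝ] V) * J * A' → I * q = q * J → ∀ v,
        ((q⁻¹ * A : (V →L[ℝ] V)ˣ) : V →L[ℝ] V) (J v) =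
          J (((q⁻¹ * A : (V →L[ℝ] V)ˣ) : V →L[ℝ] V) v) := by
      intro I J hI hIJ v
      refine congrArg (fun T : V →L[ℝ] V => T v) (?_ :
        ((q⁻¹ * A : (V →L[ℝ] V)ˣ) : V →L[ℝ] V) * J = J * ((q⁻¹ * A : (V →L[ℝ] V)ˣ) : V →L[ℝ] V))
      have e1 : ((q⁻¹ : (V →L[ℝ] V)ˣ) : V →L[ℝ] V) * I = J * ((q⁻¹ : (V →L[ℝ] V)ˣ) : V →L[ℝ] V) := by
        rw [← Units.mul_left_inj q, mul_assoc, hIJ, ← mul_assoc, Units.inv_mul, one_mul, mul_assoc,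
          Units.inv_mul, mul_one]
      rw [Units.val_mul, mul_assoc, ← hconj' J, ← hI, ← mul_assoc, e1, mul_assoc]
    have hB : q⁻¹ * A ∈ h.Sp := by
      refine (h.mem_Sp_iff).2 ⟨fun x y => ?_, hcomm I₁ _ hI₁ hq1, hcomm I₂ _ hI₂ hq2⟩
      rw [Units.val_mul]
      exact (inner_of_mem_SpOne (h.SpOne.inv_mem hq) _ _).trans (h0 _ _)
    exact ⟨q⁻¹ * A, hB, q, hq, by rw [commute_Sp_SpOne hB hq, mul_inv_cancel_left]⟩
  · rintro ⟨B, hB, q, hq, rfl⟩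
    exact mul_mem (Sp_le_SpSpOne hκ hB) (SpOne_le_SpSpOne hq)

/-- The stabilizer of `𝒦(Ŝ)` in `Sp(2)Sp(1)`. -/
theorem act_calK_eq_self_iff [FiniteDimensional ℝ V] [Nontrivial V]
    {e : Module.Basis (Fin 4) ℂ h.W} (he : h.IsAdapted e) {S : Tensor4 V}
    (hS : IsDiscFor h (h.coord e) S) {A : (V →L[ℝ] V)ˣ} :
    (A ∈ h.SpSpOne ∧ act A (h.calK S) = h.calK S) ↔ A ∈ h.SOFourIr e := by
  have hκ := h.isFrame_coord he
  -- As `𝒦` is equivariant and injective on `𝔖`, an element of `Sp(2)` fixes `𝒦(S)` exactly when it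
  -- fixes `S`.
  have hSp : ∀ {B}, B ∈ h.Sp → (act B (h.calK S) = h.calK S ↔ B ∈ h.SpOneIr e) := fun {B} hB => by
    rw [← calK_act S hB, ← act_eq_self_iff he hS hB]
    exact ⟨fun h1 => calK_injOn (hS.isSymType.act hB) hS.isSymType h1, fun h1 => by rw [h1]⟩
  constructor
  · rintro ⟨hA, hAK⟩
    obtain ⟨B, hB, q, hq, rfl⟩ := (mem_SpSpOne_iff hκ).1 hA
    rw [act_mul, act_SpOne hS.isSymType hq] at hAK
    exact mul_mem (Subgroup.mem_sup_left ((hSp hB).1 hAK)) (Subgroup.mem_sup_right hq)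
  · intro hA
    let G : Subgroup (V →L[ℝ] V)ˣ :=
      { carrier := {A | act A (h.calK S) = h.calK S}
        one_mem' := act_one _
        mul_mem' := fun {A B} hA hB => by
          rw [Set.mem_ofPred_eq] at hA hB ⊢
          rw [act_mul, hB, hA]
        inv_mem' := fun {A} hA => by
          rw [Set.mem_ofPred_eq] at hA ⊢
          nth_rw 1 [← hA]
          rw [act_inv_act] }
    have hle : h.SOFourIr e ≤ h.SpSpOne ⊓ G :=
      sup_le (le_inf ((SpOneIr_le_Sp he).trans (Sp_le_SpSpOne hκ))
        fun B hB => (hSp (SpOneIr_le_Sp he hB)).2 hB)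
        (le_inf SpOne_le_SpSpOne fun q hq => act_SpOne hS.isSymType hq)
    exact hle hA

end HyperHermitian
end

/-! ### Exponential map and compactness of the groups -/

noncomputable section

open Set Filter Topology

/-! ### The exponential map of `GL(V)` -/

section Exp

variable {V : Type*} [NormedAddCommGroup V] [InnerProductSpace ℝ V] [CompleteSpace V]

theorem exp_mul_exp_neg (X : V →L[ℝ] V) : NormedSpace.exp X * NormedSpace.exp (-X) = 1 := by
  let _ : NormedAlgebra ℚ (V →L[ℝ] V) := NormedAlgebra.restrictScalars ℚ ℝ _
  rw [← NormedSpace.exp_add_of_commute (Commute.refl X).neg_right, add_neg_cancel,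
    NormedSpace.exp_zero]

/-- The exponential of an endomorphism as an invertible transformation. -/
def expUnit (X : V →L[ℝ] V) : (V →L[ℝ] V)ˣ where
  val := NormedSpace.exp X
  inv := NormedSpace.exp (-X)
  val_inv := exp_mul_exp_neg X
  inv_val := by simpa using exp_mul_exp_neg (-X)

theorem val_expUnit (X : V →L[ℝ] V) : (expUnit X : V →L[ℝ] V) = NormedSpace.exp X := rfl

theorem val_inv_expUnit (X : V →L[ℝ] V) :
    (((expUnit X)⁻¹ : (V →L[ℝ] V)ˣ) : V →L[ℝ] V) = NormedSpace.exp (-X) := rfl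

theorem expUnit_zero : expUnit (0 : V →L[ℝ] V) = 1 := Units.ext NormedSpace.exp_zero

theorem contDiff_exp : ContDiff ℝ ω (NormedSpace.exp : (V →L[ℝ] V) → V →L[ℝ] V) :=
  contDiff_iff_contDiffAt.2 fun X => (NormedSpace.exp_analytic (𝕂 := ℝ) X).contDiffAt

/-- Skewness means `X* = -X`, so the adjoint of `exp X` is `exp (-X)`, its inverse. -/
theorem inner_exp (X : V →L[ℝ] V) (hX : ∀ u v, inner ℝ (X u) v = -inner ℝ u (X v)) (u v : V) :
    inner ℝ (NormedSpace.exp X u) (NormedSpace.exp X v) = inner ℝ u v := by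
  have h1 : star X = -X := by
    refine ContinuousLinearMap.ext fun v => ext_inner_right ℝ fun w => ?_
    rw [ContinuousLinearMap.star_eq_adjoint, ContinuousLinearMap.adjoint_inner_left]
    have := hX v w
    rw [neg_apply, inner_neg_left]
    linarith
  have h2 : ContinuousLinearMap.adjoint (NormedSpace.exp X) = NormedSpace.exp (-X) := by
    rw [← h1, ← NormedSpace.star_exp, ContinuousLinearMap.star_eq_adjoint]
  have h3 : NormedSpace.exp (-X) (NormedSpace.exp X v) = v := by
    have := congrArg (fun T : V →L[ℝ] V => T v) (exp_mul_exp_neg (-X))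
    rwa [neg_neg] at this
  rw [← ContinuousLinearMap.adjoint_inner_right, h2, h3]

/-- The exponential map is locally injective and locally surjective. -/
theorem exists_exp_log : ∃ U ∈ 𝓝 (0 : V →L[ℝ] V), InjOn NormedSpace.exp U ∧
    ∃ g : (V →L[ℝ] V) → V →L[ℝ] V, Tendsto g (𝓝 1) (𝓝 0) ∧
      ∀ᶠ A in 𝓝 1, NormedSpace.exp (g A) = A := by
  have h1 : HasStrictFDerivAt (NormedSpace.exp : (V →L[ℝ] V) → V →L[ℝ] V)
      ((ContinuousLinearEquiv.refl ℝ (V →L[ℝ] V) : (V →L[ℝ] V) ≃L[ℝ] (V →L[ℝ] V)) :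
        (V →L[ℝ] V) →L[ℝ] (V →L[ℝ] V)) 0 := hasStrictFDerivAt_exp_zero
  let c := h1.toOpenPartialHomeomorph NormedSpace.exp
  have hc : (c : (V →L[ℝ] V) → V →L[ℝ] V) = NormedSpace.exp := rfl
  have h0 : (0 : V →L[ℝ] V) ∈ c.source := h1.mem_toOpenPartialHomeomorph_source
  have h0' : c 0 = 1 := NormedSpace.exp_zero
  have h1' : (1 : V →L[ℝ] V) ∈ c.target := by rw [← h0']; exact c.map_source h0
  refine ⟨c.source, c.open_source.mem_nhds h0, c.injOn, c.symm, ?_, ?_⟩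
  · have := c.tendsto_symm h0
    rwa [h0'] at this
  · filter_upwards [c.open_target.mem_nhds h1'] with A hA
    exact c.right_inv hA

end Exp

namespace HyperHermitian

variable {V : Type*} [NormedAddCommGroup V] [InnerProductSpace ℝ V] (h : HyperHermitian V)

/-- The Lie algebra of `Sp(2)`. -/
def spAlg : Submodule ℝ (V →L[ℝ] V) where
  carrier := {X | (∀ u v, inner ℝ (X u) v = -inner ℝ u (X v)) ∧
    X * h.J₁ = h.J₁ * X ∧ X * h.J₂ = h.J₂ * X}
  zero_mem' := by simp
  add_mem' := by
    rintro X Y ⟨a1, a2, a3⟩ ⟨b1, b2, b3⟩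
    refine ⟨fun u v => ?_, by rw [add_mul, mul_add, a2, b2], by rw [add_mul, mul_add, a3, b3]⟩
    simp only [add_apply, inner_add_left, inner_add_right, a1, b1]
    ring
  smul_mem' := by
    rintro c X ⟨a1, a2, a3⟩
    refine ⟨fun u v => ?_, by rw [smul_mul_assoc, mul_smul_comm, a2],
      by rw [smul_mul_assoc, mul_smul_comm, a3]⟩
    simp only [smul_apply, real_inner_smul_left, real_inner_smul_right, a1]
    ring

theorem mem_spAlg_iff {X : V →L[ℝ] V} : X ∈ h.spAlg ↔
    (∀ u v, inner ℝ (X u) v = -inner ℝ u (X v)) ∧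
    (∀ v, X (h.J₁ v) = h.J₁ (X v)) ∧ ∀ v, X (h.J₂ v) = h.J₂ (X v) :=
  and_congr_right fun _ => and_congr ContinuousLinearMap.ext_iff ContinuousLinearMap.ext_iff

variable {h}

theorem expUnit_mem_Sp [CompleteSpace V] {X : V →L[ℝ] V} (hX : X ∈ h.spAlg) :
    expUnit X ∈ h.Sp := by
  obtain ⟨h0, h1, h2⟩ := hX
  have h1' : Commute h.J₁ (NormedSpace.exp X) := Commute.exp_right (Eq.symm h1)
  have h2' : Commute h.J₂ (NormedSpace.exp X) := Commute.exp_right (Eq.symm h2)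
  exact h.mem_Sp_iff.2 ⟨inner_exp X h0, fun v => (congrArg (fun T : V →L[ℝ] V => T v) h1').symm,
    fun v => (congrArg (fun T : V →L[ℝ] V => T v) h2').symm⟩

theorem J₁_unit (h : HyperHermitian V) : ∃ u : (V →L[ℝ] V)ˣ, (u : V →L[ℝ] V) = h.J₁ :=
  ⟨⟨h.J₁, -h.J₁, by rw [mul_neg, h.J₁_sq, neg_neg], by rw [neg_mul, h.J₁_sq, neg_neg]⟩, rfl⟩

theorem J₂_unit (h : HyperHermitian V) : ∃ u : (V →L[ℝ] V)ˣ, (u : V →L[ℝ] V) = h.J₂ :=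
  ⟨⟨h.J₂, -h.J₂, by rw [mul_neg, h.J₂_sq, neg_neg], by rw [neg_mul, h.J₂_sq, neg_neg]⟩, rfl⟩

/-- The exponential map of `Sp(2)`. -/
def expSp [CompleteSpace V] (X : h.spAlg) : h.Sp := ⟨expUnit X, expUnit_mem_Sp X.2⟩

/-- The exponential map covers a neighbourhood of the identity of `Sp(2)`. -/
theorem nhds_le_map_expSp [FiniteDimensional ℝ V] [CompleteSpace V] :
    𝓝 (1 : h.Sp) ≤ map (expSp (h := h)) (𝓝 0) := by
  obtain ⟨U, hU, hinj, g, hg, hexp⟩ := exists_exp_log (V := V)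
  obtain ⟨u₁, hu₁⟩ := J₁_unit h
  obtain ⟨u₂, hu₂⟩ := J₂_unit h
  have hadj : Continuous fun X : V →L[ℝ] V => star X := continuous_star
  -- Close to the identity, the logarithm stays in the injectivity domain `U` of `exp` even after
  -- conjugation by `J₁` or `J₂` and after `X ↦ -X*`.
  have ev : ∀ τ : (V →L[ℝ] V) → (V →L[ℝ] V), Continuous τ → τ 0 = 0 →
      ∀ᶠ A in 𝓝 (1 : V →L[ℝ] V), τ (g A) ∈ U := fun τ hτ h0 => by
    refine ((hτ.tendsto 0).comp hg).eventually ?_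
    rw [h0]; exact hU
  have hemb := (isEmbedding_subgroup_val h.Sp).continuous.tendsto 1
  intro s hs
  rw [mem_map, mem_nhds_subtype] at hs
  obtain ⟨t, ht, hts⟩ := hs
  filter_upwards [hemb.eventually hexp, hemb.eventually (hg.eventually ht),
    hemb.eventually (ev id continuous_id rfl),
    hemb.eventually (ev (fun X => u₁ * X * ((u₁⁻¹ : (V →L[ℝ] V)ˣ) : V →L[ℝ] V)) (by fun_prop) (by simp)),
    hemb.eventually (ev (fun X => u₂ * X * ((u₂⁻¹ : (V →L[ℝ] V)ˣ) : V →L[ℝ] V)) (by fun_prop) (by simp)),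
    hemb.eventually (ev (fun X => -star X) (hadj.neg) (by simp))]
    with A hA hAt hA0 hA1 hA2 hA3
  let _ : NormedAlgebra ℚ (V →L[ℝ] V) := NormedAlgebra.restrictScalars ℚ ℝ _
  obtain ⟨i0, i1, i2, -⟩ := A.2
  obtain ⟨a, ha⟩ : ∃ a, a = ((A : (V →L[ℝ] V)ˣ) : V →L[ℝ] V) := ⟨_, rfl⟩
  simp only [← ha, id] at hA hAt hA0 hA1 hA2 hA3 i0 i1 i2
  -- If `a` commutes with `u`, then `g a` and its conjugate by `u` have the same exponential, so
  -- local injectivity identifies them. The same argument for `-X*` below shows that the logarithm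
  -- is skew.
  have hconj : ∀ u : (V →L[ℝ] V)ˣ, a * u = u * a →
      u * g a * ((u⁻¹ : (V →L[ℝ] V)ˣ) : V →L[ℝ] V) ∈ U → g a * u = u * g a := fun u hu hmem => by
    have e1 : NormedSpace.exp (u * g a * ((u⁻¹ : (V →L[ℝ] V)ˣ) : V →L[ℝ] V)) =
        NormedSpace.exp (g a) := by
      rw [NormedSpace.exp_units_conj, hA, ← hu, mul_assoc, Units.mul_inv, mul_one]
    have e2 := hinj hmem hA0 e1
    nth_rw 1 [← e2]
    rw [mul_assoc, Units.inv_mul, mul_one]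
  have hstar : star (g a) = -g a := by
    have e1 : NormedSpace.exp (-star (g a)) = NormedSpace.exp (g a) := by
      have e2 : star a * a = 1 := by
        refine ContinuousLinearMap.ext fun v => ext_inner_right ℝ fun w => ?_
        change inner ℝ (star a (a v)) w = inner ℝ v w
        rw [ContinuousLinearMap.star_eq_adjoint, ContinuousLinearMap.adjoint_inner_left, i0]
      have e3 : NormedSpace.exp (star (g a)) = star a := by rw [← NormedSpace.star_exp, hA]
      have e4 := exp_mul_exp_neg (-star (g a))
      rw [neg_neg, e3] at e4
      calc NormedSpace.exp (-star (g a)) = NormedSpace.exp (-star (g a)) * (star a * a) := by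
            rw [e2, mul_one]
        _ = NormedSpace.exp (g a) := by rw [← mul_assoc, e4, one_mul, hA]
    exact neg_eq_iff_eq_neg.1 (hinj hA3 hA0 e1)
  have hmem : g a ∈ h.spAlg := by
    refine ⟨fun u v => ?_, ?_, ?_⟩
    · rw [← ContinuousLinearMap.adjoint_inner_right, ← ContinuousLinearMap.star_eq_adjoint, hstar,
        neg_apply, inner_neg_right]
    · rw [← hu₁]; exact hconj u₁ (by rw [hu₁, i1]) hA1
    · rw [← hu₂]; exact hconj u₂ (by rw [hu₂, i2]) hA2
  have := @hts ⟨g a, hmem⟩ hAt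
  have e5 : expSp (h := h) ⟨g a, hmem⟩ = A := Subtype.ext (Units.ext (hA.trans ha))
  rw [mem_preimage, e5] at this
  exact this

/-! ### Compactness -/

/-- In finite dimension an isometry is invertible with inverse its adjoint, so in `End(V)` the group
is cut out by closed conditions alone; it lies in the unit ball. -/
theorem isCompact_Sp [FiniteDimensional ℝ V] : IsCompact (h.Sp : Set (V →L[ℝ] V)ˣ) := by
  have : CompleteSpace V := FiniteDimensional.complete ℝ V
  have : ProperSpace (V →L[ℝ] V) := FiniteDimensional.proper ℝ _
  rw [Units.isOpenEmbedding_val.isEmbedding.isCompact_iff]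
  have himage : (Units.val '' (h.Sp : Set (V →L[ℝ] V)ˣ)) = {A : V →L[ℝ] V |
      (∀ x y, inner ℝ (A x) (A y) = inner ℝ x y) ∧ A * h.J₁ = h.J₁ * A ∧ A * h.J₂ = h.J₂ * A ∧
        A * h.J₃ = h.J₃ * A} := by
    ext A
    constructor
    · rintro ⟨B, hB, rfl⟩
      exact hB
    · intro hA
      have e2 : star A * A = 1 := by
        refine ContinuousLinearMap.ext fun v => ext_inner_right ℝ fun w => ?_
        change inner ℝ (star A (A v)) w = inner ℝ v w
        rw [ContinuousLinearMap.star_eq_adjoint, ContinuousLinearMap.adjoint_inner_left, hA.1]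
      have e3 : A * star A = 1 := by
        have e4 : (star A : V →L[ℝ] V).toLinearMap * A.toLinearMap = 1 :=
          congrArg ContinuousLinearMap.toLinearMap e2
        rw [mul_eq_one_comm] at e4
        exact ContinuousLinearMap.coe_injective e4
      exact ⟨⟨A, star A, e3, e2⟩, hA, rfl⟩
  rw [himage]
  refine Metric.isCompact_of_isClosed_isBounded ?_ ?_
  · have hc : ∀ J : V →L[ℝ] V, IsClosed {A : V →L[ℝ] V | A * J = J * A} := fun J =>
      isClosed_eq (by fun_prop) (by fun_prop)
    have hi : IsClosed {A : V →L[ℝ] V | ∀ x y, inner ℝ (A x) (A y) = inner ℝ x y} := by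
      simp only [ofPred_forall]
      refine isClosed_iInter fun x => isClosed_iInter fun y => isClosed_eq ?_ continuous_const
      exact Continuous.inner (by fun_prop) (by fun_prop)
    exact hi.inter ((hc _).inter ((hc _).inter (hc _)))
  · refine (Metric.isBounded_closedBall (x := (0 : V →L[ℝ] V)) (r := 1)).subset fun A hA => ?_
    rw [mem_closedBall_zero_iff]
    refine ContinuousLinearMap.opNorm_le_bound _ zero_le_one fun v => ?_
    have := hA.1 v v
    rw [real_inner_self_eq_norm_sq, real_inner_self_eq_norm_sq] at this
    rw [one_mul]
    exact (pow_le_pow_iff_left₀ (norm_nonneg _) (norm_nonneg _) two_ne_zero).1 this.le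

theorem isCompact_SpOne [FiniteDimensional ℝ V] : IsCompact (h.SpOne : Set (V →L[ℝ] V)ˣ) := by
  have : CompleteSpace V := FiniteDimensional.complete ℝ V
  rw [Units.isOpenEmbedding_val.isEmbedding.isCompact_iff]
  have himage : (Units.val '' (h.SpOne : Set (V →L[ℝ] V)ˣ)) =
      (fun x : EuclideanSpace ℝ (Fin 4) => h.quat x) '' Metric.sphere 0 1 := by
    have hs : ∀ x : EuclideanSpace ℝ (Fin 4), x ∈ Metric.sphere 0 1 ↔ ∑ s, x s ^ 2 = 1 := fun x => by
      rw [mem_sphere_zero_iff_norm, EuclideanSpace.norm_eq, Real.sqrt_eq_one]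
      simp
    ext A
    constructor
    · rintro ⟨B, ⟨x, hx, hB⟩, rfl⟩
      exact ⟨WithLp.toLp 2 x, (hs _).2 hx, hB.symm⟩
    · rintro ⟨x, hx, rfl⟩
      obtain ⟨q, hq, hqx⟩ := h.exists_SpOne ((hs x).1 hx)
      exact ⟨q, hq, hqx⟩
  rw [himage]
  refine (isCompact_sphere _ _).image ?_
  simp only [quat]
  fun_prop

theorem isCompact_SpSpOne [FiniteDimensional ℝ V] [Nontrivial V] {κ : V ≃ₗ[ℝ] (Fin 4 → ℂ)}
    (hκ : h.IsFrame κ) : IsCompact (h.SpSpOne : Set (V →L[ℝ] V)ˣ) := by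
  have : (h.SpSpOne : Set (V →L[ℝ] V)ˣ) =
      (fun p : (V →L[ℝ] V)ˣ × (V →L[ℝ] V)ˣ => p.1 * p.2) '' ((h.Sp : Set _) ×ˢ (h.SpOne : Set _)) := by
    ext A
    rw [SetLike.mem_coe, mem_SpSpOne_iff hκ]
    constructor
    · rintro ⟨B, hB, q, hq, rfl⟩
      exact ⟨(B, q), ⟨hB, hq⟩, rfl⟩
    · rintro ⟨⟨B, q⟩, ⟨hB, hq⟩, rfl⟩
      exact ⟨B, hB, q, hq, rfl⟩
  rw [this]
  exact (isCompact_Sp.prod isCompact_SpOne).image continuous_mul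

end HyperHermitian
end

/-! ### The Lie algebra of `Sp(2)` and the infinitesimal stabilizer -/

noncomputable section

open Set Filter Topology

namespace HyperHermitian

open Tensor4 SymCube

/-! ### The Lie algebra of `Sp(2)` in coordinates -/

/-- Parameters of the Lie algebra of `Sp(2)`: two real and four complex numbers. -/
abbrev LieParam : Type := (ℝ × ℝ) × (Fin 4 → ℂ)

/-- The quaternionic skew-Hermitian maps of `ℂ⁴`. -/
def lieForm : LieParam →ₗ[ℝ] (Fin 4 → ℂ) →ₗ[ℝ] (Fin 4 → ℂ) :=
  LinearMap.mk₂ ℝ (fun d x =>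
    ![Complex.I * d.1.1 * x 0 - (starRingEnd ℂ) (d.2 0) * x 1 - (starRingEnd ℂ) (d.2 1) * x 2
        - (starRingEnd ℂ) (d.2 2) * x 3,
      d.2 0 * x 0 + Complex.I * d.1.2 * x 1 - (starRingEnd ℂ) (d.2 2) * x 2
        - (starRingEnd ℂ) (d.2 3) * x 3,
      d.2 1 * x 0 + d.2 2 * x 1 - Complex.I * d.1.1 * x 2 - d.2 0 * x 3,
      d.2 2 * x 0 + d.2 3 * x 1 + (starRingEnd ℂ) (d.2 0) * x 2 - Complex.I * d.1.2 * x 3])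
    (fun d d' x => by ext k; fin_cases k <;> simp <;> ring)
    (fun r d x => by ext k; fin_cases k <;> simp <;> ring)
    (fun d x x' => by ext k; fin_cases k <;> simp <;> ring)
    (fun r d x => by ext k; fin_cases k <;> simp <;> ring)

theorem lieForm_apply (d : LieParam) (x : Fin 4 → ℂ) : lieForm d x =
    ![Complex.I * d.1.1 * x 0 - (starRingEnd ℂ) (d.2 0) * x 1 - (starRingEnd ℂ) (d.2 1) * x 2
        - (starRingEnd ℂ) (d.2 2) * x 3,
      d.2 0 * x 0 + Complex.I * d.1.2 * x 1 - (starRingEnd ℂ) (d.2 2) * x 2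
        - (starRingEnd ℂ) (d.2 3) * x 3,
      d.2 1 * x 0 + d.2 2 * x 1 - Complex.I * d.1.1 * x 2 - d.2 0 * x 3,
      d.2 2 * x 0 + d.2 3 * x 1 + (starRingEnd ℂ) (d.2 0) * x 2 - Complex.I * d.1.2 * x 3] := rfl

theorem lieForm_smul (d : LieParam) (a : ℂ) (x : Fin 4 → ℂ) :
    lieForm d (a • x) = a • lieForm d x := by
  simp only [lieForm_apply]
  ext k; fin_cases k <;> simp <;> ring

theorem lieForm_jCoord (d : LieParam) (x : Fin 4 → ℂ) :
    lieForm d (jCoord x) = jCoord (lieForm d x) := by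
  simp only [lieForm_apply]
  ext k; fin_cases k <;> simp [jCoord] <;> ring

theorem herm_lieForm (d : LieParam) (x y : Fin 4 → ℂ) :
    herm (lieForm d x) y = -herm x (lieForm d y) := by
  simp only [lieForm_apply, herm, Fin.sum_univ_four]
  simp
  ring

/-- Infinitesimal generators of the stabilizer of the discriminant. -/
def lieStab : ℝ × ℂ →ₗ[ℝ] LieParam where
  -- The constants come from differentiating `cubicRep` at the identity in the direction of the
  -- skew-Hermitian matrix with diagonal `(i z₁, -i z₁)` and lower left entry `z₂`.
  toFun z := ((3 * z.1, z.1), ![(Real.sqrt 3 : ℂ) * z.2, 0, 0, -(2 * z.2)])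
  map_add' z z' := by
    ext k
    · simp [mul_add]
    · simp
    · fin_cases k <;> simp <;> ring
  map_smul' r z := by
    ext k
    · simp; ring
    · simp
    · fin_cases k <;> simp <;> ring

/-- A complement of the generators of the stabilizer. -/
def lieCompl : ℝ × (Fin 3 → ℂ) →ₗ[ℝ] LieParam where
  toFun y := ((y.1, 0), ![0, y.2 0, y.2 1, y.2 2])
  map_add' z z' := by
    ext k
    · simp
    · simp
    · fin_cases k <;> simp
  map_smul' r z := by
    ext k
    · simp
    · simp
    · fin_cases k <;> simp

/-- The slots `d.1.2` and `d.2 0`, which `lieCompl` leaves zero, already determine the argument of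
`lieStab`. -/
theorem lieCompl_add_lieStab_injective :
    Function.Injective fun u : (ℝ × (Fin 3 → ℂ)) × (ℝ × ℂ) => lieCompl u.1 + lieStab u.2 := by
  have : ∀ u : (ℝ × (Fin 3 → ℂ)) × (ℝ × ℂ), lieCompl u.1 + lieStab u.2 = 0 → u = 0 := by
    rintro ⟨⟨r, m⟩, ⟨s, a⟩⟩ hu
    have h1 := congrArg (fun d : LieParam => d.1.1) hu
    have h2 := congrArg (fun d : LieParam => d.1.2) hu
    have h3 := fun k => congrArg (fun d : LieParam => d.2 k) hu
    have e0 := h3 0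
    have e1 := h3 1
    have e2 := h3 2
    have e3 := h3 3
    simp [lieCompl, lieStab] at h1 h2 e0 e1 e2 e3
    subst h2
    subst e0
    have hm : m = 0 := by
      ext k; fin_cases k
      · exact e1
      · exact e2
      · simpa using e3
    rw [hm]
    simp at h1
    rw [h1]; rfl
  intro u u' huu
  have h1 := this (u - u') (by
    simp only [Prod.fst_sub, Prod.snd_sub, map_sub]
    have h2 : lieCompl u.1 + lieStab u.2 = lieCompl u'.1 + lieStab u'.2 := huu
    rw [sub_add_sub_comm, h2, sub_self])
  exact sub_eq_zero.1 h1

theorem dDisc_lieStab (z : ℝ × ℂ) (x : Fin 4 → ℂ) : dDisc x (lieForm (lieStab z) x) = 0 := by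
  have h := sqrt3_mul_self
  rw [dDisc_eq, lieForm_apply]
  simp only [lieStab, LinearMap.coe_mk, AddHom.coe_mk, Matrix.cons_val_zero, Matrix.cons_val_one,
    Matrix.cons_val, map_mul, map_neg, map_zero, map_ofNat, Complex.conj_ofReal]
  push_cast
  generalize (starRingEnd ℂ) z.2 = b
  linear_combination (z.2 * (-12 * x 0 * x 1 ^ 2 * x 2 + 4 * x 1 ^ 3 * x 3)
    + b * (-4 * x 1 * x 3 ^ 3 + 12 * x 0 * x 2 * x 3 ^ 2)) * h

/-- Homogeneity of degree four: a scalar with `a⁴ = i` exchanges real and imaginary parts, so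
vanishing of the real part for all `x` forces vanishing. -/
theorem dDisc_smul_lieForm (d : LieParam) (a : ℂ) (x : Fin 4 → ℂ) :
    dDisc (a • x) (lieForm d (a • x)) = a ^ 4 * dDisc x (lieForm d x) := by
  rw [lieForm_smul, dDisc_eq, dDisc_eq]
  simp only [Pi.smul_apply, smul_eq_mul]
  ring

theorem eq_zero_of_dDisc_lieCompl {y : ℝ × (Fin 3 → ℂ)}
    (hy : ∀ x, (dDisc x (lieForm (lieCompl y) x)).re = 0) : y = 0 := by
  have hy' : ∀ x, dDisc x (lieForm (lieCompl y) x) = 0 := fun x => by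
    obtain ⟨a, ha⟩ := IsAlgClosed.exists_pow_nat_eq Complex.I (n := 4) (by norm_num)
    have h1 := hy (a • x)
    rw [dDisc_smul_lieForm, ha, Complex.I_mul_re] at h1
    exact Complex.ext (hy x) (by simpa using h1)
  have h3 := sqrt3_ne
  obtain ⟨r, m⟩ := y
  -- The vector `e₂` isolates `m₁` and `e₁ + e₄` gives `r`. The two remaining pairs, differing by a
  -- factor `i` in one entry, separate `m₂` and `m₀` from their conjugates.
  have e1 := hy' ![0, 1, 0, 0]
  rw [dDisc_eq, lieForm_apply] at e1
  simp [lieCompl] at e1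
  have e2 := hy' ![0, 1, 0, 1]
  have e3 := hy' ![0, 1, 0, Complex.I]
  have e4 := hy' ![1, 0, 1, 0]
  have e5 := hy' ![1, 0, Complex.I, 0]
  have e6 := hy' ![1, 0, 0, 1]
  rw [dDisc_eq, lieForm_apply] at e2 e3 e4 e5 e6
  simp [lieCompl, e1] at e2 e3 e4 e5 e6
  subst e6
  simp only [Complex.ofReal_zero] at e4 e5
  have m2 : m 2 = 0 := by
    linear_combination (1 / 12) * e2 - Complex.I / 12 * e3
      + 1 / 2 * ((starRingEnd ℂ) (m 2) + m 2) * Complex.I_sq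
  have m0 : m 0 = 0 := by
    linear_combination (-1 / 36) * e4 + Complex.I / 36 * e5
      + 1 / 2 * ((starRingEnd ℂ) (m 0) + m 0) * Complex.I_sq
  have hm : m = 0 := by
    ext k; fin_cases k
    exacts [m0, e1, m2]
  rw [hm]; rfl

variable {V : Type*} [NormedAddCommGroup V] [InnerProductSpace ℝ V] {h : HyperHermitian V}

/-- The endomorphism of `V` with given coordinates. -/
def lieEnd [FiniteDimensional ℝ V] (κ : V ≃ₗ[ℝ] (Fin 4 → ℂ)) : LieParam →ₗ[ℝ] (V →L[ℝ] V) :=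
  (LinearMap.toContinuousLinearMap : (V →ₗ[ℝ] V) ≃ₗ[ℝ] (V →L[ℝ] V)).toLinearMap ∘ₗ
    κ.symm.conj.toLinearMap ∘ₗ lieForm

theorem frame_lieEnd [FiniteDimensional ℝ V] (κ : V ≃ₗ[ℝ] (Fin 4 → ℂ)) (d : LieParam) (v : V) :
    κ (lieEnd κ d v) = lieForm d (κ v) := by
  simp [lieEnd, LinearEquiv.conj_apply]

theorem lieEnd_injective [FiniteDimensional ℝ V] (κ : V ≃ₗ[ℝ] (Fin 4 → ℂ)) :
    Function.Injective (lieEnd κ) := by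
  rw [← LinearMap.ker_eq_bot, LinearMap.ker_eq_bot']
  intro d hd
  have h1 : ∀ x, lieForm d x = 0 := fun x => by
    rw [← κ.apply_symm_apply x, ← frame_lieEnd, hd]; simp
  have e0 := h1 (Pi.single 0 1)
  have e1 := h1 (Pi.single 1 1)
  rw [lieForm_apply] at e0 e1
  have a0 := congrFun e0 0
  have a1 := congrFun e0 1
  have a2 := congrFun e0 2
  have a3 := congrFun e0 3
  have b1 := congrFun e1 1
  have b3 := congrFun e1 3
  simp at a0 a1 a2 a3 b1 b3
  obtain ⟨⟨r, s⟩, m⟩ := d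
  have hm : m = 0 := by
    ext k; fin_cases k
    exacts [a1, a2, a3, b3]
  simp only at a0 b1
  rw [a0, b1, hm]; rfl

theorem lieEnd_mem [FiniteDimensional ℝ V] {κ : V ≃ₗ[ℝ] (Fin 4 → ℂ)} (hκ : h.IsFrame κ)
    (d : LieParam) : lieEnd κ d ∈ h.spAlg := by
  refine h.mem_spAlg_iff.2 ⟨fun u v => ?_, fun v => ?_, fun v => ?_⟩
  · rw [hκ.inner_eq, hκ.inner_eq, frame_lieEnd, frame_lieEnd, herm_lieForm, Complex.neg_re]
    ring
  · apply κ.injective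
    rw [frame_lieEnd, hκ.J₁, hκ.J₁, frame_lieEnd, lieForm_smul]
  · apply κ.injective
    rw [frame_lieEnd, hκ.J₂, hκ.J₂, frame_lieEnd, lieForm_jCoord]

/-- Quaternionic linearity reduces `X` to its first two columns, and skewness makes their diagonal
entries imaginary and relates the entries `k2`, `k3`. The ten real parameters thus describe the
whole Lie algebra. -/
theorem exists_lieEnd_eq [FiniteDimensional ℝ V] {κ : V ≃ₗ[ℝ] (Fin 4 → ℂ)} (hκ : h.IsFrame κ)
    {X : V →L[ℝ] V} (hX : X ∈ h.spAlg) : ∃ d, lieEnd κ d = X := by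
  obtain ⟨h0, h1, h2⟩ := h.mem_spAlg_iff.1 hX
  obtain ⟨L, hL⟩ : ∃ L, L = frameMap hκ h1 := ⟨_, rfl⟩
  have hLv : ∀ v, L (κ v) = κ (X v) := fun v => by rw [hL, frameMap_apply]
  have hLj : ∀ x, L (jCoord x) = jCoord (L x) := fun x => by
    obtain ⟨v, rfl⟩ := κ.surjective x
    rw [← hκ.J₂, hLv, hLv, h2, hκ.J₂]
  have hLh : ∀ x y, herm (L x) y = -herm x (L y) := fun x y => by
    obtain ⟨u, rfl⟩ := κ.surjective x
    obtain ⟨v, rfl⟩ := κ.surjective y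
    rw [hLv, hLv, hκ.inner_herm, hκ.inner_herm, h0, ← h1, h0, h1]
    push_cast; ring
  obtain ⟨p, hp⟩ : ∃ p, p = L (Pi.single 0 1) := ⟨_, rfl⟩
  obtain ⟨q, hq⟩ : ∃ q, q = L (Pi.single 1 1) := ⟨_, rfl⟩
  have hp' : L (Pi.single 2 1) = jCoord p := by
    have h1 : jCoord (Pi.single 0 1) = Pi.single 2 1 := by
      ext k; fin_cases k <;> simp [jCoord]
    rw [← h1, hLj, hp]
  have hq' : L (Pi.single 3 1) = jCoord q := by
    have h1 : jCoord (Pi.single 1 1) = Pi.single 3 1 := by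
      ext k; fin_cases k <;> simp [jCoord]
    rw [← h1, hLj, hq]
  have k0 := hLh (Pi.single 0 1) (Pi.single 0 1)
  have k1 := hLh (Pi.single 1 1) (Pi.single 1 1)
  have k2 := hLh (Pi.single 1 1) (Pi.single 0 1)
  have k3 := hLh (Pi.single 1 1) (Pi.single 2 1)
  rw [hp'] at k3
  rw [← hp] at k0 k2
  rw [← hq] at k1 k2 k3
  simp [herm, Fin.sum_univ_four, jCoord] at k0 k1 k2 k3
  have him : ∀ z : ℂ, z = -(starRingEnd ℂ) z → z = Complex.I * z.im := fun z hz => by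
    have := congrArg Complex.re hz
    simp at this
    apply Complex.ext <;> simp
    linarith
  refine ⟨(((p 0).im, (q 1).im), ![p 1, p 2, p 3, q 3]), ContinuousLinearMap.ext fun v => ?_⟩
  apply κ.injective
  rw [frame_lieEnd, ← hLv]
  obtain ⟨x, hx⟩ : ∃ x, x = κ v := ⟨_, rfl⟩
  have hx' : x = x 0 • Pi.single 0 1 + x 1 • Pi.single 1 1 + x 2 • Pi.single 2 1 +
      x 3 • Pi.single 3 1 := by
    ext k; fin_cases k <;> simp
  have e0 := him _ k0
  have e1 := him _ k1
  rw [← hx]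
  conv_rhs => rw [hx']
  simp only [map_add, map_smul, ← hp, ← hq, hp', hq', lieForm_apply]
  ext k; fin_cases k <;> simp [jCoord, ← e0, ← e1, k2, k3, Matrix.vecHead, Matrix.vecTail]
  · ring
  · ring
  · linear_combination (-x 2) * k0
  · linear_combination (-x 3) * k1

end HyperHermitian
end

/-! ### Exponential parametrization of `Sp(2)` adapted to the stabilizer -/

noncomputable section

open Set Filter Topology

theorem fderiv_eq_of_hasDerivAt_line {E F : Type*} [NormedAddCommGroup E] [NormedSpace ℝ E]
    [NormedAddCommGroup F] [NormedSpace ℝ F] {f : E → F} (hf : DifferentiableAt ℝ f 0) {u : E} {d : F}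
    (h : HasDerivAt (fun t : ℝ => f (t • u)) d 0) : fderiv ℝ f 0 u = d := by
  have h1 : HasFDerivAt f (fderiv ℝ f 0) ((0 : ℝ) • u) := by
    rw [zero_smul]; exact hf.hasFDerivAt
  have h2 : HasDerivAt (fun t : ℝ => t • u) u 0 := by
    simpa using (hasDerivAt_id (0 : ℝ)).smul_const u
  exact (h1.comp_hasDerivAt (0 : ℝ) h2).unique h

namespace HyperHermitian

open Tensor4 SymCube

theorem hasDerivAt_disc {c : ℝ → Fin 4 → ℂ} {c' : Fin 4 → ℂ} {t : ℝ} (hc : HasDerivAt c c' t) :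
    HasDerivAt (fun t => disc (c t)) (dDisc (c t) c') t := by
  have hk := fun k => hasDerivAt_pi.1 hc k
  unfold disc
  have h1 := ((((((((hk 0).const_mul (-18 : ℂ)).mul (hk 1)).mul (hk 2)).mul (hk 3)).add
    (((hk 0).const_mul (4 * (Real.sqrt 3 : ℂ))).mul ((hk 3).pow 3))).sub
    ((((hk 1).pow 3).const_mul (4 * (Real.sqrt 3 : ℂ))).mul (hk 2))).add
    ((((hk 1).pow 2).const_mul 3).mul ((hk 3).pow 2))).sub
    ((((hk 0).pow 2).const_mul 9).mul ((hk 2).pow 2))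
  refine h1.congr_deriv ?_
  rw [dDisc_eq]
  simp only [Pi.pow_apply, Pi.mul_apply]
  push_cast
  ring

variable {V : Type*} [NormedAddCommGroup V] [InnerProductSpace ℝ V] {h : HyperHermitian V}

theorem hasDerivAt_disc_exp [FiniteDimensional ℝ V] [CompleteSpace V] (κ : V ≃ₗ[ℝ] (Fin 4 → ℂ))
    (X : V →L[ℝ] V) (v : V) (t : ℝ) :
    HasDerivAt (fun t : ℝ => disc (κ (NormedSpace.exp (t • X) v)))
      (dDisc (κ (NormedSpace.exp (t • X) v)) (κ (X (NormedSpace.exp (t • X) v)))) t := by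
  refine hasDerivAt_disc ?_
  have h1 := hasDerivAt_exp_smul_const' (𝕂 := ℝ) X t
  have h2 := (ContinuousLinearMap.apply ℝ V v).hasFDerivAt.comp_hasDerivAt t h1
  exact (LinearMap.toContinuousLinearMap κ.toLinearMap).hasFDerivAt.comp_hasDerivAt t h2

/-- The derivative of the discriminant along `exp(tX) v` is `dDisc` at that very point in the
direction of `X`, hence zero for all `t`. Comparing `t = -1` with `t = 0` gives invariance. -/
theorem act_expUnit_eq [FiniteDimensional ℝ V] [CompleteSpace V] {κ : V ≃ₗ[ℝ] (Fin 4 → ℂ)}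
    {S : Tensor4 V} (hS : IsDiscFor h κ S) {X : V →L[ℝ] V} (hX : X ∈ h.spAlg)
    (hd : ∀ v, dDisc (κ v) (κ (X v)) = 0) : act (expUnit X) S = S := by
  refine IsDiscFor.unique (κ := κ) ⟨hS.isSymType.act (expUnit_mem_Sp hX), fun v => ?_⟩ hS
  have h1 : ∀ t, HasDerivAt (fun t : ℝ => disc (κ (NormedSpace.exp (t • X) v))) 0 t := fun t =>
    (hasDerivAt_disc_exp κ X v t).congr_deriv (hd _)
  have h2 := is_const_of_deriv_eq_zero (fun t => (h1 t).differentiableAt)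
    (fun t => (h1 t).deriv) (-1) 0
  simp only [neg_smul, one_smul, zero_smul, NormedSpace.exp_zero] at h2
  rw [act_vec, hS.diag, val_inv_expUnit, h2]
  rfl

/-- A splitting of the Lie algebra of `Sp(2)` into the stabilizer of `S` and a complement. -/
structure LieSplit (h : HyperHermitian V) (κ : V ≃ₗ[ℝ] (Fin 4 → ℂ)) where
  compl : EuclideanSpace ℝ (Fin 7) →L[ℝ] V →L[ℝ] V
  stab : EuclideanSpace ℝ (Fin 3) →L[ℝ] V →L[ℝ] V
  compl_mem : ∀ y, compl y ∈ h.spAlg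
  stab_mem : ∀ z, stab z ∈ h.spAlg
  injective : ∀ y z, compl y + stab z = 0 → y = 0 ∧ z = 0
  dDisc_stab : ∀ z v, dDisc (κ v) (κ (stab z v)) = 0
  dDisc_compl : ∀ y, (∀ v, (dDisc (κ v) (κ (compl y v))).re = 0) → y = 0

theorem exists_lieSplit [FiniteDimensional ℝ V] {κ : V ≃ₗ[ℝ] (Fin 4 → ℂ)} (hκ : h.IsFrame κ) :
    Nonempty (LieSplit h κ) := by
  let a : EuclideanSpace ℝ (Fin 7) ≃L[ℝ] ℝ × (Fin 3 → ℂ) :=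
    ContinuousLinearEquiv.ofFinrankEq (by simp [Module.finrank_pi_fintype])
  let b : EuclideanSpace ℝ (Fin 3) ≃L[ℝ] ℝ × ℂ :=
    ContinuousLinearEquiv.ofFinrankEq (by simp)
  let A : EuclideanSpace ℝ (Fin 7) →ₗ[ℝ] V →L[ℝ] V :=
    lieEnd κ ∘ₗ lieCompl ∘ₗ a.toLinearEquiv.toLinearMap
  let B : EuclideanSpace ℝ (Fin 3) →ₗ[ℝ] V →L[ℝ] V :=
    lieEnd κ ∘ₗ lieStab ∘ₗ b.toLinearEquiv.toLinearMap
  have hA : ∀ y, A y = lieEnd κ (lieCompl (a y)) := fun y => rfl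
  have hB : ∀ z, B z = lieEnd κ (lieStab (b z)) := fun z => rfl
  refine ⟨⟨LinearMap.toContinuousLinearMap A, LinearMap.toContinuousLinearMap B,
    fun y => lieEnd_mem hκ _, fun z => lieEnd_mem hκ _, fun y z hyz => ?_, fun z v => ?_,
    fun y hy => ?_⟩⟩
  · change A y + B z = 0 at hyz
    rw [hA, hB, ← map_add, ← map_zero (lieEnd κ)] at hyz
    have h1 := lieEnd_injective κ hyz
    have h2 := @lieCompl_add_lieStab_injective (a y, b z) 0 (by simpa using h1)
    have h3 : a y = 0 ∧ b z = 0 := Prod.mk.inj h2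
    exact ⟨by simpa using h3.1, by simpa using h3.2⟩
  · change dDisc (κ v) (κ (B z v)) = 0
    rw [hB, frame_lieEnd, dDisc_lieStab]
  · have h1 : a y = 0 := eq_zero_of_dDisc_lieCompl fun x => by
      have h2 := hy (κ.symm x)
      change (dDisc (κ (κ.symm x)) (κ (A y (κ.symm x)))).re = 0 at h2
      rwa [hA, frame_lieEnd, LinearEquiv.apply_symm_apply] at h2
    simpa using h1

/-- A chart of `Sp(2)` at the identity by the exponential map. -/
theorem exists_Sp_chart [FiniteDimensional ℝ V] {κ : V ≃ₗ[ℝ] (Fin 4 → ℂ)} (hκ : h.IsFrame κ) :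
    ∃ c : OpenPartialHomeomorph h.Sp LieParam,
      IsAdaptedChart (fun A : h.Sp => ((A : (V →L[ℝ] V)ˣ) : V →L[ℝ] V)) c ∧ 1 ∈ c.source := by
  have : CompleteSpace V := FiniteDimensional.complete ℝ V
  let Λ : LieParam ≃ₗ[ℝ] h.spAlg := LinearEquiv.ofBijective
    ((lieEnd κ).codRestrict h.spAlg (lieEnd_mem hκ))
    ⟨fun d d' hd => lieEnd_injective κ (congrArg Subtype.val hd), fun X => by
      obtain ⟨d, hd⟩ := exists_lieEnd_eq hκ X.2
      exact ⟨d, Subtype.ext hd⟩⟩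
  let ΛL : LieParam →L[ℝ] V →L[ℝ] V := LinearMap.toContinuousLinearMap (lieEnd κ)
  let φ : LieParam → h.Sp := fun d => expSp (Λ d)
  have hval : (fun A : h.Sp => ((A : (V →L[ℝ] V)ˣ) : V →L[ℝ] V)) ∘ φ =
      fun d => NormedSpace.exp (ΛL d) := rfl
  have hcd : ContDiff ℝ ω (fun d => NormedSpace.exp (ΛL d)) := contDiff_exp.comp ΛL.contDiff
  have hfd : ∀ d, fderiv ℝ (fun d => NormedSpace.exp (ΛL d)) 0 d = ΛL d := fun d =>
    fderiv_eq_of_hasDerivAt_line (hcd.differentiable (by simp) 0) (by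
      have := hasDerivAt_exp_smul_const (𝕂 := ℝ) (ΛL d) 0
      simpa using this)
  have h1 : φ 0 = 1 := by
    simp only [φ, map_zero]
    exact Subtype.ext expUnit_zero
  obtain ⟨c, hc, h0, -, -⟩ := exists_isAdaptedChart_of_open (isEmbedding_subgroup_val h.Sp)
    (φ := φ) (by rw [hval]; exact hcd.contDiffAt)
    (by
      rw [hval]
      intro d d' hd
      rw [hfd, hfd] at hd
      exact lieEnd_injective κ hd)
    (by
      have h2 : map Λ (𝓝 0) = 𝓝 0 :=
        (Λ.toContinuousLinearEquiv.toHomeomorph.map_nhds_eq 0).trans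
          (by congr 1; exact map_zero Λ)
      rw [h1, show φ = expSp ∘ Λ from rfl, ← map_map, h2]
      exact nhds_le_map_expSp)
  exact ⟨c, hc, by rwa [h1] at h0⟩

namespace LieSplit

variable {κ : V ≃ₗ[ℝ] (Fin 4 → ℂ)} (D : LieSplit h κ)

/-- The parametrization `(y, z) ↦ exp(y) exp(z)` of `Sp(2)`. -/
def param [CompleteSpace V] (u : EuclideanSpace ℝ (Fin 7) × EuclideanSpace ℝ (Fin 3)) : h.Sp :=
  expSp ⟨D.compl u.1, D.compl_mem u.1⟩ * expSp ⟨D.stab u.2, D.stab_mem u.2⟩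

theorem val_param [CompleteSpace V] (u : EuclideanSpace ℝ (Fin 7) × EuclideanSpace ℝ (Fin 3)) :
    ((D.param u : (V →L[ℝ] V)ˣ) : V →L[ℝ] V) =
      NormedSpace.exp (D.compl u.1) * NormedSpace.exp (D.stab u.2) := rfl

theorem param_zero [CompleteSpace V] : D.param 0 = 1 := by
  refine Subtype.ext (Units.ext ?_)
  rw [val_param]
  simp

theorem contDiff_param [CompleteSpace V] :
    ContDiff ℝ ω fun u => ((D.param u : (V →L[ℝ] V)ˣ) : V →L[ℝ] V) :=
  ContDiff.mul (contDiff_exp.comp (D.compl.contDiff.comp contDiff_fst))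
    (contDiff_exp.comp (D.stab.contDiff.comp contDiff_snd))

theorem hasDerivAt_param [CompleteSpace V]
    (u : EuclideanSpace ℝ (Fin 7) × EuclideanSpace ℝ (Fin 3)) :
    HasDerivAt (fun t : ℝ => ((D.param (t • u) : (V →L[ℝ] V)ˣ) : V →L[ℝ] V))
      (D.compl u.1 + D.stab u.2) 0 := by
  have h1 := (hasDerivAt_exp_smul_const (𝕂 := ℝ) (D.compl u.1) 0).mul
    (hasDerivAt_exp_smul_const (𝕂 := ℝ) (D.stab u.2) 0)
  simp only [zero_smul, NormedSpace.exp_zero, one_mul, mul_one] at h1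
  refine h1.congr_of_eventuallyEq (Eventually.of_forall fun t => ?_)
  simp [val_param]

theorem fderiv_param [CompleteSpace V]
    (u : EuclideanSpace ℝ (Fin 7) × EuclideanSpace ℝ (Fin 3)) :
    fderiv ℝ (fun u => ((D.param u : (V →L[ℝ] V)ˣ) : V →L[ℝ] V)) 0 u =
      D.compl u.1 + D.stab u.2 :=
  fderiv_eq_of_hasDerivAt_line (D.contDiff_param.differentiable (by simp) 0) (D.hasDerivAt_param u)

theorem fderiv_param_injective [CompleteSpace V] : Function.Injective
    (fderiv ℝ (fun u => ((D.param u : (V →L[ℝ] V)ˣ) : V →L[ℝ] V)) 0) := by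
  rw [injective_iff_map_eq_zero]
  intro u hu
  rw [fderiv_param] at hu
  obtain ⟨h1, h2⟩ := D.injective _ _ hu
  exact Prod.ext h1 h2

/-- The exponential chart exhibits `Sp(2)` as a submanifold of dimension `10 = 7 + 3`, and an
immersion between equal dimensions is open. -/
theorem nhds_le_map_param [FiniteDimensional ℝ V] [CompleteSpace V] (hκ : h.IsFrame κ) :
    𝓝 (1 : h.Sp) ≤ map D.param (𝓝 0) := by
  obtain ⟨c, hc, hc1⟩ := exists_Sp_chart hκ
  have := nhds_le_map_of_injective_fderiv (isEmbedding_subgroup_val h.Sp) hc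
    (φ := D.param) (by simp [Module.finrank_pi_fintype]) (by rwa [D.param_zero]) D.contDiff_param.contDiffAt
    D.fderiv_param_injective
  rwa [D.param_zero] at this

variable {S : Tensor4 V}

theorem act_param [FiniteDimensional ℝ V] [CompleteSpace V] (hS : IsDiscFor h κ S)
    (y : EuclideanSpace ℝ (Fin 7)) (z : EuclideanSpace ℝ (Fin 3)) :
    act (D.param (y, z)) (h.calK S) = act (D.param (y, 0)) (h.calK S) := by
  have h1 : act (expUnit (D.stab z)) (h.calK S) = h.calK S := by
    rw [← calK_act S (expUnit_mem_Sp (D.stab_mem z)),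
      act_expUnit_eq hS (D.stab_mem z) (D.dDisc_stab z)]
  have h2 : (D.param (y, z) : (V →L[ℝ] V)ˣ) =
    expUnit (D.compl y) * expUnit (D.stab z) := rfl
  have h3 : (D.param (y, 0) : (V →L[ℝ] V)ˣ) = expUnit (D.compl y) := by
    apply Units.ext
    rw [val_param]
    simp [val_expUnit]
  rw [h2, h3, act_mul, h1]

/-- By `eq_calK` a linear functional recovers `S(v,v,v,v)` from `𝒦(S)`. Along `exp(t compl y)` its
value is `Re disc(κ(exp(-t compl y) v)) / 8`, whose derivative is `-1/8` times the real part of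
`dDisc`. Vanishing for every `v` forces `y = 0` by the choice of complement. -/
theorem orb_injective [FiniteDimensional ℝ V] [CompleteSpace V] (hS : IsDiscFor h κ S) :
    Function.Injective (fderiv ℝ (fun y => act (D.param (y, 0)) (h.calK S)) 0) := by
  obtain ⟨f, hf⟩ := Tensor4.exists_contDiffAt_act (h.calK S)
  have hdiff : DifferentiableAt ℝ (fun y => act (D.param (y, 0)) (h.calK S)) 0 := by
    have h1 : ContDiffAt ℝ ω (fun y : EuclideanSpace ℝ (Fin 7) =>
        f ((D.param (y, 0) : (V →L[ℝ] V)ˣ) : V →L[ℝ] V)) 0 :=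
      ContDiffAt.comp (g := f) (0 : EuclideanSpace ℝ (Fin 7)) (hf _).1
        (D.contDiff_param.comp (contDiff_id.prodMk contDiff_const)).contDiffAt
    exact (h1.congr_of_eventuallyEq
      (Eventually.of_forall fun y => ((hf _).2).symm)).differentiableAt (by simp)
  rw [injective_iff_map_eq_zero]
  intro y hy
  refine D.dDisc_compl y fun v => ?_
  let l : Tensor4 V →L[ℝ] ℝ := (1 / 2 : ℝ) •
    (ContinuousMultilinearMap.apply ℝ (fun _ : Fin 4 => V) ℝ ![h.J₁ v, h.J₂ v, v, h.J₃ v] +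
      ContinuousMultilinearMap.apply ℝ (fun _ : Fin 4 => V) ℝ ![v, h.J₂ v, v, h.J₂ v])
  have hl : ∀ T : Tensor4 V, h.IsSymType T → l (h.calK T) = T ![v, v, v, v] := fun T hT =>
    (eq_calK hT v v v v).symm
  have hline : HasDerivAt (fun t : ℝ => t • y) y 0 := by
    simpa using (hasDerivAt_id (0 : ℝ)).smul_const y
  have h1 : HasDerivAt (fun t : ℝ => l (act (D.param (t • y, 0)) (h.calK S))) 0 0 := by
    have h2 : HasFDerivAt (fun y => act (D.param (y, 0)) (h.calK S))
        (fderiv ℝ (fun y => act (D.param (y, 0)) (h.calK S)) 0) ((0 : ℝ) • y) := by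
      rw [zero_smul]; exact hdiff.hasFDerivAt
    have h3 := l.hasFDerivAt.comp_hasDerivAt (0 : ℝ) (h2.comp_hasDerivAt (0 : ℝ) hline)
    rw [hy, map_zero] at h3
    exact h3
  have h4 : ∀ t : ℝ, l (act (D.param (t • y, 0)) (h.calK S)) =
      1 / 8 * (disc (κ (NormedSpace.exp (t • -D.compl y) v))).re := fun t => by
    have e1 : (D.param (t • y, 0) : (V →L[ℝ] V)ˣ) = expUnit (D.compl (t • y)) := by
      apply Units.ext
      rw [val_param]
      simp [val_expUnit]
    have e2 := expUnit_mem_Sp (D.compl_mem (t • y))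
    rw [e1, ← calK_act S e2, hl _ (hS.isSymType.act e2), act_vec, hS.diag, val_inv_expUnit, map_smul,
      smul_neg]
  have h5 := (Complex.reCLM.hasFDerivAt.comp_hasDerivAt (0 : ℝ)
    (hasDerivAt_disc_exp κ (-D.compl y) v 0)).const_mul (1 / 8 : ℝ)
  have h6 := (h1.congr_of_eventuallyEq (Eventually.of_forall fun t => (h4 t).symm)).unique h5
  simp only [zero_smul, NormedSpace.exp_zero] at h6
  have h7 : dDisc (κ v) (κ ((-D.compl y) v)) = -dDisc (κ v) (κ (D.compl y v)) := by
    rw [neg_apply, map_neg, dDisc_eq, dDisc_eq]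
    simp only [Pi.neg_apply]
    ring
  change 0 = 1 / 8 * (dDisc (κ v) (κ ((-D.compl y) v))).re at h6
  rw [h7, Complex.neg_re] at h6
  linarith

end LieSplit

end HyperHermitian
end

/-! ### Parametrization of `Sp(2)Sp(1)` and the orbit -/

noncomputable section

open Set Filter Topology

namespace HyperHermitian

open Tensor4 SymCube

variable {V : Type*} [NormedAddCommGroup V] [InnerProductSpace ℝ V] {h : HyperHermitian V}

/-! ### A parametrization of `Sp(1)` -/

/-- The rational parametrization of the unit quaternions. -/
def cayley (w : EuclideanSpace ℝ (Fin 3)) : Fin 4 → ℝ :=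
  (1 + (w 0 ^ 2 + w 1 ^ 2 + w 2 ^ 2))⁻¹ •
    ![1 - (w 0 ^ 2 + w 1 ^ 2 + w 2 ^ 2), 2 * w 0, 2 * w 1, 2 * w 2]

theorem sum_cayley_sq (w : EuclideanSpace ℝ (Fin 3)) : ∑ s, cayley w s ^ 2 = 1 := by
  have h0 : 1 + (w 0 ^ 2 + w 1 ^ 2 + w 2 ^ 2) ≠ 0 := by positivity
  simp only [cayley, Fin.sum_univ_four, Pi.smul_apply, smul_eq_mul, Matrix.cons_val_zero,
    Matrix.cons_val_one, Matrix.cons_val]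
  field_simp
  ring

/-- The unit quaternion with parameter `w`. -/
def cayleyUnit (w : EuclideanSpace ℝ (Fin 3)) : h.SpOne :=
  ⟨(exists_SpOne (sum_cayley_sq w)).choose, (exists_SpOne (sum_cayley_sq w)).choose_spec.1⟩

theorem val_cayleyUnit (w : EuclideanSpace ℝ (Fin 3)) :
    ((cayleyUnit (h := h) w : (V →L[ℝ] V)ˣ) : V →L[ℝ] V) = h.quat (cayley w) :=
  (exists_SpOne (sum_cayley_sq w)).choose_spec.2

theorem cayley_zero : cayley 0 = ![1, 0, 0, 0] := by
  ext k; fin_cases k <;> simp [cayley]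

theorem cayleyUnit_zero : cayleyUnit (h := h) 0 = 1 := by
  refine Subtype.ext (Units.ext ?_)
  rw [val_cayleyUnit, cayley_zero]
  simp [quat]

/-- Quaternions as a linear map. -/
def quatL (h : HyperHermitian V) : (Fin 4 → ℝ) →ₗ[ℝ] (V →L[ℝ] V) where
  toFun := h.quat
  map_add' x y := by simp only [quat, Pi.add_apply]; module
  map_smul' r x := by simp only [quat, Pi.smul_apply, smul_eq_mul, RingHom.id_apply]; module

theorem quatL_injective [Nontrivial V] : Function.Injective h.quatL := by
  rw [injective_iff_map_eq_zero]
  intro x hx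
  obtain ⟨v, hv⟩ := exists_ne (0 : V)
  have h1 := inner_quat (h := h) x v v
  have h2 : h.quat x v = 0 := congrArg (fun T : V →L[ℝ] V => T v) hx
  rw [h2, inner_zero_left, eq_comm, mul_eq_zero] at h1
  have h3 := h1.resolve_right (fun h0 => hv (inner_self_eq_zero.1 h0))
  ext s
  have h4 := (Finset.sum_eq_zero_iff_of_nonneg fun s _ => sq_nonneg (x s)).1 h3 s (Finset.mem_univ s)
  simpa using h4

/-- Near `1` a continuous right inverse is stereographic projection, `w = (x₁, x₂, x₃) / (1 + x₀)`,
the coordinates of a quaternion being read off by a linear left inverse of `quatL`. -/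
theorem nhds_le_map_cayleyUnit [FiniteDimensional ℝ V] [Nontrivial V] :
    𝓝 (1 : h.SpOne) ≤ map (cayleyUnit (h := h)) (𝓝 0) := by
  obtain ⟨P, hP⟩ := LinearMap.exists_leftInverse_of_injective h.quatL
    (LinearMap.ker_eq_bot.2 quatL_injective)
  have hP' : ∀ x, P (h.quat x) = x := fun x => congrArg (fun T : (Fin 4 → ℝ) →ₗ[ℝ] _ => T x) hP
  have hPc : Continuous P := P.continuous_of_finiteDimensional
  have hemb : Continuous fun q : h.SpOne => P ((q : (V →L[ℝ] V)ˣ) : V →L[ℝ] V) :=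
    hPc.comp (isEmbedding_subgroup_val h.SpOne).continuous
  have hP1 : P (1 : V →L[ℝ] V) = ![1, 0, 0, 0] := by
    rw [← hP' ![1, 0, 0, 0]]
    congr 1
    simp [quat]
  let x : h.SpOne → Fin 4 → ℝ := fun q => P ((q : (V →L[ℝ] V)ˣ) : V →L[ℝ] V)
  have hx1 : x 1 = ![1, 0, 0, 0] := hP1
  let w : h.SpOne → EuclideanSpace ℝ (Fin 3) := fun q =>
    (1 + x q 0)⁻¹ • WithLp.toLp 2 ![x q 1, x q 2, x q 3]
  have hx : Continuous x := hemb
  have hw : ContinuousAt w 1 := by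
    refine ContinuousAt.smul (ContinuousAt.inv₀ (f := fun q => 1 + x q 0)
      (Continuous.continuousAt (by fun_prop)) ?_) ?_
    · rw [hx1]; norm_num
    · refine ((PiLp.continuous_toLp 2 _).comp ?_).continuousAt
      refine continuous_pi fun k => ?_
      fin_cases k <;> simp <;> fun_prop
  have hw1 : w 1 = 0 := by
    ext k; fin_cases k <;> simp [w, hx1]
  have hpos : ∀ᶠ q in 𝓝 (1 : h.SpOne), 0 < 1 + x q 0 := by
    have : ContinuousAt (fun q => 1 + x q 0) 1 := by fun_prop
    refine this.eventually (lt_mem_nhds ?_)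
    change 0 < 1 + x 1 0
    rw [hx1]; norm_num
  intro s hs
  rw [mem_map] at hs
  rw [ContinuousAt, hw1] at hw
  filter_upwards [hw.eventually hs, hpos] with q hq hq0
  have hqw : cayleyUnit (w q) = q := by
    obtain ⟨y, hy, hqy⟩ := q.2
    have hxy : x q = y := by simp only [x, hqy, hP']
    refine Subtype.ext (Units.ext ?_)
    rw [val_cayleyUnit, hqy]
    congr 1
    rw [hxy] at hq0
    rw [Fin.sum_univ_four] at hy
    have hn : (w q 0 ^ 2 + w q 1 ^ 2 + w q 2 ^ 2) = (1 - y 0) / (1 + y 0) := by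
      simp [w, hxy]
      field_simp
      linear_combination hy
    have h1 : (1 + (1 - y 0) / (1 + y 0))⁻¹ = (1 + y 0) / 2 := by
      field_simp; ring
    rw [cayley, hn, h1]
    ext k; fin_cases k <;> simp [w, hxy] <;> field_simp <;> ring
  have : cayleyUnit (w q) ∈ s := hq
  rwa [hqw] at this

theorem contDiff_cayley : ContDiff ℝ ω fun w => h.quat (cayley w) := by
  have h0 : ∀ w : EuclideanSpace ℝ (Fin 3), 1 + (w 0 ^ 2 + w 1 ^ 2 + w 2 ^ 2) ≠ 0 := fun w => by
    positivity
  simp only [quat, cayley, Pi.smul_apply, smul_eq_mul, Matrix.cons_val_zero,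
    Matrix.cons_val_one, Matrix.cons_val]
  fun_prop (disch := exact h0 _)

theorem hasDerivAt_cayley (w : EuclideanSpace ℝ (Fin 3)) :
    HasDerivAt (fun t : ℝ => h.quat (cayley (t • w))) (h.quat ![0, 2 * w 0, 2 * w 1, 2 * w 2]) 0 := by
  have h1 : HasDerivAt (fun t : ℝ => cayley (t • w)) ![0, 2 * w 0, 2 * w 1, 2 * w 2] 0 := by
    obtain ⟨n, hn⟩ : ∃ n, n = w 0 ^ 2 + w 1 ^ 2 + w 2 ^ 2 := ⟨_, rfl⟩
    have e1 : (fun t : ℝ => cayley (t • w)) = fun t : ℝ =>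
        (1 + t ^ 2 * n)⁻¹ • ![1 - t ^ 2 * n, 2 * (t * w 0), 2 * (t * w 1), 2 * (t * w 2)] := by
      funext t
      simp only [cayley, PiLp.smul_apply, smul_eq_mul, hn]
      congr 2 <;> ring_nf
    rw [e1]
    have e2 : HasDerivAt (fun t : ℝ => t ^ 2 * n) 0 0 := by
      simpa using (hasDerivAt_pow 2 (0 : ℝ)).mul_const n
    have e3 : HasDerivAt (fun t : ℝ => (1 + t ^ 2 * n)⁻¹) 0 0 := by
      exact ((e2.const_add 1).fun_inv (by simp)).congr_deriv (by simp)
    have e4 : ∀ a : ℝ, HasDerivAt (fun t : ℝ => 2 * (t * a)) (2 * a) 0 := fun a => by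
      simpa using ((hasDerivAt_id (0 : ℝ)).mul_const a).const_mul 2
    have e5 : HasDerivAt (fun t : ℝ => ![1 - t ^ 2 * n, 2 * (t * w 0), 2 * (t * w 1), 2 * (t * w 2)])
        ![0, 2 * w 0, 2 * w 1, 2 * w 2] 0 := by
      rw [hasDerivAt_pi]
      intro k
      fin_cases k
      · simpa using e2.const_sub 1
      · exact e4 _
      · exact e4 _
      · exact e4 _
    exact (e3.fun_smul e5).congr_deriv (by simp)
  exact (LinearMap.toContinuousLinearMap h.quatL).hasFDerivAt.comp_hasDerivAt (0 : ℝ) h1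

/-- An imaginary quaternion commuting with `J₁` and `J₂` vanishes, so the Lie algebras of `Sp(2)`
and `Sp(1)` meet in zero. -/
theorem quat_add_mem_spAlg_eq_zero [Nontrivial V] {X : V →L[ℝ] V} (hX : X ∈ h.spAlg)
    {w : Fin 4 → ℝ} (hw : w 0 = 0) (hXw : X + h.quat w = 0) : X = 0 ∧ w = 0 := by
  obtain ⟨-, h1, h2⟩ := hX
  have hX' : X = -h.quat w := eq_neg_of_add_eq_zero_left hXw
  have q1 : h.J₁ = h.quat ![0, 1, 0, 0] := by simp [quat]
  have q2 : h.J₂ = h.quat ![0, 0, 1, 0] := by simp [quat]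
  rw [hX', neg_mul, mul_neg, neg_inj, q1, quat_mul, quat_mul] at h1
  rw [hX', neg_mul, mul_neg, neg_inj, q2, quat_mul, quat_mul] at h2
  have e1 := quatL_injective (h := h) h1
  have e2 := quatL_injective (h := h) h2
  have a2 := congrFun e1 2
  have a3 := congrFun e1 3
  have b1 := congrFun e2 1
  have b3 := congrFun e2 3
  simp at a2 a3 b1 b3
  have hw' : w = 0 := by
    ext k; fin_cases k
    · exact hw
    · simp only [Fin.mk_one, Pi.zero_apply]; linarith
    · simp only [Fin.reduceFinMk, Pi.zero_apply]; linarith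
    · simp only [Fin.reduceFinMk, Pi.zero_apply]; linarith
  refine ⟨?_, hw'⟩
  rw [hX', hw']
  simp [quat]

/-! ### The orbit `𝒞` as a homogeneous space -/

section Orbit

variable [FiniteDimensional ℝ V] [Nontrivial V] {κ : V ≃ₗ[ℝ] (Fin 4 → ℂ)} (hκ : h.IsFrame κ)
  {S : Tensor4 V} (hS : IsDiscFor h κ S)

include hκ hS

/-- Only the `Sp(2)` factor of an element of `Sp(2)Sp(1)` moves `𝒦(S)`, so the larger group does not
leave `𝒞`. -/
theorem exists_orbit_point {A : (V →L[ℝ] V)ˣ} (hA : A ∈ h.SpSpOne) :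
    ∃ K : h.orbitC, ((K : h.Curv) : Tensor4 V) = act A (h.calK S) := by
  obtain ⟨B, hB, q, hq, rfl⟩ := (mem_SpSpOne_iff hκ).1 hA
  rw [act_mul, act_SpOne hS.isSymType hq]
  have h1 : act B (h.calK S) ∈ h.Curv := by
    rw [← calK_act S hB]
    exact calK_mem_Curv (hS.isSymType.act hB)
  exact ⟨⟨⟨_, h1⟩, (mem_orbitC_iff hκ hS _).2 ⟨B, hB, rfl⟩⟩, rfl⟩

theorem exists_orb {G : Subgroup (V →L[ℝ] V)ˣ} (hG : G ≤ h.SpSpOne) (hG' : h.Sp ≤ G) :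
    ∃ orb : G → h.orbitC, (∀ A : G, ((orb A : h.Curv) : Tensor4 V) = act A (h.calK S)) ∧
      Function.Surjective orb := by
  choose orb horb using fun A : G => exists_orbit_point hκ hS (hG A.2)
  refine ⟨orb, horb, fun K => ?_⟩
  obtain ⟨A, hA, hAK⟩ := (mem_orbitC_iff hκ hS K).1 K.2
  exact ⟨⟨A, hG' hA⟩, Subtype.ext (Subtype.ext ((horb _).trans hAK))⟩

theorem exists_isOrbitParam_Sp : ∃ orb φ,
    IsOrbitParam (d := 7) (k := 3) (R := h.Curv) (C := h.orbitC) h.Sp (h.calK S) orb φ := by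
  have : CompleteSpace V := FiniteDimensional.complete ℝ V
  obtain ⟨orb, horb, hsurj⟩ := exists_orb hκ hS (Sp_le_SpSpOne hκ) le_rfl
  obtain ⟨D⟩ := exists_lieSplit hκ
  exact ⟨orb, D.param, isCompact_Sp, horb, hsurj, D.param_zero, D.contDiff_param.contDiffAt,
    D.fderiv_param_injective, D.nhds_le_map_param hκ, D.act_param hS, D.orb_injective hS⟩

/-- The three parameters of `Sp(1)` join those of the stabilizer, so `k = 6` while the orbit
directions are those of `Sp(2)`. -/
theorem exists_isOrbitParam_SpSpOne : ∃ orb φ,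
    IsOrbitParam (d := 7) (k := 6) (R := h.Curv) (C := h.orbitC) h.SpSpOne (h.calK S) orb φ := by
  have : CompleteSpace V := FiniteDimensional.complete ℝ V
  obtain ⟨orb, horb, hsurj⟩ := exists_orb hκ hS le_rfl (Sp_le_SpSpOne hκ)
  obtain ⟨D⟩ := exists_lieSplit hκ
  let c : EuclideanSpace ℝ (Fin 6) ≃L[ℝ] EuclideanSpace ℝ (Fin 3) × EuclideanSpace ℝ (Fin 3) :=
    ContinuousLinearEquiv.ofFinrankEq (by simp)
  let μ : h.Sp × h.SpOne →* h.SpSpOne :=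
    { toFun := fun p => ⟨p.1 * p.2, mul_mem (Sp_le_SpSpOne hκ p.1.2) (SpOne_le_SpSpOne p.2.2)⟩
      map_one' := Subtype.ext (by simp)
      map_mul' := fun p q => Subtype.ext (by
        have h1 := commute_Sp_SpOne (h := h) q.1.2 p.2.2
        simp only [Prod.fst_mul, Prod.snd_mul, Subgroup.coe_mul]
        rw [mul_assoc, mul_assoc, ← mul_assoc (q.1 : (V →L[ℝ] V)ˣ), h1, mul_assoc]) }
  have hμs : Function.Surjective μ := fun A => by
    obtain ⟨B, hB, q, hq, hBq⟩ := (mem_SpSpOne_iff hκ).1 A.2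
    exact ⟨(⟨B, hB⟩, ⟨q, hq⟩), Subtype.ext hBq.symm⟩
  have hμc : Continuous μ := by
    refine Continuous.subtype_mk ?_ _
    fun_prop
  have hc1 : CompactSpace h.Sp := isCompact_iff_compactSpace.1 isCompact_Sp
  have hc2 : CompactSpace h.SpOne := isCompact_iff_compactSpace.1 isCompact_SpOne
  have hc3 : CompactSpace h.SpSpOne := isCompact_iff_compactSpace.1 (isCompact_SpSpOne hκ)
  -- A continuous surjective homomorphism of compact Hausdorff groups is open, so neighbourhoods of
  -- `1` in the two factors multiply to a neighbourhood in `Sp(2)Sp(1)`.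
  have hμo : IsOpenMap μ := μ.isOpenMap_of_sigmaCompact hμs hμc
  let φ : EuclideanSpace ℝ (Fin 7) × EuclideanSpace ℝ (Fin 6) → h.SpSpOne := fun u =>
    μ (D.param (u.1, (c u.2).1), cayleyUnit (c u.2).2)
  have hval : ∀ u, ((φ u : (V →L[ℝ] V)ˣ) : V →L[ℝ] V) =
      ((D.param (u.1, (c u.2).1) : (V →L[ℝ] V)ˣ) : V →L[ℝ] V) * h.quat (cayley (c u.2).2) := fun u => by
    rw [← val_cayleyUnit]; rfl
  have hφ0 : φ 0 = 1 := by
    simp only [φ, Prod.fst_zero, Prod.snd_zero, map_zero, cayleyUnit_zero]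
    rw [show ((0, 0) : EuclideanSpace ℝ (Fin 7) × EuclideanSpace ℝ (Fin 3)) = 0 from rfl,
      D.param_zero, ← Prod.one_eq_mk, map_one]
  have hcd : ContDiff ℝ ω fun u => ((φ u : (V →L[ℝ] V)ˣ) : V →L[ℝ] V) := by
    simp only [hval]
    exact (D.contDiff_param.comp (contDiff_fst.prodMk
      (contDiff_fst.comp (c.contDiff.comp contDiff_snd)))).mul
      (contDiff_cayley.comp (contDiff_snd.comp (c.contDiff.comp contDiff_snd)))
  have hfd : ∀ u, fderiv ℝ (fun u => ((φ u : (V →L[ℝ] V)ˣ) : V →L[ℝ] V)) 0 u =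
      D.compl u.1 + D.stab (c u.2).1 +
        h.quat ![0, 2 * (c u.2).2 0, 2 * (c u.2).2 1, 2 * (c u.2).2 2] := fun u => by
    refine fderiv_eq_of_hasDerivAt_line (hcd.differentiable (by simp) 0) ?_
    have h1 := (D.hasDerivAt_param (u.1, (c u.2).1)).mul (hasDerivAt_cayley (h := h) (c u.2).2)
    have h2 : h.quat ![1, 0, 0, 0] = 1 := by simp [quat]
    simp only [zero_smul, D.param_zero, cayley_zero, h2, OneMemClass.coe_one, Units.val_one, one_mul,
      mul_one] at h1
    refine h1.congr_of_eventuallyEq (Eventually.of_forall fun t => ?_)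
    simp [hval]
  have hact : ∀ y z, act (φ (y, z)) (h.calK S) = act (D.param (y, (c z).1)) (h.calK S) := fun y z => by
    have h1 : (φ (y, z) : (V →L[ℝ] V)ˣ) =
        (D.param (y, (c z).1) : (V →L[ℝ] V)ˣ) * (cayleyUnit (h := h) (c z).2 : (V →L[ℝ] V)ˣ) := rfl
    rw [h1, act_mul, act_SpOne hS.isSymType (cayleyUnit (h := h) (c z).2).2]
  refine ⟨orb, φ, isCompact_SpSpOne hκ, horb, hsurj, hφ0, hcd.contDiffAt, ?_, ?_, ?_, ?_⟩
  · rw [injective_iff_map_eq_zero]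
    intro u hu
    rw [hfd] at hu
    obtain ⟨h1, h2⟩ := quat_add_mem_spAlg_eq_zero
      (add_mem (D.compl_mem u.1) (D.stab_mem (c u.2).1)) (by rfl) hu
    obtain ⟨h3, h4⟩ := D.injective _ _ h1
    have h5 : (c u.2).2 = 0 := by
      have e1 := congrFun h2 1
      have e2 := congrFun h2 2
      have e3 := congrFun h2 3
      simp at e1 e2 e3
      ext k; fin_cases k
      exacts [e1, e2, e3]
    have h6 : c u.2 = 0 := Prod.ext h4 h5
    exact Prod.ext h3 (by simpa using h6)
  · have h1 : 𝓝 (1 : h.SpSpOne) ≤ map μ (𝓝 1) := by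
      have := hμo.nhds_le 1
      rwa [map_one] at this
    let c' : (EuclideanSpace ℝ (Fin 7) × EuclideanSpace ℝ (Fin 6)) ≃L[ℝ]
        ((EuclideanSpace ℝ (Fin 7) × EuclideanSpace ℝ (Fin 3)) × EuclideanSpace ℝ (Fin 3)) :=
      ((ContinuousLinearEquiv.refl ℝ _).prodCongr c).trans
        (ContinuousLinearEquiv.prodAssoc ℝ _ _ _).symm
    have h3 : φ = μ ∘ Prod.map D.param cayleyUnit ∘ c' := rfl
    have h4 : map c' (𝓝 0) = 𝓝 0 :=
      (c'.toHomeomorph.map_nhds_eq 0).trans (by congr 1; exact map_zero c')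
    rw [h3, ← map_map, ← map_map, h4]
    refine h1.trans (map_mono ?_)
    rw [Prod.one_eq_mk, nhds_prod_eq, Prod.zero_eq_mk, nhds_prod_eq, ← prod_map_map_eq']
    exact prod_mono (D.nhds_le_map_param hκ) nhds_le_map_cayleyUnit
  · intro y z
    rw [hact, hact, D.act_param hS, D.act_param hS y (c 0).1]
  · have h1 : (fun y => act (φ (y, 0)) (h.calK S)) =
        fun y => act (D.param (y, 0)) (h.calK S) := funext fun y => by
      rw [hact, D.act_param hS]
    rw [h1]
    exact D.orb_injective hS

end Orbit

end HyperHermitian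
end

/-! ### The proposition -/

theorem mainTheorem4 {V : Type*} [NormedAddCommGroup V] [InnerProductSpace ℝ V]
    (hV : Module.finrank ℝ V = 8) (h : HyperHermitian V) :
    (∃ e : Module.Basis (Fin 4) ℂ h.W, h.IsAdapted e) ∧
    (∀ e : Module.Basis (Fin 4) ℂ h.W, h.IsAdapted e → ∃! S : Tensor4 V, h.IsDiscTensor e S) ∧
    (∀ e : Module.Basis (Fin 4) ℂ h.W, h.IsAdapted e →
      ∀ S : Tensor4 V, h.IsDiscTensor e S →
        {A | A ∈ h.Sp ∧ Tensor4.act A S = S} = (h.SpOneIr e : Set (V →L[ℝ] V)ˣ) ∧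
        {A | A ∈ h.SpSpOne ∧ Tensor4.act A (h.calK S) = h.calK S} =
          (h.SOFourIr e : Set (V →L[ℝ] V)ˣ)) ∧
    ∃ (_ : ChartedSpace (EuclideanSpace ℝ (Fin 7)) h.orbitC)
      (_ : IsManifold (𝓡 7) ∞ h.orbitC),
      Manifold.IsSmoothEmbedding (𝓡 7) 𝓘(ℝ, h.Curv) ∞ (Subtype.val : h.orbitC → h.Curv) ∧
      ∀ e : Module.Basis (Fin 4) ℂ h.W, h.IsAdapted e →
        ∀ S : Tensor4 V, h.IsDiscTensor e S →
          DiffeoToHomogeneous 10 7 h.Sp (h.SpOneIr e) h.Curv h.orbitC (h.calK S) ∧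
          DiffeoToHomogeneous 13 7 h.SpSpOne (h.SOFourIr e) h.Curv h.orbitC (h.calK S) := by
  have hfin : FiniteDimensional ℝ V := Module.finite_of_finrank_pos (by omega)
  have hnt : Nontrivial V := Module.nontrivial_of_finrank_pos (R := ℝ) (by omega)
  obtain ⟨κ, hκ⟩ := h.exists_isFrame hV
  obtain ⟨S₀, hS₀, -⟩ := HyperHermitian.exists_isDiscFor hκ
  obtain ⟨orb₀, φ₀, h₀⟩ := HyperHermitian.exists_isOrbitParam_Sp hκ hS₀
  -- The smooth structure on `𝒞` is fixed here by one auxiliary frame. Its charts are characterized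
  -- by the inclusion into `ℜ` alone, so the same structure serves every adapted basis.
  have hC := h₀.hasAdaptedCharts
  refine ⟨⟨_, h.isAdapted_frameBasis hκ⟩, fun e he => ?_, fun e he S hS => ?_, hC.chartedSpace,
    hC.isManifold, hC.isSmoothEmbedding Topology.IsEmbedding.subtypeVal, fun e he S hS => ?_⟩
  · obtain ⟨S, hS, -⟩ := HyperHermitian.exists_isDiscFor (h.isFrame_coord he)
    exact ⟨S, (HyperHermitian.isDiscTensor_iff_isDiscFor he).2 hS, fun T hT =>
      ((HyperHermitian.isDiscTensor_iff_isDiscFor he).1 hT).unique hS⟩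
  · rw [HyperHermitian.isDiscTensor_iff_isDiscFor he] at hS
    refine ⟨Set.ext fun A => ⟨fun hA => ?_, fun hA => ?_⟩, Set.ext fun A => ?_⟩
    · exact (HyperHermitian.act_eq_self_iff he hS hA.1).1 hA.2
    · have hA' := HyperHermitian.SpOneIr_le_Sp he hA
      exact ⟨hA', (HyperHermitian.act_eq_self_iff he hS hA').2 hA⟩
    · exact HyperHermitian.act_calK_eq_self_iff he hS
  · rw [HyperHermitian.isDiscTensor_iff_isDiscFor he] at hS
    have hf := h.isFrame_coord he
    obtain ⟨orb₁, φ₁, h₁⟩ := HyperHermitian.exists_isOrbitParam_Sp hf hS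
    obtain ⟨orb₂, φ₂, h₂⟩ := HyperHermitian.exists_isOrbitParam_SpSpOne hf hS
    refine ⟨h₁.diffeoToHomogeneous hC rfl _ fun A => ?_,
      h₂.diffeoToHomogeneous hC rfl _ fun A => ?_⟩
    · rw [← HyperHermitian.act_eq_self_iff he hS A.2, ← HyperHermitian.calK_act S A.2]
      exact ⟨HyperHermitian.calK_injOn (hS.isSymType.act A.2) hS.isSymType, fun hA => by rw [hA]⟩
    · rw [← HyperHermitian.act_calK_eq_self_iff he hS]
      exact ⟨fun hA => ⟨A.2, hA⟩, fun hA => hA.2⟩
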